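/- A (polygonal) curve in the plane is a finite nonempty sequence of points of $\mathbb{R}^2$, its vertices; its complexity is the number of its vertices. A warping path between curves $x=(x_1,\dots,x_a)$ and $y=(y_1,\dots,y_b)$ is a sequence of index pairs that starts with $(1,1)$, ends with $(a,b)$, and in which consecutive pairs differ by $(0,1)$, $(1,0)$ or $(1,1)$. The discrete Fréchet distance is $d_{dF}(x,y)=\min_W\max_{(i,j)\in W}\|x_i-y_j\|$, where $W$ ranges over all warping paths between $x$ and $y$. Given curves $g_1,\dots,g_n$ and positive integers $k,\ell$, the $(k,\ell)$-center problem under $d_{dF}$ asks for $k$ curves $c_1,\dots,c_k$ (repetitions allowed), each of complexity at most $\ell$, that minimize the cost $\max_{1\le j\le n}\min_{1\le i\le k} d_{dF}(c_i,g_j)$ among all such families of $k$ curves. Theorem. There are a single program for the real RAM (unit-cost exact $+,-,\times,/$, square roots and comparisons of reals, and addition, subtraction and comparison of integer indices) and an absolute constant $K$ such that for all positive integers $n,m,k,\ell$ and every family $G$ of $n$ curves in the plane with at most $m$ vertices each, the program, given $k$, $\ell$ and $G$, halts and outputs an exact solution $c_1,\dots,c_k$ of the $(k,\ell)$-center problem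 for $G$ under the discrete Fréchet distance, together with its cost; and if $mn\ge 2$, it does so after at most $$K\,(mn)^{2k\ell}\,k\ell\,m\log(mn)$$ steps. -/

import Mathlib

/-! ### Curves in the plane, discrete Fréchet distance, the `(k, ℓ)`-center problem -/

namespace CurveClustering

/-- The Euclidean plane. -/
abbrev Plane : Type := EuclideanSpace ℝ (Fin 2)

/-- A polygonal curve in the plane, given by its nonempty sequence of vertices. The complexity of
a curve is its number of vertices. -/
structure Curve where
  complexity : ℕ
  pos : 0 < complexity
  vertex : Fin complexity → Plane

/-- `q` may follow `p` on a warping path: `q - p` is one of `(0,1)`, `(1,0)`, `(1,1)`. -/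
def WarpStep {a b : ℕ} (p q : Fin a × Fin b) : Prop :=
  (q.1.val = p.1.val ∧ q.2.val = p.2.val + 1) ∨
  (q.1.val = p.1.val + 1 ∧ q.2.val = p.2.val) ∨
  (q.1.val = p.1.val + 1 ∧ q.2.val = p.2.val + 1)

/-- Warping paths between `x` and `y` (vertices are indexed from `0`): sequences of index pairs
from the pair of first vertices to the pair of last vertices, each step being a `WarpStep`. -/
structure IsWarpingPath (x y : Curve) (W : List (Fin x.complexity × Fin y.complexity)) :
    Prop where
  first : ∃ p, W.head? = some p ∧ p.1.val = 0 ∧ p.2.val = 0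
  last : ∃ p, W.getLast? = some p ∧ p.1.val + 1 = x.complexity ∧ p.2.val + 1 = y.complexity
  step : W.IsChain WarpStep

/-- The largest distance of two matched vertices on `W`. Distances are nonnegative, so the
initial value `0` of the maximum does not matter. -/
noncomputable def pathCost (x y : Curve) (W : List (Fin x.complexity × Fin y.complexity)) : ℝ :=
  (W.map fun p => dist (x.vertex p.1) (y.vertex p.2)).foldr max 0

/-- The discrete Fréchet distance: the minimum of `pathCost` over all warping paths. -/
noncomputable def discreteFrechet (x y : Curve) : ℝ :=
  sInf {c | ∃ W, IsWarpingPath x y W ∧ c = pathCost x y W}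

/-- The objective of the center problem: the maximum over the input curves `G` of the distance
to the nearest center curve. -/
noncomputable def centerCost {n k : ℕ} (G : Fin n → Curve) (C : Fin k → Curve) : ℝ :=
  ⨆ g : Fin n, ⨅ i : Fin k, discreteFrechet (C i) (G g)

/-- `C` is a solution of the `(k, ℓ)`-center problem for `G` under the discrete Fréchet distance:
`k` curves of complexity at most `ℓ` whose cost is minimum among all such families. -/
def IsCenterSolution {n k : ℕ} (ℓ : ℕ) (G : Fin n → Curve) (C : Fin k → Curve) : Prop :=
  (∀ i, (C i).complexity ≤ ℓ) ∧
  ∀ C' : Fin k → Curve, (∀ i, (C' i).complexity ≤ ℓ) → centerCost G C ≤ centerCost G C'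

/-- All vertices of a family of curves, one curve after the other. -/
def allVerts {n : ℕ} (G : Fin n → Curve) : List Plane :=
  (List.ofFn G).flatMap fun x => List.ofFn x.vertex

end CurveClustering

/-! ### A real RAM

Programs of a small imperative language. A state has registers and arrays that hold natural
numbers (used as counters and indices) and registers and arrays that hold real numbers.
Natural numbers can be added, subtracted and compared; real numbers allow exact
`+`, `-`, `*`, `/`, square roots and comparisons, all at unit cost. There is no rounding of reals,
no conversion between the two sorts, and only rational constants occur in programs. -/

namespace RealRAM

/-- Register `i` is `nreg i` resp. `rreg i`; cell `i` of array `a` is `nmem a i` resp.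
`rmem a i`. A program names its registers and arrays literally, so it uses finitely many. -/
structure State where
  nreg : ℕ → ℕ
  rreg : ℕ → ℝ
  nmem : ℕ → ℕ → ℕ
  rmem : ℕ → ℕ → ℝ

/-- Expressions for natural numbers. -/
inductive NExpr where
  | const (c : ℕ)
  | reg (r : ℕ)
  | get (a : ℕ) (i : NExpr)
  | add (e f : NExpr)
  | sub (e f : NExpr)

/-- Value of an expression; subtraction is truncated at `0`. -/
def NExpr.eval (s : State) : NExpr → ℕ
  | const c => c
  | reg r => s.nreg r
  | get a i => s.nmem a (i.eval s)
  | add e f => e.eval s + f.eval s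
  | sub e f => e.eval s - f.eval s

/-- Number of operations of an expression. -/
def NExpr.cost : NExpr → ℕ
  | const _ => 1
  | reg _ => 1
  | get _ i => i.cost + 1
  | add e f => e.cost + f.cost + 1
  | sub e f => e.cost + f.cost + 1

/-- Expressions for real numbers. -/
inductive RExpr where
  | const (q : ℚ)
  | reg (r : ℕ)
  | get (a : ℕ) (i : NExpr)
  | add (e f : RExpr)
  | sub (e f : RExpr)
  | mul (e f : RExpr)
  | div (e f : RExpr)
  | sqrt (e : RExpr)

/-- Value of an expression. Division by `0` and roots of negative numbers return `0`; a program
can test for these cases. -/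
noncomputable def RExpr.eval (s : State) : RExpr → ℝ
  | const q => (q : ℝ)
  | reg r => s.rreg r
  | get a i => s.rmem a (i.eval s)
  | add e f => e.eval s + f.eval s
  | sub e f => e.eval s - f.eval s
  | mul e f => e.eval s * f.eval s
  | div e f => e.eval s / f.eval s
  | sqrt e => Real.sqrt (e.eval s)

/-- Number of operations of an expression. -/
def RExpr.cost : RExpr → ℕ
  | const _ => 1
  | reg _ => 1
  | get _ i => i.cost + 1
  | add e f => e.cost + f.cost + 1
  | sub e f => e.cost + f.cost + 1
  | mul e f => e.cost + f.cost + 1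
  | div e f => e.cost + f.cost + 1
  | sqrt e => e.cost + 1

/-- Tests. -/
inductive Test where
  | natLE (e f : NExpr)
  | realLE (e f : RExpr)
  | neg (b : Test)
  | both (b c : Test)

/-- Truth of a test. -/
def Test.Holds (s : State) : Test → Prop
  | natLE e f => e.eval s ≤ f.eval s
  | realLE e f => e.eval s ≤ f.eval s
  | neg b => ¬ b.Holds s
  | both b c => b.Holds s ∧ c.Holds s

/-- Number of operations of a test. -/
def Test.cost : Test → ℕ
  | natLE e f => e.cost + f.cost + 1
  | realLE e f => e.cost + f.cost + 1
  | neg b => b.cost + 1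
  | both b c => b.cost + c.cost + 1

/-- Programs: `setN r e` and `setR r e` assign to registers, `putN a i e` and `putR a i e` assign
to cell `i` of array `a`, `cond` is "if then else" and `loop` is "while". -/
inductive Program where
  | skip
  | setN (r : ℕ) (e : NExpr)
  | setR (r : ℕ) (e : RExpr)
  | putN (a : ℕ) (i e : NExpr)
  | putR (a : ℕ) (i : NExpr) (e : RExpr)
  | seq (p q : Program)
  | cond (b : Test) (p q : Program)
  | loop (b : Test) (p : Program)

/-- `Runs p s s' t`: started in state `s`, the (deterministic) program `p` halts in state `s'`
after exactly `t` steps. -/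
inductive Runs : Program → State → State → ℕ → Prop
  | skip (s : State) : Runs .skip s s 1
  | setN (r : ℕ) (e : NExpr) (s : State) :
      Runs (.setN r e) s { s with nreg := Function.update s.nreg r (e.eval s) } (e.cost + 1)
  | setR (r : ℕ) (e : RExpr) (s : State) :
      Runs (.setR r e) s { s with rreg := Function.update s.rreg r (e.eval s) } (e.cost + 1)
  | putN (a : ℕ) (i e : NExpr) (s : State) :
      Runs (.putN a i e) s
        { s with nmem := Function.update s.nmem a
                    (Function.update (s.nmem a) (i.eval s) (e.eval s)) }
        (i.cost + e.cost + 1)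
  | putR (a : ℕ) (i : NExpr) (e : RExpr) (s : State) :
      Runs (.putR a i e) s
        { s with rmem := Function.update s.rmem a
                    (Function.update (s.rmem a) (i.eval s) (e.eval s)) }
        (i.cost + e.cost + 1)
  | seq {p q : Program} {s s₁ s₂ : State} {t₁ t₂ : ℕ}
      (hp : Runs p s s₁ t₁) (hq : Runs q s₁ s₂ t₂) : Runs (.seq p q) s s₂ (t₁ + t₂)
  | condTrue {b : Test} {p q : Program} {s s₁ : State} {t : ℕ}
      (hb : b.Holds s) (hp : Runs p s s₁ t) : Runs (.cond b p q) s s₁ (b.cost + t + 1)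
  | condFalse {b : Test} {p q : Program} {s s₁ : State} {t : ℕ}
      (hb : ¬ b.Holds s) (hq : Runs q s s₁ t) : Runs (.cond b p q) s s₁ (b.cost + t + 1)
  | loopDone {b : Test} {p : Program} {s : State}
      (hb : ¬ b.Holds s) : Runs (.loop b p) s s (b.cost + 1)
  | loopStep {b : Test} {p : Program} {s s₁ s₂ : State} {t₁ t₂ : ℕ}
      (hb : b.Holds s) (hp : Runs p s s₁ t₁) (hl : Runs (.loop b p) s₁ s₂ t₂) :
      Runs (.loop b p) s s₂ (b.cost + t₁ + t₂ + 1)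

end RealRAM

/-! ### Input and output of a program for the `(k, ℓ)`-center problem -/

namespace CurveClustering

/-- The initial state: the number `n` of input curves, `k` and `ℓ` are in registers `0`, `1`, `2`,
the complexities of the curves in array `0`, and the `x`- and `y`-coordinates of all vertices, one
curve after the other, in the real arrays `0` and `1`. Everything else is `0`. -/
noncomputable def inputState {n : ℕ} (k ℓ : ℕ) (G : Fin n → Curve) : RealRAM.State where
  nreg r := if r = 0 then n else if r = 1 then k else if r = 2 then ℓ else 0
  rreg _ := 0
  nmem a i := if h : a = 0 ∧ i < n then (G ⟨i, h.2⟩).complexity else 0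
  rmem a j :=
    if h : j < (allVerts G).length then
      if a = 0 then ((allVerts G)[j]) 0 else if a = 1 then ((allVerts G)[j]) 1 else 0
    else 0

/-- The state `s` presents the curves `C` and the number `r` as output: the complexities of the
curves are in array `1`, the `x`- and `y`-coordinates of all their vertices, one curve after
the other, in the real arrays `2` and `3`, and `r` is in the real register `0`. -/
def Outputs {k : ℕ} (s : RealRAM.State) (C : Fin k → Curve) (r : ℝ) : Prop :=
  (∀ i : Fin k, s.nmem 1 i = (C i).complexity) ∧
  (∀ (j : ℕ) (h : j < (allVerts C).length),
    s.rmem 2 j = ((allVerts C)[j]) 0 ∧ s.rmem 3 j = ((allVerts C)[j]) 1) ∧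
  s.rreg 0 = r

end CurveClustering

/-! ### Reasoning about programs -/

namespace RealRAM

/-! Let `N ≤ m * n` be the number of input points. By `discreteFrechet_le_iff`, a discrete Fréchet
distance is at most `r` iff the end of the table of pairs at distance at most `r` is reachable
(`Reach`). So the cost of a family of centers depends only on which input points are close to which
center vertices, and moving a center vertex without losing a close point does no harm (`Feas.snap`).
Centers with fewer than `ℓ` vertices may repeat their last vertex (`Reach.pad`), so there are
exactly `k * ℓ` center vertices.

Optimal radius. Given centers of cost `c`, move each vertex to the center of the smallest disk
around the input points within `c` of it. The largest radius of these disks is at most `c` and still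
feasible. A smallest enclosing disk is determined by at most three points, so the optimum is among
the at most `N ^ 3` values of `critRadius` (`isCritList_of_critRadius`). They are sorted, and a
binary search finds the smallest feasible one with `O(log (m * n))` decisions (`searchRadius_spec`).

Decision for a radius `r`. The leftmost point of an intersection of disks of radius `r` is
determined by an ordered pair of their centers (`exists_cand`), so `N ^ 2` candidates suffice for a
center vertex. They are enumerated for all center vertices except for the last one. Once these are
fixed, a curve not served by one of the first `k - 1` centers should have as long a prefix as
possible matched with the first `ℓ - 1` vertices of the last center; the rest of the curve, and its
final vertex in any case, must be close to the last center vertex (`feas_of_marked`,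
`marked_of_feas`). A point close to all of these exists iff their smallest enclosing disk has radius
at most `r`, and this disk is found in `O(N ^ 2)` steps (`smallestDisk_spec`). Thus `N ^ (2 * (k * ℓ
- 1))` tuples at `O(k * ℓ * (m * n) ^ 2)` steps each give `O((m * n) ^ (2 * k * ℓ) * k * ℓ)` steps
per decision (`decideRadius_spec`). If `k * ℓ = 1`, a list of `N ^ 3` radii would be too long, but
then the smallest disk around all points gives the optimum. The factor `m` of the claimed bound is
slack.

The programs are verified by Hoare rules for total correctness with step counts (`Wp`) and by
syntactic frame conditions (`Frame`). -/

instance : Add NExpr := ⟨NExpr.add⟩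
instance : Sub NExpr := ⟨NExpr.sub⟩
instance : Add RExpr := ⟨RExpr.add⟩
instance : Sub RExpr := ⟨RExpr.sub⟩
instance : Mul RExpr := ⟨RExpr.mul⟩
instance : Div RExpr := ⟨RExpr.div⟩

attribute [simp] NExpr.eval RExpr.eval Test.Holds

@[simp] theorem NExpr.eval_add' (e f : NExpr) (s : State) :
    (e + f).eval s = e.eval s + f.eval s := rfl
@[simp] theorem NExpr.eval_sub' (e f : NExpr) (s : State) :
    (e - f).eval s = e.eval s - f.eval s := rfl
@[simp] theorem RExpr.eval_add' (e f : RExpr) (s : State) :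
    (e + f).eval s = e.eval s + f.eval s := rfl
@[simp] theorem RExpr.eval_sub' (e f : RExpr) (s : State) :
    (e - f).eval s = e.eval s - f.eval s := rfl
@[simp] theorem RExpr.eval_mul' (e f : RExpr) (s : State) :
    (e * f).eval s = e.eval s * f.eval s := rfl
@[simp] theorem RExpr.eval_div' (e f : RExpr) (s : State) :
    (e / f).eval s = e.eval s / f.eval s := rfl

/-- Sequential composition. -/
infixr:60 " ;; " => Program.seq

/-- Natural number registers a program may write. -/
def Program.wn : Program → List ℕ
  | .setN r _ => [r]
  | .seq p q => p.wn ++ q.wn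
  | .cond _ p q => p.wn ++ q.wn
  | .loop _ p => p.wn
  | _ => []

/-- Real registers a program may write. -/
def Program.wr : Program → List ℕ
  | .setR r _ => [r]
  | .seq p q => p.wr ++ q.wr
  | .cond _ p q => p.wr ++ q.wr
  | .loop _ p => p.wr
  | _ => []

/-- Arrays of natural numbers a program may write. -/
def Program.wna : Program → List ℕ
  | .putN a _ _ => [a]
  | .seq p q => p.wna ++ q.wna
  | .cond _ p q => p.wna ++ q.wna
  | .loop _ p => p.wna
  | _ => []

/-- Arrays of real numbers a program may write. -/
def Program.wra : Program → List ℕ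
  | .putR a _ _ => [a]
  | .seq p q => p.wra ++ q.wra
  | .cond _ p q => p.wra ++ q.wra
  | .loop _ p => p.wra
  | _ => []

/-- `s'` differs from `s` only where `p` may write. -/
structure Frame (p : Program) (s s' : State) : Prop where
  nreg : ∀ r, r ∉ p.wn → s'.nreg r = s.nreg r
  rreg : ∀ r, r ∉ p.wr → s'.rreg r = s.rreg r
  nmem : ∀ a, a ∉ p.wna → s'.nmem a = s.nmem a
  rmem : ∀ a, a ∉ p.wra → s'.rmem a = s.rmem a

theorem Frame.refl (p : Program) (s : State) : Frame p s s :=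
  ⟨fun _ _ => rfl, fun _ _ => rfl, fun _ _ => rfl, fun _ _ => rfl⟩

theorem Frame.trans {p : Program} {s s₁ s₂ : State} (h : Frame p s s₁) (h' : Frame p s₁ s₂) :
    Frame p s s₂ :=
  ⟨fun r hr => (h'.nreg r hr).trans (h.nreg r hr), fun r hr => (h'.rreg r hr).trans (h.rreg r hr),
   fun r hr => (h'.nmem r hr).trans (h.nmem r hr), fun r hr => (h'.rmem r hr).trans (h.rmem r hr)⟩

theorem Frame.mono {p q : Program} {s s' : State} (h : Frame p s s')
    (h1 : p.wn ⊆ q.wn) (h2 : p.wr ⊆ q.wr) (h3 : p.wna ⊆ q.wna) (h4 : p.wra ⊆ q.wra) :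
    Frame q s s' :=
  ⟨fun r hr => h.nreg r fun h' => hr (h1 h'), fun r hr => h.rreg r fun h' => hr (h2 h'),
   fun r hr => h.nmem r fun h' => hr (h3 h'), fun r hr => h.rmem r fun h' => hr (h4 h')⟩

theorem Frame.seqLeft {p q : Program} {s s' : State} (h : Frame p s s') : Frame (p ;; q) s s' :=
  h.mono (List.subset_append_left _ _) (List.subset_append_left _ _)
    (List.subset_append_left _ _) (List.subset_append_left _ _)

theorem Frame.seqRight {p q : Program} {s s' : State} (h : Frame q s s') : Frame (p ;; q) s s' :=
  h.mono (List.subset_append_right _ _) (List.subset_append_right _ _)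
    (List.subset_append_right _ _) (List.subset_append_right _ _)

/-- The write sets of a concrete program are lists of literals, so later on `decide` settles that a
register or an array keeps its value. -/
theorem Runs.frame {p : Program} {s s' : State} {t : ℕ} (h : Runs p s s' t) : Frame p s s' := by
  induction h with
  | skip s => exact Frame.refl _ _
  | setN r e s =>
    refine ⟨fun r' hr => ?_, fun _ _ => rfl, fun _ _ => rfl, fun _ _ => rfl⟩
    simp only [Program.wn, List.mem_singleton] at hr
    simp [hr]
  | setR r e s =>
    refine ⟨fun _ _ => rfl, fun r' hr => ?_, fun _ _ => rfl, fun _ _ => rfl⟩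
    simp only [Program.wr, List.mem_singleton] at hr
    simp [hr]
  | putN a i e s =>
    refine ⟨fun _ _ => rfl, fun _ _ => rfl, fun r' hr => ?_, fun _ _ => rfl⟩
    simp only [Program.wna, List.mem_singleton] at hr
    simp [hr]
  | putR a i e s =>
    refine ⟨fun _ _ => rfl, fun _ _ => rfl, fun _ _ => rfl, fun r' hr => ?_⟩
    simp only [Program.wra, List.mem_singleton] at hr
    simp [hr]
  | seq hp hq ihp ihq => exact ihp.seqLeft.trans ihq.seqRight
  | condTrue hb hp ih =>
    exact ih.mono (List.subset_append_left _ _) (List.subset_append_left _ _)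
      (List.subset_append_left _ _) (List.subset_append_left _ _)
  | condFalse hb hp ih =>
    exact ih.mono (List.subset_append_right _ _) (List.subset_append_right _ _)
      (List.subset_append_right _ _) (List.subset_append_right _ _)
  | loopDone hb => exact Frame.refl _ _
  | loopStep hb hp hl ih ih' => exact Frame.trans ⟨ih.1, ih.2, ih.3, ih.4⟩ ih'

/-- Started in `s`, the program `p` halts within `T` steps in a state that satisfies `Q`. -/
def Wp (p : Program) (s : State) (T : ℕ) (Q : State → Prop) : Prop :=
  ∃ s' t, Runs p s s' t ∧ t ≤ T ∧ Q s'

theorem Wp.imp {p : Program} {s : State} {T T' : ℕ} {Q Q' : State → Prop} (h : Wp p s T Q)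
    (hT : T ≤ T') (hQ : ∀ s', Q s' → Frame p s s' → Q' s') : Wp p s T' Q' := by
  obtain ⟨s', t, hr, ht, hq⟩ := h
  exact ⟨s', t, hr, ht.trans hT, hQ s' hq hr.frame⟩

theorem Wp.seq {p q : Program} {s : State} {T T₁ T₂ : ℕ} {Q₁ Q : State → Prop}
    (hp : Wp p s T₁ Q₁) (hT : T₁ + T₂ ≤ T) (hq : ∀ s₁, Q₁ s₁ → Frame p s s₁ → Wp q s₁ T₂ Q) :
    Wp (p ;; q) s T Q := by
  obtain ⟨s₁, t₁, hr, ht, h₁⟩ := hp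
  obtain ⟨s₂, t₂, hr', ht', h₂⟩ := hq s₁ h₁ hr.frame
  exact ⟨s₂, t₁ + t₂, hr.seq hr', by omega, h₂⟩

theorem Wp.cond {b : Test} {p q : Program} {s : State} {T T₁ : ℕ} {Q : State → Prop}
    (hT : b.cost + T₁ + 1 ≤ T) (hp : b.Holds s → Wp p s T₁ Q) (hq : ¬ b.Holds s → Wp q s T₁ Q) :
    Wp (.cond b p q) s T Q := by
  by_cases hb : b.Holds s
  · obtain ⟨s', t, hr, ht, h⟩ := hp hb
    exact ⟨s', _, .condTrue hb hr, by omega, h⟩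
  · obtain ⟨s', t, hr, ht, h⟩ := hq hb
    exact ⟨s', _, .condFalse hb hr, by omega, h⟩

/-- Termination comes from the round counter `j`: the guard can hold only while `j < n`. The step
hypothesis also receives the frame relative to the start of the loop, so invariants need not mention
what the body never writes. The proof is by induction on the number `d` of remaining rounds. -/
theorem Wp.loop {b : Test} {p : Program} (n B : ℕ) (I : ℕ → State → Prop) {s₀ : State}
    (h₀ : I 0 s₀)
    (hstep : ∀ j s, I j s → Frame (.loop b p) s₀ s → b.Holds s → j < n ∧ Wp p s B (I (j + 1))) :
    Wp (.loop b p) s₀ (n * (B + b.cost + 1) + b.cost + 1)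
      (fun s' => ∃ j, j ≤ n ∧ I j s' ∧ ¬ b.Holds s') := by
  have key : ∀ d j s, j + d = n → I j s → Frame (.loop b p) s₀ s →
      Wp (.loop b p) s (d * (B + b.cost + 1) + b.cost + 1)
        (fun s' => ∃ j, j ≤ n ∧ I j s' ∧ ¬ b.Holds s') := by
    intro d
    induction d with
    | zero =>
      intro j s hj hI hF
      have hb : ¬ b.Holds s := fun hb => by have := (hstep j s hI hF hb).1; omega
      exact ⟨s, _, .loopDone hb, by omega, j, by omega, hI, hb⟩
    | succ d ih =>
      intro j s hj hI hF
      by_cases hb : b.Holds s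
      · obtain ⟨-, s₁, t₁, hr, ht, h₁⟩ := hstep j s hI hF hb
        have hF₁ : Frame (.loop b p) s₀ s₁ :=
          hF.trans ⟨hr.frame.1, hr.frame.2, hr.frame.3, hr.frame.4⟩
        obtain ⟨s₂, t₂, hr', ht', h₂⟩ := ih (j + 1) s₁ (by omega) h₁ hF₁
        refine ⟨s₂, _, .loopStep hb hr hr', ?_, h₂⟩
        rw [Nat.succ_mul]; omega
      · exact ⟨s, _, .loopDone hb, by omega, j, by omega, hI, hb⟩
  exact key n 0 s₀ (by omega) h₀ (Frame.refl _ _)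

/-- Programs without loops. -/
def Program.Basic : Program → Bool
  | .seq p q => p.Basic && q.Basic
  | .cond _ p q => p.Basic && q.Basic
  | .loop _ _ => false
  | _ => true

/-- A bound for the running time of a program without loops. -/
def Program.bcost : Program → ℕ
  | .skip => 1
  | .setN _ e => e.cost + 1
  | .setR _ e => e.cost + 1
  | .putN _ i e => i.cost + e.cost + 1
  | .putR _ i e => i.cost + e.cost + 1
  | .seq p q => p.bcost + q.bcost
  | .cond b p q => b.cost + max p.bcost q.bcost + 1
  | .loop _ _ => 0

open Classical in
/-- The final state of a program without loops. -/
noncomputable def Program.run : Program → State → State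
  | .skip, s => s
  | .setN r e, s => { s with nreg := Function.update s.nreg r (e.eval s) }
  | .setR r e, s => { s with rreg := Function.update s.rreg r (e.eval s) }
  | .putN a i e, s =>
    let c := Function.update (s.nmem a) (i.eval s) (e.eval s)
    { s with nmem := Function.update s.nmem a c }
  | .putR a i e, s =>
    let c := Function.update (s.rmem a) (i.eval s) (e.eval s)
    { s with rmem := Function.update s.rmem a c }
  | .seq p q, s => q.run (p.run s)
  | .cond b p q, s => if b.Holds s then p.run s else q.run s
  | .loop _ _, s => s

theorem Wp.run {p : Program} (hp : p.Basic = true) (s : State) :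
    Wp p s p.bcost (fun s' => s' = p.run s) := by
  induction p generalizing s with
  | skip => exact ⟨_, _, .skip s, le_rfl, rfl⟩
  | setN r e => exact ⟨_, _, .setN r e s, le_rfl, rfl⟩
  | setR r e => exact ⟨_, _, .setR r e s, le_rfl, rfl⟩
  | putN a i e => exact ⟨_, _, .putN a i e s, le_rfl, rfl⟩
  | putR a i e => exact ⟨_, _, .putR a i e s, le_rfl, rfl⟩
  | seq p q ihp ihq =>
    simp only [Program.Basic, Bool.and_eq_true] at hp
    refine Wp.seq (ihp hp.1 s) le_rfl ?_
    rintro _ rfl -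
    exact ihq hp.2 _
  | cond b p q ihp ihq =>
    simp only [Program.Basic, Bool.and_eq_true] at hp
    refine Wp.cond (le_refl _) (fun hb => ?_) (fun hb => ?_)
    · exact (ihp hp.1 s).imp (le_max_left _ _) (by rintro _ rfl -; simp [Program.run, hb])
    · exact (ihq hp.2 s).imp (le_max_right _ _) (by rintro _ rfl -; simp [Program.run, hb])
  | loop b p => simp [Program.Basic] at hp

/-- Loop-free code is verified by symbolic execution: `simp` unfolds `Program.run`, and `decide`
checks the step count. -/
theorem Wp.basic {p : Program} {s : State} {T : ℕ} {Q : State → Prop} (hp : p.Basic = true)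
    (hT : p.bcost ≤ T) (hQ : Q (p.run s)) : Wp p s T Q :=
  (Wp.run hp s).imp hT (by rintro _ rfl -; exact hQ)

/-- `e < f` -/
def Test.natLT (e f : NExpr) : Test := .natLE (e + .const 1) f

@[simp] theorem Test.holds_natLT (e f : NExpr) (s : State) :
    (Test.natLT e f).Holds s ↔ e.eval s < f.eval s := Nat.succ_le_iff

/-- `for i := 0 to (value of register b) - 1 do p` -/
def Program.forN (i b : ℕ) (p : Program) : Program :=
  .setN i (.const 0) ;; .loop (.natLT (.reg i) (.reg b)) (p ;; .setN i (.reg i + .const 1))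

/-- The state `s` with register `i` set to `v`. -/
def State.setN (s : State) (i v : ℕ) : State := { s with nreg := Function.update s.nreg i v }

@[simp] theorem State.setN_nreg (s : State) (i v : ℕ) :
    (s.setN i v).nreg = Function.update s.nreg i v := rfl
@[simp] theorem State.setN_rreg (s : State) (i v : ℕ) : (s.setN i v).rreg = s.rreg := rfl
@[simp] theorem State.setN_nmem (s : State) (i v : ℕ) : (s.setN i v).nmem = s.nmem := rfl
@[simp] theorem State.setN_rmem (s : State) (i v : ℕ) : (s.setN i v).rmem = s.rmem := rfl

/-- Rule for counting loops. The invariant must not depend on the loop counter's register. -/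
theorem Wp.forN {i b : ℕ} {p : Program} {n T B : ℕ} {s₀ : State} {Q : State → Prop}
    (I : ℕ → State → Prop)
    (hb : s₀.nreg b = n) (hi : i ∉ p.wn) (hib : b ∉ i :: p.wn)
    (hI : ∀ j s v, I j s → I j (s.setN i v))
    (h₀ : I 0 s₀)
    (hstep : ∀ j s, j < n → I j s → Frame (Program.forN i b p) s₀ s → s.nreg i = j →
      Wp p s B (I (j + 1)))
    (hT : n * (B + 10) + 8 ≤ T)
    (hQ : ∀ s, I n s → Frame (Program.forN i b p) s₀ s → Q s) :
    Wp (Program.forN i b p) s₀ T Q := by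
  simp only [List.mem_cons, not_or] at hib
  -- A round costs `5` for the test, `4` for the increment and `1` for the loop besides the body.
  -- The summand `8` is `2` for the initialization and `6` for the final failing test.
  have main : Wp (Program.forN i b p) s₀ (n * (B + 10) + 8) (I n) := by
    refine Wp.seq (T₁ := 2) (T₂ := n * (B + 10) + 6) (Q₁ := fun s => s = s₀.setN i 0)
      (Wp.basic rfl le_rfl rfl) (by omega) ?_
    rintro _ rfl hF₀
    have hbn : ∀ s, Frame (.loop (.natLT (.reg i) (.reg b)) (p ;; .setN i (.reg i + .const 1)))
        (s₀.setN i 0) s → s.nreg b = n := by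
      intro s hF
      rw [hF.nreg b (by simp [Program.wn, hib.1, hib.2])]
      simp [hib.1, hb]
    refine (Wp.loop n (B + 4) (fun j s => I j s ∧ s.nreg i = j ∧ j ≤ n)
      ⟨hI _ _ _ h₀, by simp, by omega⟩ ?_).imp (T := _) ?_ ?_
    · rintro j s ⟨hj, hij, -⟩ hF hlt
      simp only [Test.holds_natLT, NExpr.eval, hij, hbn s hF] at hlt
      refine ⟨hlt, Wp.seq (hstep j s hlt hj ?_ hij) (T₂ := 4) le_rfl ?_⟩
      · exact hF₀.seqLeft.trans hF.seqRight
      · intro s₁ h₁ hF₁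
        have hc : s₁.nreg i = j := by rw [hF₁.nreg i hi, hij]
        refine Wp.basic rfl le_rfl ?_
        have hr : (Program.setN i (.reg i + .const 1)).run s₁ = s₁.setN i (j + 1) := by
          simp [Program.run, State.setN, hc]
        rw [hr]
        exact ⟨hI _ _ _ h₁, by simp, hlt⟩
    · exact le_refl (n * (B + 10) + 6)
    · rintro s ⟨j, -, ⟨hj, hij, hjn⟩, hnb⟩ hF
      simp only [Test.holds_natLT, NExpr.eval, hij, hbn s hF] at hnb
      obtain rfl : j = n := by omega
      exact hj
  exact main.imp hT fun s h hF => hQ s h hF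

end RealRAM

/-! ### Plane geometry in coordinates -/

namespace PlaneGeometry

/-- Squared distance of two points. -/
def sqd (px py qx qy : ℝ) : ℝ := (px - qx) * (px - qx) + (py - qy) * (py - qy)

/-- Distance of two points. -/
noncomputable def pdist (px py qx qy : ℝ) : ℝ := √(sqd px py qx qy)

/-- Twice the signed area of the triangle `a e q`; positive if `q` is to the left of `a e`. -/
def cross (ax ay ex ey qx qy : ℝ) : ℝ := (ex - ax) * (qy - ay) - (ey - ay) * (qx - ax)

/-- The inner product of `a - q` and `e - q`. -/
def apex (ax ay ex ey qx qy : ℝ) : ℝ := (qx - ax) * (qx - ex) + (qy - ay) * (qy - ey)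

/-- Abscissa of a point on the perpendicular bisector of `a e`. -/
noncomputable def bisX (ax ay ex ey t : ℝ) : ℝ := (ax + ex) / 2 - t * (ey - ay)

/-- Ordinate of a point on the perpendicular bisector of `a e`. -/
noncomputable def bisY (ax ay ex ey t : ℝ) : ℝ := (ay + ey) / 2 + t * (ex - ax)

/-- Position of the circumcenter of `a e q` on the perpendicular bisector of `a e`. -/
noncomputable def circumPar (ax ay ex ey qx qy : ℝ) : ℝ :=
  apex ax ay ex ey qx qy / cross ax ay ex ey qx qy / 2

/-- The circumradius of `a e q`. If `a e q` are collinear, half the distance of `a` and `e`. -/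
noncomputable def critRadius (ax ay ex ey qx qy : ℝ) : ℝ :=
  pdist (bisX ax ay ex ey (circumPar ax ay ex ey qx qy))
    (bisY ax ay ex ey (circumPar ax ay ex ey qx qy)) ax ay

theorem sqd_nonneg (px py qx qy : ℝ) : 0 ≤ sqd px py qx qy :=
  add_nonneg (mul_self_nonneg _) (mul_self_nonneg _)

theorem pdist_nonneg (px py qx qy : ℝ) : 0 ≤ pdist px py qx qy := Real.sqrt_nonneg _

theorem sqd_comm (px py qx qy : ℝ) : sqd px py qx qy = sqd qx qy px py := by
  unfold sqd; ring

theorem pdist_le_iff {px py qx qy r : ℝ} (hr : 0 ≤ r) :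
    pdist px py qx qy ≤ r ↔ sqd px py qx qy ≤ r * r := by
  unfold pdist
  rw [Real.sqrt_le_left hr, sq]

theorem pdist_le_pdist_iff {px py qx qy ax ay ex ey : ℝ} :
    pdist px py qx qy ≤ pdist ax ay ex ey ↔ sqd px py qx qy ≤ sqd ax ay ex ey :=
  Real.sqrt_le_sqrt_iff (sqd_nonneg _ _ _ _)

theorem eq_of_sqd_le_zero {px py qx qy : ℝ} (h : sqd px py qx qy ≤ 0) : px = qx ∧ py = qy := by
  unfold sqd at h
  constructor <;> nlinarith [mul_self_nonneg (px - qx), mul_self_nonneg (py - qy)]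

/-- The power of `q` with respect to the circle through `a` and `e` is affine in the position `t` of
the center on the bisector. So `q` is in the disk iff `apex ≤ 2 * t * cross`: points to the left of
`a e` bound `t` from below, those to the right bound it from above. -/
theorem sqd_bis_sub (ax ay ex ey t qx qy : ℝ) :
    sqd (bisX ax ay ex ey t) (bisY ax ay ex ey t) qx qy
      - sqd (bisX ax ay ex ey t) (bisY ax ay ex ey t) ax ay
      = apex ax ay ex ey qx qy - 2 * t * cross ax ay ex ey qx qy := by
  unfold sqd bisX bisY apex cross; ring

theorem sqd_bis_eq (ax ay ex ey t : ℝ) :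
    sqd (bisX ax ay ex ey t) (bisY ax ay ex ey t) ax ay =
      sqd (bisX ax ay ex ey t) (bisY ax ay ex ey t) ex ey := by
  unfold sqd bisX bisY; ring

/-- A disk with chord `a e` is described by the position of its center on the bisector. -/
theorem exists_bisector_par {ax ay ex ey cx cy : ℝ} (hab : 0 < sqd ax ay ex ey)
    (he : sqd cx cy ax ay = sqd cx cy ex ey) (hc : 0 ≤ cross ax ay ex ey cx cy) :
    ∃ t, 0 ≤ t ∧ ∀ qx qy, sqd cx cy qx qy ≤ sqd cx cy ax ay →
      apex ax ay ex ey qx qy ≤ 2 * t * cross ax ay ex ey qx qy := by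
  -- This is the signed distance of `c` from the line `a e` divided by the length of the chord.
  refine ⟨cross ax ay ex ey cx cy / sqd ax ay ex ey, div_nonneg hc hab.le, fun qx qy hq => ?_⟩
  have key : sqd ax ay ex ey * (apex ax ay ex ey qx qy - (sqd cx cy qx qy - sqd cx cy ax ay)) =
      2 * (cross ax ay ex ey cx cy * cross ax ay ex ey qx qy) := by
    unfold sqd cross apex at *
    linear_combination ((ex - ax) * (qx - ax) + (ey - ay) * (qy - ay)) * he
  have : 2 * (cross ax ay ex ey cx cy / sqd ax ay ex ey) * cross ax ay ex ey qx qy =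
      apex ax ay ex ey qx qy - (sqd cx cy qx qy - sqd cx cy ax ay) := by
    field_simp
    linarith
  linarith

/-- Points of the circumdisk of the counterclockwise triangle `a e p` that are not to the left of
`a e` are not to the left of `p e`. -/
theorem cross_nonpos_first {ax ay ex ey px py cx cy qx qy : ℝ}
    (hp : 0 < cross ax ay ex ey px py)
    (ha : sqd cx cy ax ay = sqd cx cy ex ey) (he : sqd cx cy px py = sqd cx cy ex ey)
    (hq : sqd cx cy qx qy ≤ sqd cx cy ex ey) (hs : cross ax ay ex ey qx qy ≤ 0) :
    cross px py ex ey qx qy ≤ 0 := by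
  by_contra hcon
  push Not at hcon
  -- The incircle determinant of `a`, `e`, `p`, `q` with origin `e`, expanded along its column of
  -- squared lengths. If `q` were to the left of `p e`, the right side would be positive, but the
  -- left side is not because `q` is in the disk.
  have key : cross ax ay ex ey px py * (sqd cx cy qx qy - sqd cx cy ex ey) =
      cross ax ay ex ey px py * sqd qx qy ex ey
      + cross px py ex ey qx qy * sqd ax ay ex ey
      - cross ax ay ex ey qx qy * sqd px py ex ey := by
    unfold sqd cross at *
    linear_combination -((ex - px) * (qy - py) - (ey - py) * (qx - px)) * ha
      + ((ex - ax) * (qy - ay) - (ey - ay) * (qx - ax)) * he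
  have h1 : cross ax ay ex ey px py * (sqd cx cy qx qy - sqd cx cy ex ey) ≤ 0 :=
    mul_nonpos_of_nonneg_of_nonpos hp.le (by linarith)
  have h2 : 0 < sqd ax ay ex ey := by
    rcases (sqd_nonneg ax ay ex ey).lt_or_eq with h | h
    · exact h
    · obtain ⟨rfl, rfl⟩ := eq_of_sqd_le_zero h.ge
      simp [cross] at hp
  have h3 := mul_pos hcon h2
  have h4 := mul_nonneg hp.le (sqd_nonneg qx qy ex ey)
  have h5 := mul_nonpos_of_nonpos_of_nonneg hs (sqd_nonneg px py ex ey)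
  linarith

/-- Points of the circumdisk of the counterclockwise triangle `a e p` that are not to the left of
`a e` are not to the left of `a p`. -/
theorem cross_nonpos_second {ax ay ex ey px py cx cy qx qy : ℝ}
    (hp : 0 < cross ax ay ex ey px py)
    (hb : sqd cx cy ex ey = sqd cx cy ax ay) (he : sqd cx cy px py = sqd cx cy ax ay)
    (hq : sqd cx cy qx qy ≤ sqd cx cy ax ay) (hs : cross ax ay ex ey qx qy ≤ 0) :
    cross ax ay px py qx qy ≤ 0 := by
  by_contra hcon
  push Not at hcon
  have key : cross ax ay ex ey px py * (sqd cx cy qx qy - sqd cx cy ax ay) =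
      cross ax ay ex ey px py * sqd qx qy ax ay
      + cross ax ay px py qx qy * sqd ex ey ax ay
      - cross ax ay ex ey qx qy * sqd px py ax ay := by
    unfold sqd cross at *
    linear_combination -((px - ax) * (qy - ay) - (py - ay) * (qx - ax)) * hb
      + ((ex - ax) * (qy - ay) - (ey - ay) * (qx - ax)) * he
  have h1 : cross ax ay ex ey px py * (sqd cx cy qx qy - sqd cx cy ax ay) ≤ 0 :=
    mul_nonpos_of_nonneg_of_nonpos hp.le (by linarith)
  have h2 : 0 < sqd ex ey ax ay := by
    rcases (sqd_nonneg ex ey ax ay).lt_or_eq with h | h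
    · exact h
    · obtain ⟨rfl, rfl⟩ := eq_of_sqd_le_zero h.ge
      simp [cross] at hp
  have h3 := mul_pos hcon h2
  have h4 := mul_nonneg hp.le (sqd_nonneg qx qy ax ay)
  have h5 := mul_nonpos_of_nonpos_of_nonneg hs (sqd_nonneg px py ax ay)
  linarith

/-- If the angle of the counterclockwise triangle `a e p` at `a` is obtuse, then the circumcenter
is to the left of `p e`. -/
theorem cross_center_first {ax ay ex ey px py cx cy : ℝ} (hp : 0 < cross ax ay ex ey px py)
    (ha : sqd cx cy ax ay = sqd cx cy ex ey) (he : sqd cx cy px py = sqd cx cy ex ey)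
    (ho : apex ex ey px py ax ay < 0) : 0 ≤ cross px py ex ey cx cy := by
  -- Up to positive factors, the signed distance of the circumcenter from the side `p e` is minus
  -- the cosine of the opposite angle.
  have key : 2 * (cross ax ay ex ey px py * cross px py ex ey cx cy) =
      sqd ex ey px py * (-apex ex ey px py ax ay) := by
    unfold sqd cross apex at *
    linear_combination ((px - ex) * (px - ex) + (py - ey) * (py - ey)) * ha
      - ((ax - ex) * (px - ex) + (ay - ey) * (py - ey)) * he
  have h1 := mul_nonneg (sqd_nonneg ex ey px py) (neg_pos.2 ho).le
  by_contra hcon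
  push Not at hcon
  have := mul_neg_of_pos_of_neg hp hcon
  linarith

/-- If the angle of the counterclockwise triangle `a e p` at `e` is obtuse, then the circumcenter
is to the left of `a p`. -/
theorem cross_center_second {ax ay ex ey px py cx cy : ℝ} (hp : 0 < cross ax ay ex ey px py)
    (hb : sqd cx cy ex ey = sqd cx cy ax ay) (he : sqd cx cy px py = sqd cx cy ax ay)
    (ho : apex ax ay px py ex ey < 0) : 0 ≤ cross ax ay px py cx cy := by
  have key : 2 * (cross ax ay ex ey px py * cross ax ay px py cx cy) =
      sqd ax ay px py * (-apex ax ay px py ex ey) := by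
    unfold sqd cross apex at *
    linear_combination ((px - ax) * (px - ax) + (py - ay) * (py - ay)) * hb
      - ((ex - ax) * (px - ax) + (ey - ay) * (py - ay)) * he
  have h1 := mul_nonneg (sqd_nonneg ax ay px py) (neg_pos.2 ho).le
  by_contra hcon
  push Not at hcon
  have := mul_neg_of_pos_of_neg hp hcon
  linarith

/-- A disk that contains `a` and `e` has at least the radius of the disk with diameter `a e`. -/
theorem diameter_le {ax ay ex ey x y ρ : ℝ} (ha : sqd x y ax ay ≤ ρ) (hb : sqd x y ex ey ≤ ρ) :
    sqd (bisX ax ay ex ey 0) (bisY ax ay ex ey 0) ax ay ≤ ρ := by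
  unfold sqd bisX bisY at *
  -- Median formula: the mean of the squared distances to `a` and `e` is the squared distance to the
  -- midpoint plus the squared half chord.
  nlinarith [mul_self_nonneg (x - (ax + ex) / 2), mul_self_nonneg (y - (ay + ey) / 2)]

/-- A disk that contains a nonobtuse triangle has at least the radius of the circumdisk. -/
theorem circumradius_le {ax ay ex ey px py cx cy x y ρ : ℝ}
    (hp : 0 < cross ax ay ex ey px py)
    (hb : sqd cx cy ex ey = sqd cx cy ax ay) (he : sqd cx cy px py = sqd cx cy ax ay)
    (oa : 0 ≤ apex ex ey px py ax ay) (ob : 0 ≤ apex ax ay px py ex ey)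
    (op : 0 ≤ apex ax ay ex ey px py)
    (ha' : sqd x y ax ay ≤ ρ) (hb' : sqd x y ex ey ≤ ρ) (hp' : sqd x y px py ≤ ρ) :
    sqd cx cy ax ay ≤ ρ := by
  set D := cross ax ay ex ey px py with hD
  -- `la`, `lb`, `lp` are unnormalized barycentric coordinates of the circumcenter. They are
  -- nonnegative because no angle is obtuse.
  set la := sqd ex ey px py * apex ex ey px py ax ay with hla
  set lb := sqd ax ay px py * apex ax ay px py ex ey with hlb
  set lp := sqd ax ay ex ey * apex ax ay ex ey px py with hlp
  have hsum : la + lb + lp = 2 * D ^ 2 := by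
    rw [hla, hlb, hlp, hD]; unfold sqd cross apex; ring
  have hx : la * (ax - cx) + lb * (ex - cx) + lp * (px - cx) = 0 := by
    have h : la * (ax - cx) + lb * (ex - cx) + lp * (px - cx) = D * (py - ay) *
        (sqd cx cy ex ey - sqd cx cy ax ay) - D * (ey - ay) *
        (sqd cx cy px py - sqd cx cy ax ay) := by
      rw [hla, hlb, hlp, hD]; unfold sqd cross apex; ring
    rw [h, hb, he]; ring
  have hy : la * (ay - cy) + lb * (ey - cy) + lp * (py - cy) = 0 := by
    have h : la * (ay - cy) + lb * (ey - cy) + lp * (py - cy) = D * (ex - ax) *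
        (sqd cx cy px py - sqd cx cy ax ay) - D * (px - ax) *
        (sqd cx cy ex ey - sqd cx cy ax ay) := by
      rw [hla, hlb, hlp, hD]; unfold sqd cross apex; ring
    rw [h, hb, he]; ring
  -- The circumcenter is the weighted mean of the corners (`hx`, `hy`), so the linear terms cancel
  -- in the weighted mean of the squared distances. That mean exceeds the squared circumradius by
  -- the squared distance of the two centers.
  have key : la * sqd x y ax ay + lb * sqd x y ex ey + lp * sqd x y px py =
      2 * D ^ 2 * (sqd cx cy ax ay + sqd cx cy x y) := by
    rw [← hsum]
    have e1 : sqd x y ax ay = sqd cx cy ax ay + sqd cx cy x y +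
      2 * ((ax - cx) * (cx - x) + (ay - cy) * (cy - y)) := by unfold sqd; ring
    have e2 : sqd x y ex ey = sqd cx cy ax ay + sqd cx cy x y +
      2 * ((ex - cx) * (cx - x) + (ey - cy) * (cy - y)) := by rw [← hb]; unfold sqd; ring
    have e3 : sqd x y px py = sqd cx cy ax ay + sqd cx cy x y +
      2 * ((px - cx) * (cx - x) + (py - cy) * (cy - y)) := by rw [← he]; unfold sqd; ring
    rw [e1, e2, e3]
    linear_combination 2 * (cx - x) * hx + 2 * (cy - y) * hy
  have ka := mul_le_mul_of_nonneg_left ha' (mul_nonneg (sqd_nonneg ex ey px py) oa)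
  have kb := mul_le_mul_of_nonneg_left hb' (mul_nonneg (sqd_nonneg ax ay px py) ob)
  have kp := mul_le_mul_of_nonneg_left hp' (mul_nonneg (sqd_nonneg ax ay ex ey) op)
  rw [← hla] at ka
  rw [← hlb] at kb
  rw [← hlp] at kp
  have h4 : 2 * D ^ 2 * (sqd cx cy ax ay + sqd cx cy x y) ≤ 2 * D ^ 2 * ρ := by
    rw [← key, ← hsum]; linarith
  have h5 := le_of_mul_le_mul_left h4 (by positivity)
  linarith [sqd_nonneg cx cy x y]

/-- Moving the center of a disk from `o` to a point `a` on its circle until the circle hits `q`. -/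
theorem sqd_segment_sub (ox oy ax ay qx qy t : ℝ) :
    sqd (ox + t * (ax - ox)) (oy + t * (ay - oy)) qx qy
      - sqd (ox + t * (ax - ox)) (oy + t * (ay - oy)) ax ay =
    2 * t * (sqd ax ay ox oy - ((qx - ox) * (ax - ox) + (qy - oy) * (ay - oy)))
      - (sqd ax ay ox oy - sqd qx qy ox oy) := by
  unfold sqd; ring

/-- The coefficient of `2 * t` in `sqd_segment_sub` is positive, so the moving circle meets `q` at
exactly one parameter. -/
theorem segment_denom_pos {ox oy ax ay qx qy : ℝ} (h : sqd qx qy ox oy ≤ sqd ax ay ox oy)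
    (hq : 0 < sqd qx qy ax ay) :
    0 < sqd ax ay ox oy - ((qx - ox) * (ax - ox) + (qy - oy) * (ay - oy)) := by
  have : 2 * (sqd ax ay ox oy - ((qx - ox) * (ax - ox) + (qy - oy) * (ay - oy))) =
    (sqd ax ay ox oy - sqd qx qy ox oy) + sqd qx qy ax ay := by unfold sqd; ring
  linarith

/-- The two intersection points of the circles of radius `r` about `a` and `e`. -/
theorem eq_bis_of_sqd_eq {ax ay ex ey qx qy r : ℝ} (hab : 0 < sqd ax ay ex ey)
    (ha : sqd qx qy ax ay = r * r) (hb : sqd qx qy ex ey = r * r) :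
    (qx = bisX ax ay ex ey √(r * r / sqd ax ay ex ey - 1 / 4) ∧
      qy = bisY ax ay ex ey √(r * r / sqd ax ay ex ey - 1 / 4)) ∨
    (qx = bisX ex ey ax ay √(r * r / sqd ex ey ax ay - 1 / 4) ∧
      qy = bisY ex ey ax ay √(r * r / sqd ex ey ax ay - 1 / 4)) := by
  set d := sqd ax ay ex ey with hd
  rw [sqd_comm ex ey ax ay, ← hd]
  -- The position of `q` on the bisector. Its square is forced by `r`; its sign selects the order of
  -- `a` and `e`, which is why ordered pairs describe both intersection points.
  set s := cross ax ay ex ey qx qy / d with hs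
  have hsd : s * d = cross ax ay ex ey qx qy := div_mul_cancel₀ _ hab.ne'
  have hx : qx = bisX ax ay ex ey s := by
    have : d * (qx - bisX ax ay ex ey s) = 0 := by
      have : d * (qx - bisX ax ay ex ey s) =
        d * (qx - (ax + ex) / 2) + s * d * (ey - ay) := by unfold bisX; ring
      rw [this, hsd, hd]
      unfold sqd cross at *
      linear_combination (ex - ax) / 2 * (ha - hb)
    have := (mul_eq_zero.1 this).resolve_left hab.ne'
    linarith
  have hy : qy = bisY ax ay ex ey s := by
    have : d * (qy - bisY ax ay ex ey s) = 0 := by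
      have : d * (qy - bisY ax ay ex ey s) =
        d * (qy - (ay + ey) / 2) - s * d * (ex - ax) := by unfold bisY; ring
      rw [this, hsd, hd]
      unfold sqd cross at *
      linear_combination (ey - ay) / 2 * (ha - hb)
    have := (mul_eq_zero.1 this).resolve_left hab.ne'
    linarith
  have hss : r * r / d - 1 / 4 = s ^ 2 := by
    have : r * r = d * (s ^ 2 + 1 / 4) := by
      rw [← ha, hx, hy, hd]; unfold sqd bisX bisY; ring
    rw [this]; field_simp; ring
  rw [hss, Real.sqrt_sq_eq_abs]
  rcases le_total 0 s with h | h
  · left; rw [abs_of_nonneg h]; exact ⟨hx, hy⟩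
  · right; rw [abs_of_nonpos h, hx, hy]; unfold bisX bisY; constructor <;> ring

end PlaneGeometry

/-! ### Candidate positions for center vertices -/

namespace PlaneGeometry

open Classical in
/-- Abscissa of an extreme point of the intersection of the disks of radius `r` about `a` and `e`:
one of the points on both circles or, if `a = e`, the leftmost point. -/
noncomputable def candX (r ax ay ex ey : ℝ) : ℝ :=
  if sqd ax ay ex ey ≤ 0 then ax - r else bisX ax ay ex ey √(r * r / sqd ax ay ex ey - 1 / 4)

open Classical in
/-- Ordinate of the point with abscissa `candX`. -/
noncomputable def candY (r ax ay ex ey : ℝ) : ℝ :=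
  if sqd ax ay ex ey ≤ 0 then ay else bisY ax ay ex ey √(r * r / sqd ax ay ex ey - 1 / 4)

open Filter Topology in
/-- If disks of radius `r` about finitely many points intersect, then a candidate point of two of
them lies in all of them. -/
theorem exists_cand {ι : Type*} (S : Finset ι) (hS : S.Nonempty) (X Y : ι → ℝ) {r : ℝ} (hr : 0 ≤ r)
    (h : ∃ x y, ∀ i ∈ S, pdist x y (X i) (Y i) ≤ r) :
    ∃ i ∈ S, ∃ j ∈ S, ∀ p ∈ S,
      pdist (candX r (X i) (Y i) (X j) (Y j)) (candY r (X i) (Y i) (X j) (Y j)) (X p) (Y p) ≤ r := by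
  simp only [pdist_le_iff hr] at h ⊢
  obtain ⟨x, y, hxy⟩ := h
  obtain ⟨i₀, hi₀⟩ := hS
  set K : Set (ℝ × ℝ) := {z | ∀ i ∈ S, sqd z.1 z.2 (X i) (Y i) ≤ r * r} with hK
  have hclosed : IsClosed K := by
    have : K = ⋂ i ∈ S, {z : ℝ × ℝ | sqd z.1 z.2 (X i) (Y i) ≤ r * r} := by ext z; simp [hK]
    rw [this]
    refine isClosed_biInter fun i _ => isClosed_le ?_ continuous_const
    unfold sqd; fun_prop
  have hcomp : IsCompact K := by
    refine (isCompact_Icc (a := (X i₀ - r, Y i₀ - r)) (b := (X i₀ + r, Y i₀ + r))).of_isClosed_subset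
      hclosed fun z hz => ?_
    have hz' := hz i₀ hi₀
    unfold sqd at hz'
    have h1 := abs_le_of_sq_le_sq (a := z.1 - X i₀) (b := r) (by nlinarith [mul_self_nonneg (z.2 - Y i₀)]) hr
    have h2 := abs_le_of_sq_le_sq (a := z.2 - Y i₀) (b := r) (by nlinarith [mul_self_nonneg (z.1 - X i₀)]) hr
    rw [abs_le] at h1 h2
    exact ⟨⟨by linarith [h1.1], by linarith [h2.1]⟩, ⟨by linarith [h1.2], by linarith [h2.2]⟩⟩
  -- `q` is a leftmost point of the intersection. It lies either on two different circles or only on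
  -- coinciding ones.
  obtain ⟨q, hq, hmin⟩ := hcomp.exists_isMinOn ⟨(x, y), hxy⟩ continuous_fst.continuousOn
  by_cases hA : ∃ i ∈ S, ∃ j ∈ S, sqd q.1 q.2 (X i) (Y i) = r * r ∧ sqd q.1 q.2 (X j) (Y j) = r * r ∧
      0 < sqd (X i) (Y i) (X j) (Y j)
  · obtain ⟨i, hi, j, hj, hqi, hqj, hij⟩ := hA
    have hji : 0 < sqd (X j) (Y j) (X i) (Y i) := by rwa [sqd_comm]
    rcases eq_bis_of_sqd_eq hij hqi hqj with ⟨h1, h2⟩ | ⟨h1, h2⟩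
    · refine ⟨i, hi, j, hj, fun p hp => ?_⟩
      rw [candX, candY, if_neg hij.not_ge, if_neg hij.not_ge, ← h1, ← h2]
      exact hq p hp
    · refine ⟨j, hj, i, hi, fun p hp => ?_⟩
      rw [candX, candY, if_neg hji.not_ge, if_neg hji.not_ge, ← h1, ← h2]
      exact hq p hp
  · push Not at hA
    obtain ⟨p, hp, hact⟩ : ∃ p ∈ S, ∀ i ∈ S, sqd q.1 q.2 (X i) (Y i) = r * r →
        X i = X p ∧ Y i = Y p := by
      by_cases hex : ∃ p ∈ S, sqd q.1 q.2 (X p) (Y p) = r * r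
      · obtain ⟨p, hp, hpa⟩ := hex
        exact ⟨p, hp, fun i hi hia => eq_of_sqd_le_zero (hA i hi p hp hia hpa)⟩
      · push Not at hex
        -- If `q` is on no circle, any disk of the family can play the role of `p`; the argument
        -- below then yields `q` as its leftmost point all the same.
        exact ⟨i₀, hi₀, fun i hi hia => absurd hia (hex i hi)⟩
    have hqp := hq p hp
    have hql : q.1 = X p - r ∧ q.2 = Y p := by
      by_contra hne
      have hlt : X p - r < q.1 := by
        by_contra hle
        push Not at hle
        unfold sqd at hqp
        have h1 : q.1 = X p - r := by nlinarith [mul_self_nonneg (q.2 - Y p)]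
        refine hne ⟨h1, ?_⟩
        have h2 : (q.2 - Y p) * (q.2 - Y p) ≤ 0 := by rw [h1] at hqp; nlinarith
        nlinarith [mul_self_nonneg (q.2 - Y p)]
      -- Move `q` a little towards the leftmost point of the disk about `p`. By convexity that disk
      -- is not left, the disks with slack are not left by continuity, and the abscissa decreases,
      -- contrary to the choice of `q`.
      set z : ℝ → ℝ × ℝ := fun ε => (q.1 + ε * (X p - r - q.1), q.2 + ε * (Y p - q.2)) with hz
      have hev : ∀ᶠ ε in 𝓝[>] (0 : ℝ), 0 < ε ∧ ∀ i ∈ S, sqd (z ε).1 (z ε).2 (X i) (Y i) ≤ r * r := by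
        refine (eventually_mem_nhdsWithin).and ((eventually_all_finset S).2 fun i hi => ?_)
        by_cases hia : sqd q.1 q.2 (X i) (Y i) = r * r
        · obtain ⟨h1, h2⟩ := hact i hi hia
          rw [h1, h2]
          filter_upwards [Ioo_mem_nhdsGT (zero_lt_one' ℝ)] with ε hε
          simp only [hz]
          unfold sqd at hqp ⊢
          have e : (q.1 + ε * (X p - r - q.1) - X p) * (q.1 + ε * (X p - r - q.1) - X p) +
            (q.2 + ε * (Y p - q.2) - Y p) * (q.2 + ε * (Y p - q.2) - Y p) =
            (1 - ε) * ((q.1 - X p) * (q.1 - X p) + (q.2 - Y p) * (q.2 - Y p)) + ε * (r * r)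
            - ε * (1 - ε) * ((q.1 - X p + r) * (q.1 - X p + r) +
              (q.2 - Y p) * (q.2 - Y p)) := by ring
          rw [e]
          have h3 := mul_le_mul_of_nonneg_left hqp (sub_nonneg.2 hε.2.le)
          have h4 : 0 ≤ ε * (1 - ε) * ((q.1 - X p + r) * (q.1 - X p + r) +
              (q.2 - Y p) * (q.2 - Y p)) :=
            mul_nonneg (mul_nonneg hε.1.le (sub_nonneg.2 hε.2.le))
              (add_nonneg (mul_self_nonneg _) (mul_self_nonneg _))
          linarith
        · have hlt' : sqd q.1 q.2 (X i) (Y i) < r * r := lt_of_le_of_ne (hq i hi) hia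
          have hc : Continuous fun ε => sqd (z ε).1 (z ε).2 (X i) (Y i) := by
            simp only [hz]; unfold sqd; fun_prop
          have h0 : sqd (z 0).1 (z 0).2 (X i) (Y i) < r * r := by simpa [hz] using hlt'
          exact ((hc.tendsto 0).eventually_lt_const h0).filter_mono nhdsWithin_le_nhds
            |>.mono fun _ => le_of_lt
      obtain ⟨ε, hε, hin⟩ := hev.exists
      have := hmin (show z ε ∈ K from hin)
      simp only [hz, Set.mem_ofPred_eq] at this
      nlinarith
    refine ⟨p, hp, p, hp, fun i hi => ?_⟩
    have h0 : sqd (X p) (Y p) (X p) (Y p) ≤ 0 := by simp [sqd]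
    rw [candX, candY, if_pos h0, if_pos h0, ← hql.1, ← hql.2]
    exact hq i hi

end PlaneGeometry

/-! ### Smallest disks by shrinking disks with a given chord -/

namespace PlaneGeometry

/-- The disk with center `c` through `a` is the smallest disk that contains the points `p` with
`S p`. -/
structure IsSmallestDisk (S : ℕ → Prop) (X Y : ℕ → ℝ) (cx cy ax ay : ℝ) : Prop where
  cover : ∀ i, S i → sqd cx cy (X i) (Y i) ≤ sqd cx cy ax ay
  le : ∀ x y ρ, 0 ≤ ρ → (∀ i, S i → sqd x y (X i) (Y i) ≤ ρ) → sqd cx cy ax ay ≤ ρ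

/-- The disks with chord `a e` shrink to the one of diameter `a e`. -/
theorem isSmallestDisk_diameter {S : ℕ → Prop} {X Y : ℕ → ℝ} {a e : ℕ} (ha : S a) (he : S e) {t : ℝ}
    (ht : 0 ≤ t)
    (hinv : ∀ q, S q → apex (X a) (Y a) (X e) (Y e) (X q) (Y q) ≤
      2 * t * cross (X a) (Y a) (X e) (Y e) (X q) (Y q))
    (hmax : ∀ q, S q → 0 < cross (X a) (Y a) (X e) (Y e) (X q) (Y q) →
      apex (X a) (Y a) (X e) (Y e) (X q) (Y q) /
        cross (X a) (Y a) (X e) (Y e) (X q) (Y q) ≤ 0) :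
    IsSmallestDisk S X Y (bisX (X a) (Y a) (X e) (Y e) 0) (bisY (X a) (Y a) (X e) (Y e) 0)
      (X a) (Y a) := by
  refine ⟨fun q hq => ?_, fun x y ρ _ h => diameter_le (h a ha) (h e he)⟩
  have h1 := sqd_bis_sub (X a) (Y a) (X e) (Y e) 0 (X q) (Y q)
  have h2 := hinv q hq
  suffices apex (X a) (Y a) (X e) (Y e) (X q) (Y q) ≤ 0 by linarith
  rcases le_or_gt (cross (X a) (Y a) (X e) (Y e) (X q) (Y q)) 0 with h | h
  · exact h2.trans (mul_nonpos_of_nonneg_of_nonpos (by linarith) h)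
  · have := hmax q hq h
    rw [div_le_iff₀ h] at this
    linarith

section Step

variable {S : ℕ → Prop} {X Y : ℕ → ℝ} {ax ay ex ey px py t : ℝ}

/-- The disks with chord `a e` shrink until they hit a point `p`. -/
theorem shrink_cover
    (hinv : ∀ q, S q → apex ax ay ex ey (X q) (Y q) ≤ 2 * t * cross ax ay ex ey (X q) (Y q))
    (hp : 0 < cross ax ay ex ey px py)
    (hpt : apex ax ay ex ey px py ≤ 2 * t * cross ax ay ex ey px py)
    (hmax : ∀ q, S q → 0 < cross ax ay ex ey (X q) (Y q) →
      apex ax ay ex ey (X q) (Y q) / cross ax ay ex ey (X q) (Y q) ≤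
        apex ax ay ex ey px py / cross ax ay ex ey px py)
    {q : ℕ} (hq : S q) :
    sqd (bisX ax ay ex ey (circumPar ax ay ex ey px py))
      (bisY ax ay ex ey (circumPar ax ay ex ey px py)) (X q) (Y q) ≤
    sqd (bisX ax ay ex ey (circumPar ax ay ex ey px py))
      (bisY ax ay ex ey (circumPar ax ay ex ey px py)) ax ay := by
  have h1 := sqd_bis_sub ax ay ex ey (circumPar ax ay ex ey px py) (X q) (Y q)
  have h2 := hinv q hq
  have e : 2 * circumPar ax ay ex ey px py =
      apex ax ay ex ey px py / cross ax ay ex ey px py := by unfold circumPar; ring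
  rw [e] at h1
  suffices apex ax ay ex ey (X q) (Y q) ≤ apex ax ay ex ey px py / cross ax ay ex ey px py *
    cross ax ay ex ey (X q) (Y q) by linarith
  rcases le_or_gt (cross ax ay ex ey (X q) (Y q)) 0 with h | h
  · refine h2.trans (mul_le_mul_of_nonpos_right ?_ h)
    rwa [div_le_iff₀ hp]
  · have := hmax q hq h
    rwa [div_le_iff₀ h] at this

theorem shrink_eq (hp : 0 < cross ax ay ex ey px py) :
    sqd (bisX ax ay ex ey (circumPar ax ay ex ey px py))
      (bisY ax ay ex ey (circumPar ax ay ex ey px py)) px py =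
    sqd (bisX ax ay ex ey (circumPar ax ay ex ey px py))
      (bisY ax ay ex ey (circumPar ax ay ex ey px py)) ax ay := by
  have h1 := sqd_bis_sub ax ay ex ey (circumPar ax ay ex ey px py) px py
  have e : 2 * circumPar ax ay ex ey px py * cross ax ay ex ey px py = apex ax ay ex ey px py := by
    unfold circumPar; field_simp
  linarith

end Step

/-- First contact: the center moves from `o` towards a farthest point `a` while the circle keeps
passing through `a`. The slack of every other point is affine in the parameter, so at the smallest
contact parameter `τ` the point `e` is on the circle and no point has been lost. -/
theorem exists_start {S : ℕ → Prop} {X Y : ℕ → ℝ} {ox oy ax ay ex ey τ : ℝ}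
    (hfar : ∀ q, S q → sqd (X q) (Y q) ox oy ≤ sqd ax ay ox oy)
    (hmin : ∀ q, S q → 0 < sqd (X q) (Y q) ax ay → τ ≤
      (sqd ax ay ox oy - sqd (X q) (Y q) ox oy) /
      (2 * (sqd ax ay ox oy - ((X q - ox) * (ax - ox) + (Y q - oy) * (ay - oy)))))
    (hfare : sqd ex ey ox oy ≤ sqd ax ay ox oy) (hea : 0 < sqd ex ey ax ay)
    (hτ : τ = (sqd ax ay ox oy - sqd ex ey ox oy) /
      (2 * (sqd ax ay ox oy - ((ex - ox) * (ax - ox) + (ey - oy) * (ay - oy))))) :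
    sqd (ox + τ * (ax - ox)) (oy + τ * (ay - oy)) ax ay =
      sqd (ox + τ * (ax - ox)) (oy + τ * (ay - oy)) ex ey ∧
    ∀ q, S q → sqd (ox + τ * (ax - ox)) (oy + τ * (ay - oy)) (X q) (Y q) ≤
      sqd (ox + τ * (ax - ox)) (oy + τ * (ay - oy)) ax ay := by
  constructor
  · have h1 := sqd_segment_sub ox oy ax ay ex ey τ
    have h2 := segment_denom_pos hfare hea
    have h3 : 2 * τ * (sqd ax ay ox oy - ((ex - ox) * (ax - ox) + (ey - oy) * (ay - oy))) =
        sqd ax ay ox oy - sqd ex ey ox oy := by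
      rw [hτ]; field_simp
    linarith
  · intro q hq
    rcases (sqd_nonneg (X q) (Y q) ax ay).lt_or_eq with h | h
    · have h1 := sqd_segment_sub ox oy ax ay (X q) (Y q) τ
      have h2 := segment_denom_pos (hfar q hq) h
      have h3 := hmin q hq h
      rw [le_div_iff₀ (by linarith)] at h3
      linarith
    · obtain ⟨h1, h2⟩ := eq_of_sqd_le_zero h.ge
      rw [h1, h2]

end PlaneGeometry

namespace RealRAM

open PlaneGeometry

/-! ### Smallest enclosing disks -/

def sqdE (px py qx qy : RExpr) : RExpr := (px - qx) * (px - qx) + (py - qy) * (py - qy)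
def pdistE (px py qx qy : RExpr) : RExpr := .sqrt (sqdE px py qx qy)
def crossE (ax ay ex ey qx qy : RExpr) : RExpr := (ex - ax) * (qy - ay) - (ey - ay) * (qx - ax)
def apexE (ax ay ex ey qx qy : RExpr) : RExpr := (qx - ax) * (qx - ex) + (qy - ay) * (qy - ey)
def bisXE (ax ay ex ey t : RExpr) : RExpr := (ax + ex) / .const 2 - t * (ey - ay)
def bisYE (ax ay ex ey t : RExpr) : RExpr := (ay + ey) / .const 2 + t * (ex - ax)

section eval

variable (s : State) (ax ay ex ey qx qy t : RExpr)

@[simp] theorem eval_sqdE : (sqdE ax ay ex ey).eval s =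
    sqd (ax.eval s) (ay.eval s) (ex.eval s) (ey.eval s) := rfl
@[simp] theorem eval_pdistE : (pdistE ax ay ex ey).eval s =
    pdist (ax.eval s) (ay.eval s) (ex.eval s) (ey.eval s) := rfl
@[simp] theorem eval_crossE : (crossE ax ay ex ey qx qy).eval s =
    cross (ax.eval s) (ay.eval s) (ex.eval s) (ey.eval s) (qx.eval s) (qy.eval s) := rfl
@[simp] theorem eval_apexE : (apexE ax ay ex ey qx qy).eval s =
    apex (ax.eval s) (ay.eval s) (ex.eval s) (ey.eval s) (qx.eval s) (qy.eval s) := rfl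
@[simp] theorem eval_bisXE : (bisXE ax ay ex ey t).eval s =
    bisX (ax.eval s) (ay.eval s) (ex.eval s) (ey.eval s) (t.eval s) := by simp [bisXE, bisX]
@[simp] theorem eval_bisYE : (bisYE ax ay ex ey t).eval s =
    bisY (ax.eval s) (ay.eval s) (ex.eval s) (ey.eval s) (t.eval s) := by simp [bisYE, bisY]

end eval

/-- Among the indices below register `3` that satisfy `g`, find one with maximum `key`. Register
`10` holds the index to which `g` and `key` refer. The flag in register `12` tells whether there is
such an index; the index is returned in register `11` and its key in real register `10`. -/
def argmax (g : Test) (key : RExpr) : Program :=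
  .setN 12 (.const 0) ;;
  .forN 10 3
    (.cond (.both g (.neg (.both (.natLE (.const 1) (.reg 12)) (.realLE key (.reg 10)))))
      (.setN 11 (.reg 10) ;; .setN 12 (.const 1) ;; .setR 10 key) .skip)

/-- The guard and the key are replaced by a predicate `P` and a function `f` of the index, which is
legitimate if they do not depend on what the search itself writes; this is what `hg` and `hk`
express. -/
theorem argmax_spec {g : Test} {key : RExpr} {s : State} {N C : ℕ} (P : ℕ → Prop) (f : ℕ → ℝ)
    (hN : s.nreg 3 = N)
    (hg : ∀ s', Frame (argmax g key) s s' → s'.nreg 10 < N → (g.Holds s' ↔ P (s'.nreg 10)))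
    (hk : ∀ s', Frame (argmax g key) s s' → s'.nreg 10 < N → P (s'.nreg 10) →
      key.eval s' = f (s'.nreg 10))
    (hC : g.cost + 2 * key.cost ≤ C) :
    Wp (argmax g key) s ((C + 50) * (N + 1)) (fun s' =>
      (s'.nreg 12 = 0 ∧ ∀ j < N, ¬ P j) ∨
      (s'.nreg 12 = 1 ∧ s'.nreg 11 < N ∧ P (s'.nreg 11) ∧ s'.rreg 10 = f (s'.nreg 11) ∧
        ∀ j < N, P j → f j ≤ f (s'.nreg 11))) := by
  refine Wp.seq (T₁ := 2) (T₂ := N * ((C + 30) + 10) + 8) (Q₁ := fun s' => s' = s.setN 12 0)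
    (Wp.basic rfl le_rfl rfl) (by nlinarith) ?_
  rintro _ rfl hF₀
  refine Wp.forN (fun m s' =>
      (s'.nreg 12 = 0 ∧ ∀ j < m, ¬ P j) ∨
      (s'.nreg 12 = 1 ∧ s'.nreg 11 < N ∧ P (s'.nreg 11) ∧ s'.rreg 10 = f (s'.nreg 11) ∧
        ∀ j < m, P j → f j ≤ f (s'.nreg 11)))
    (n := N) (by simpa using hN) (by decide : 10 ∉ [11, 12]) (by decide : 3 ∉ [10, 11, 12])
    (by intro j s' v; simp) (Or.inl (by simp)) ?_ le_rfl (fun s' h _ => h)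
  intro m s₁ hm hI hF hj
  have hF' : Frame (argmax g key) s s₁ := hF₀.seqLeft.trans hF.seqRight
  have hg' := hg s₁ hF' (by omega)
  have hk' := hk s₁ hF' (by omega)
  rw [hj] at hg' hk'
  refine Wp.basic rfl ?_ ?_
  · simp only [Program.bcost, Test.cost, NExpr.cost, RExpr.cost]; omega
  simp only [Program.run]
  split_ifs with h
  · simp only [Test.Holds, NExpr.eval, RExpr.eval, hg'] at h
    obtain ⟨hP, hnot⟩ := h
    -- The program evaluates `key` again after it has written registers `11` and `12`, so the value
    -- must not depend on these.
    have hke : ∀ (x y : ℕ), key.eval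
        { s₁ with nreg := Function.update (Function.update s₁.nreg 11 x) 12 y } = f m := by
      intro x y
      have := hk { s₁ with nreg := Function.update (Function.update s₁.nreg 11 x) 12 y }
        (hF'.trans ⟨fun r hr => ?_, fun _ _ => rfl, fun _ _ => rfl, fun _ _ => rfl⟩)
        (by simpa [hj] using hm) (by simpa [hj] using hP)
      · simpa [hj] using this
      · have h1 : r ≠ 11 := by rintro rfl; exact hr (by decide : 11 ∈ [12, 10, 11, 12, 10])
        have h2 : r ≠ 12 := by rintro rfl; exact hr (by decide : 12 ∈ [12, 10, 11, 12, 10])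
        simp [h1, h2]
    refine Or.inr ⟨by simp, by simpa [hj] using hm, by simpa [hj] using hP, ?_, ?_⟩
    · simp only [Function.update_self, hke]; simp [hj]
    · intro j hjm hPj
      suffices f j ≤ f m by simpa [hj] using this
      rcases Nat.lt_succ_iff_lt_or_eq.1 hjm with hlt | rfl
      · rcases hI with ⟨-, hno⟩ | ⟨h12, -, -, h10, hmax⟩
        · exact absurd hPj (hno j hlt)
        · refine (hmax j hlt hPj).trans ?_
          rw [h12, h10, hk' hP] at hnot
          simp only [le_refl, true_and, not_le] at hnot
          exact hnot.le
      · exact le_rfl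
  · simp only [Test.Holds, NExpr.eval, RExpr.eval, hg'] at h
    push Not at h
    rcases hI with ⟨h12, hno⟩ | ⟨h12, h1, h2, h3, hmax⟩
    · refine Or.inl ⟨h12, fun j hjm hPj => ?_⟩
      rcases Nat.lt_succ_iff_lt_or_eq.1 hjm with hlt | rfl
      · exact hno j hlt hPj
      · have := (h hPj).1; omega
    · refine Or.inr ⟨h12, h1, h2, h3, fun j hjm hPj => ?_⟩
      rcases Nat.lt_succ_iff_lt_or_eq.1 hjm with hlt | rfl
      · exact hmax j hlt hPj
      · have := (h hPj).2; rwa [hk' hPj, h3] at this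

end RealRAM

namespace RealRAM
open PlaneGeometry

/-- Coordinates of input point number `i`. -/
def ptX (i : NExpr) : RExpr := .get 0 i
def ptY (i : NExpr) : RExpr := .get 1 i

@[simp] theorem eval_ptX (i : NExpr) (s : State) : (ptX i).eval s = s.rmem 0 (i.eval s) := rfl
@[simp] theorem eval_ptY (i : NExpr) (s : State) : (ptY i).eval s = s.rmem 1 (i.eval s) := rfl

/-- The point in register `10` is selected. -/
def marked : Test := .natLE (.const 1) (.get 4 (.reg 10))

@[simp] theorem holds_marked (s : State) : marked.Holds s ↔ 1 ≤ s.nmem 4 (s.nreg 10) := Iff.rfl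

/-- One step of the search for the smallest enclosing disk: the disks with chord `a e`
(registers `11`-`14`) shrink until they hit another point. -/
def shrinkStep : Program :=
  argmax (.both marked (.neg (.realLE (crossE (.reg 11) (.reg 12) (.reg 13) (.reg 14)
      (ptX (.reg 10)) (ptY (.reg 10))) (.const 0))))
    (apexE (.reg 11) (.reg 12) (.reg 13) (.reg 14) (ptX (.reg 10)) (ptY (.reg 10)) /
      crossE (.reg 11) (.reg 12) (.reg 13) (.reg 14) (ptX (.reg 10)) (ptY (.reg 10))) ;;
  .cond (.both (.natLE (.const 1) (.reg 12)) (.neg (.realLE (.reg 10) (.const 0))))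
    (.setR 15 (ptX (.reg 11)) ;; .setR 16 (ptY (.reg 11)) ;; .setR 22 (.reg 10 / .const 2) ;;
      .setR 17 (bisXE (.reg 11) (.reg 12) (.reg 13) (.reg 14) (.reg 22)) ;;
      .setR 18 (bisYE (.reg 11) (.reg 12) (.reg 13) (.reg 14) (.reg 22)) ;;
      .cond (.neg (.realLE (.const 0)
          (apexE (.reg 13) (.reg 14) (.reg 15) (.reg 16) (.reg 11) (.reg 12))))
        (.setR 11 (.reg 15) ;; .setR 12 (.reg 16))
        (.cond (.neg (.realLE (.const 0)
            (apexE (.reg 11) (.reg 12) (.reg 15) (.reg 16) (.reg 13) (.reg 14))))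
          (.setR 13 (.reg 15) ;; .setR 14 (.reg 16))
          (.setN 13 (.const 0))))
    (.setR 17 (bisXE (.reg 11) (.reg 12) (.reg 13) (.reg 14) (.const 0)) ;;
      .setR 18 (bisYE (.reg 11) (.reg 12) (.reg 13) (.reg 14) (.const 0)) ;;
      .setN 13 (.const 0))

/-- While the search goes on, the points `a` and `e` are on the boundary of a disk that contains
all points of `S`, its center is not to the right of `a e`, and at most `N - j` points of `S` are
to the left of `a e`. -/
def ShrinkRunning (S : ℕ → Prop) (X Y : ℕ → ℝ) (N j : ℕ) (ax ay ex ey : ℝ) : Prop :=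
  ∃ a e, S a ∧ S e ∧ ax = X a ∧ ay = Y a ∧ ex = X e ∧ ey = Y e ∧ 0 < sqd ax ay ex ey ∧
    (∃ t, 0 ≤ t ∧ ∀ q, S q →
      apex ax ay ex ey (X q) (Y q) ≤ 2 * t * cross ax ay ex ey (X q) (Y q)) ∧
    ∃ F : Finset ℕ, (∀ q, S q → 0 < cross ax ay ex ey (X q) (Y q) → q ∈ F) ∧ F.card + j ≤ N

/-- When the search ends, the disk with center `c` through `a` is the smallest enclosing disk, and
its radius is a critical radius. -/
def ShrinkDone (S : ℕ → Prop) (X Y : ℕ → ℝ) (cx cy ax ay : ℝ) : Prop :=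
  IsSmallestDisk S X Y cx cy ax ay ∧ ∃ i j q, S i ∧ S j ∧ S q ∧
    pdist cx cy ax ay = critRadius (X i) (Y i) (X j) (Y j) (X q) (Y q)

/-- Progress of the search: `p` was to the left of the old chord and is on the line of the new one,
while no point gets to the left side. So the finite set `F` that bounds the points on the left can
drop `p`. -/
theorem shrink_of_drop {S : ℕ → Prop} {X Y : ℕ → ℝ} {N j a' e' p : ℕ} {ax ay ex ey cx cy : ℝ}
    (ha' : S a') (he' : S e') (hp : S p) (hpos : 0 < sqd (X a') (Y a') (X e') (Y e'))
    (heq : sqd cx cy (X a') (Y a') = sqd cx cy (X e') (Y e'))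
    (hc : 0 ≤ cross (X a') (Y a') (X e') (Y e') cx cy)
    (hcov : ∀ q, S q → sqd cx cy (X q) (Y q) ≤ sqd cx cy (X a') (Y a'))
    (hsub : ∀ q, S q → cross ax ay ex ey (X q) (Y q) ≤ 0 →
      cross (X a') (Y a') (X e') (Y e') (X q) (Y q) ≤ 0)
    (hpp : 0 < cross ax ay ex ey (X p) (Y p))
    (hp0 : cross (X a') (Y a') (X e') (Y e') (X p) (Y p) = 0)
    (hF : ∃ F : Finset ℕ, (∀ q, S q → 0 < cross ax ay ex ey (X q) (Y q) → q ∈ F) ∧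
      F.card + j ≤ N) :
    ShrinkRunning S X Y N (j + 1) (X a') (Y a') (X e') (Y e') := by
  obtain ⟨F, hF, hcard⟩ := hF
  obtain ⟨t, ht, htq⟩ := exists_bisector_par hpos heq hc
  refine ⟨a', e', ha', he', rfl, rfl, rfl, rfl, hpos, ⟨t, ht, fun q hq => htq _ _ (hcov q hq)⟩,
    F.erase p, fun q hq hq' => ?_, ?_⟩
  · refine Finset.mem_erase.2 ⟨?_, hF q hq ?_⟩
    · rintro rfl; exact hq'.ne' hp0
    · by_contra h
      exact hq'.not_ge (hsub q hq (not_lt.1 h))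
  · have := Finset.card_erase_add_one (hF p hp hpp)
    omega

theorem shrinkStep_spec {s : State} {N j : ℕ} (hN : s.nreg 3 = N) (h13 : s.nreg 13 = 1)
    {S : ℕ → Prop} (hS : ∀ q, S q ↔ q < N ∧ 1 ≤ s.nmem 4 q)
    (hI : ShrinkRunning S (s.rmem 0) (s.rmem 1) N j (s.rreg 11) (s.rreg 12) (s.rreg 13)
      (s.rreg 14)) :
    Wp shrinkStep s (400 * (N + 1)) (fun s' =>
      (s'.nreg 13 = 1 ∧ ShrinkRunning S (s.rmem 0) (s.rmem 1) N (j + 1) (s'.rreg 11) (s'.rreg 12)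
        (s'.rreg 13) (s'.rreg 14)) ∨
      (s'.nreg 13 = 0 ∧ ShrinkDone S (s.rmem 0) (s.rmem 1) (s'.rreg 17) (s'.rreg 18) (s'.rreg 11)
        (s'.rreg 12))) := by
  set X := s.rmem 0 with hX
  set Y := s.rmem 1 with hY
  set ax := s.rreg 11
  set ay := s.rreg 12
  set ex := s.rreg 13
  set ey := s.rreg 14
  refine Wp.seq (argmax_spec (fun q => 1 ≤ s.nmem 4 q ∧ 0 < cross ax ay ex ey (X q) (Y q))
    (fun q => apex ax ay ex ey (X q) (Y q) / cross ax ay ex ey (X q) (Y q)) hN (C := 150) ?_ ?_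
    (by decide)) (T₂ := 200) (by omega) ?_
  · intro s' hF _
    have e1 := hF.rreg 11 (by decide : 11 ∉ [10])
    have e2 := hF.rreg 12 (by decide : 12 ∉ [10])
    have e3 := hF.rreg 13 (by decide : 13 ∉ [10])
    have e4 := hF.rreg 14 (by decide : 14 ∉ [10])
    have e5 := hF.nmem 4 (by decide : 4 ∉ [])
    have e6 := hF.rmem 0 (by decide : 0 ∉ [])
    have e7 := hF.rmem 1 (by decide : 1 ∉ [])
    simp [e1, e2, e3, e4, e5, e6, e7, ax, ay, ex, ey, hX, hY]
  · intro s' hF _ _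
    have e1 := hF.rreg 11 (by decide : 11 ∉ [10])
    have e2 := hF.rreg 12 (by decide : 12 ∉ [10])
    have e3 := hF.rreg 13 (by decide : 13 ∉ [10])
    have e4 := hF.rreg 14 (by decide : 14 ∉ [10])
    have e6 := hF.rmem 0 (by decide : 0 ∉ [])
    have e7 := hF.rmem 1 (by decide : 1 ∉ [])
    simp [e1, e2, e3, e4, e6, e7, ax, ay, ex, ey, hX, hY]
  intro s₁ h₁ hF
  have e1 : s₁.rreg 11 = ax := hF.rreg 11 (by decide : 11 ∉ [10])
  have e2 : s₁.rreg 12 = ay := hF.rreg 12 (by decide : 12 ∉ [10])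
  have e3 : s₁.rreg 13 = ex := hF.rreg 13 (by decide : 13 ∉ [10])
  have e4 : s₁.rreg 14 = ey := hF.rreg 14 (by decide : 14 ∉ [10])
  have e6 : s₁.rmem 0 = X := hF.rmem 0 (by decide : 0 ∉ [])
  have e7 : s₁.rmem 1 = Y := hF.rmem 1 (by decide : 1 ∉ [])
  have e8 : s₁.nreg 13 = 1 := (hF.nreg 13 (by decide : 13 ∉ [12, 10, 11, 12, 10])).trans h13
  obtain ⟨a, e, ha, he, hax, hay, hex, hey, hpos, ⟨t, ht, hinv⟩, hFin⟩ := hI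
  refine Wp.basic rfl (by decide) ?_
  have hfinal : (∀ q, S q → 0 < cross ax ay ex ey (X q) (Y q) →
      apex ax ay ex ey (X q) (Y q) / cross ax ay ex ey (X q) (Y q) ≤ 0) →
      ShrinkDone S X Y (bisX ax ay ex ey 0) (bisY ax ay ex ey 0) ax ay := by
    intro hmax
    rw [hax, hay, hex, hey] at hinv hmax ⊢
    refine ⟨isSmallestDisk_diameter ha he ht hinv hmax, a, e, a, ha, he, ha, ?_⟩
    -- Half the chord is the critical radius of the degenerate triple `a`, `e`, `a`.
    have h0 : circumPar (X a) (Y a) (X e) (Y e) (X a) (Y a) = 0 := by simp [circumPar, apex]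
    rw [critRadius, h0]
  rcases h₁ with ⟨h12, hno⟩ | ⟨h12, hpN, ⟨hpS, hp⟩, h10, hmax⟩
  · simpa [Program.run, h12, e1, e2, e3, e4, e8] using
      hfinal fun q hq hpos => absurd ⟨((hS q).1 hq).2, hpos⟩ (hno q ((hS q).1 hq).1)
  generalize hpe : s₁.nreg 11 = p at *
  replace hpS : S p := (hS p).2 ⟨hpN, hpS⟩
  replace hmax : ∀ q, S q → 0 < cross ax ay ex ey (X q) (Y q) →
      apex ax ay ex ey (X q) (Y q) / cross ax ay ex ey (X q) (Y q) ≤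
        apex ax ay ex ey (X p) (Y p) / cross ax ay ex ey (X p) (Y p) :=
    fun q hq h => hmax q ((hS q).1 hq).1 ⟨((hS q).1 hq).2, h⟩
  rcases le_or_gt (s₁.rreg 10) 0 with hle | hgt
  · simpa [Program.run, h12, e1, e2, e3, e4, e8, hle] using
      hfinal fun q hq h => (hmax q hq h).trans (h10 ▸ hle)
  have ht10 : s₁.rreg 10 / 2 = circumPar ax ay ex ey (X p) (Y p) := by rw [h10, circumPar]
  have hcov := fun q (hq : S q) => shrink_cover hinv hp (hinv p hpS) hmax hq
  have heqp := shrink_eq hp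
  have heqe := (sqd_bis_eq ax ay ex ey (circumPar ax ay ex ey (X p) (Y p))).symm
  set cx := bisX ax ay ex ey (circumPar ax ay ex ey (X p) (Y p)) with hcx
  set cy := bisY ax ay ex ey (circumPar ax ay ex ey (X p) (Y p)) with hcy
  -- An obtuse angle at `a` means that the disk can shrink further with the longest side `p e` as
  -- its chord.
  by_cases ho1 : apex ex ey (X p) (Y p) ax ay < 0
  · have hpos' : 0 < sqd (X p) (Y p) ex ey := by
      refine lt_of_le_of_ne (sqd_nonneg _ _ _ _) fun h => ?_
      obtain ⟨h1, h2⟩ := eq_of_sqd_le_zero h.symm.le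
      rw [h1, h2] at hp
      exact hp.ne' (by simp [cross]; ring)
    have : ShrinkRunning S X Y N (j + 1) (X p) (Y p) ex ey := by
      rw [hex, hey]
      refine shrink_of_drop (ax := ax) (ay := ay) (ex := ex) (ey := ey) (cx := cx) (cy := cy)
        hpS he hpS (by rwa [← hex, ← hey]) (by rw [← hex, ← hey, heqp, heqe]) ?_ ?_ ?_ hp
        (by simp [cross]) hFin
      · rw [← hex, ← hey]
        exact cross_center_first hp heqe.symm (heqp.trans heqe.symm) ho1
      · intro q hq; rw [heqp]; exact hcov q hq
      · intro q hq hs; rw [← hex, ← hey]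
        exact cross_nonpos_first hp heqe.symm (heqp.trans heqe.symm)
          ((hcov q hq).trans heqe.ge) hs
    simpa [Program.run, h12, e1, e2, e3, e4, e6, e7, e8, hgt, hgt.not_ge, ho1, hpe] using this
  -- Likewise, if the angle at `e` is obtuse, the new chord is `a p`.
  by_cases ho2 : apex ax ay (X p) (Y p) ex ey < 0
  · have hpos' : 0 < sqd ax ay (X p) (Y p) := by
      refine lt_of_le_of_ne (sqd_nonneg _ _ _ _) fun h => ?_
      obtain ⟨h1, h2⟩ := eq_of_sqd_le_zero h.symm.le
      rw [← h1, ← h2] at hp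
      exact hp.ne' (by simp [cross])
    have : ShrinkRunning S X Y N (j + 1) ax ay (X p) (Y p) := by
      rw [hax, hay]
      refine shrink_of_drop (ax := ax) (ay := ay) (ex := ex) (ey := ey) (cx := cx) (cy := cy)
        ha hpS hpS (by rwa [← hax, ← hay]) (by rw [← hax, ← hay, heqp]) ?_ ?_ ?_ hp
        (by simp [cross]; ring) hFin
      · rw [← hax, ← hay]
        exact cross_center_second hp heqe heqp ho2
      · intro q hq; rw [← hax, ← hay]; exact hcov q hq
      · intro q hq hs; rw [← hax, ← hay]
        exact cross_nonpos_second hp heqe heqp (hcov q hq) hs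
    simpa [Program.run, h12, e1, e2, e3, e4, e6, e7, e8, hgt, hgt.not_ge, ho1, ho2, hpe] using this
  -- The angle at `p` is not obtuse because contact occurs at a positive parameter. So the triangle
  -- has no obtuse angle and its circumdisk is the smallest disk.
  · have hap : 0 ≤ apex ax ay ex ey (X p) (Y p) := by
      rw [h10, lt_div_iff₀ hp] at hgt; linarith
    have : ShrinkDone S X Y cx cy ax ay := by
      refine ⟨⟨hcov, fun x y ρ _ h => ?_⟩, a, e, p, ha, he, hpS, by rw [← hax, ← hay, ← hex, ← hey,
        critRadius]⟩
      exact circumradius_le hp heqe heqp (not_lt.1 ho1) (not_lt.1 ho2) hap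
        (by rw [hax, hay]; exact h a ha) (by rw [hex, hey]; exact h e he) (h p hpS)
    rw [hcx, hcy, ← ht10] at this
    simpa [Program.run, h12, e1, e2, e3, e4, e6, e7, e8, hgt, hgt.not_ge, ho1, ho2, hpe] using this

end RealRAM

namespace RealRAM
open PlaneGeometry

/-- The smallest enclosing disk of the marked points: its center is returned in real registers
`17` and `18`, its radius in real register `19`. -/
def smallestDisk : Program :=
  argmax marked (.const 0) ;;
  .cond (.natLE (.const 1) (.reg 12))
    ((.setR 20 (ptX (.reg 11)) ;; .setR 21 (ptY (.reg 11))) ;;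
      argmax marked (sqdE (ptX (.reg 10)) (ptY (.reg 10)) (.reg 20) (.reg 21)) ;;
      (.setR 11 (ptX (.reg 11)) ;; .setR 12 (ptY (.reg 11)) ;;
        .setR 17 (.reg 20) ;; .setR 18 (.reg 21)) ;;
      .cond (.realLE (sqdE (.reg 11) (.reg 12) (.reg 20) (.reg 21)) (.const 0)) .skip
        (argmax (.both marked (.neg (.realLE (sqdE (ptX (.reg 10)) (ptY (.reg 10)) (.reg 11) (.reg 12))
            (.const 0))))
          (.const 0 - (sqdE (.reg 11) (.reg 12) (.reg 20) (.reg 21) -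
            sqdE (ptX (.reg 10)) (ptY (.reg 10)) (.reg 20) (.reg 21)) /
            (.const 2 * (sqdE (.reg 11) (.reg 12) (.reg 20) (.reg 21) -
              ((ptX (.reg 10) - .reg 20) * (.reg 11 - .reg 20) +
                (ptY (.reg 10) - .reg 21) * (.reg 12 - .reg 21))))) ;;
        (.setR 13 (ptX (.reg 11)) ;; .setR 14 (ptY (.reg 11)) ;; .setR 22 (.const 0 - .reg 10) ;;
          .setR 17 (.reg 20 + .reg 22 * (.reg 11 - .reg 20)) ;;
          .setR 18 (.reg 21 + .reg 22 * (.reg 12 - .reg 21)) ;;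
          .cond (.realLE (.const 0) (crossE (.reg 11) (.reg 12) (.reg 13) (.reg 14) (.reg 17) (.reg 18)))
            .skip
            (.setR 23 (.reg 11) ;; .setR 24 (.reg 12) ;; .setR 11 (.reg 13) ;; .setR 12 (.reg 14) ;;
              .setR 13 (.reg 23) ;; .setR 14 (.reg 24)) ;;
          .setN 13 (.const 1)) ;;
        .loop (.natLE (.const 1) (.reg 13)) shrinkStep) ;;
      .setR 19 (pdistE (.reg 17) (.reg 18) (.reg 11) (.reg 12)))
    (.setR 17 (.const 0) ;; .setR 18 (.const 0) ;; .setR 19 (.const 0))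

/-- The disk with center `c` and radius `R` is the smallest disk that contains the points `p` with
`S p` (the disk of radius `0` about the origin if there are none), and its radius is critical. -/
structure IsEnclosingDisk (S : ℕ → Prop) (X Y : ℕ → ℝ) (cx cy R : ℝ) : Prop where
  cover : ∀ i, S i → pdist cx cy (X i) (Y i) ≤ R
  le : ∀ x y r, 0 ≤ r → (∀ i, S i → pdist x y (X i) (Y i) ≤ r) → R ≤ r
  crit : R = 0 ∨ ∃ i j q, S i ∧ S j ∧ S q ∧ R = critRadius (X i) (Y i) (X j) (Y j) (X q) (Y q)

theorem isEnclosingDisk_of_isSmallestDisk {S : ℕ → Prop} {X Y : ℕ → ℝ} {cx cy ax ay : ℝ}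
    (h : IsSmallestDisk S X Y cx cy ax ay)
    (hc : pdist cx cy ax ay = 0 ∨ ∃ i j q, S i ∧ S j ∧ S q ∧
      pdist cx cy ax ay = critRadius (X i) (Y i) (X j) (Y j) (X q) (Y q)) :
    IsEnclosingDisk S X Y cx cy (pdist cx cy ax ay) := by
  refine ⟨fun i hi => pdist_le_pdist_iff.2 (h.cover i hi), fun x y r hr hxy => ?_, hc⟩
  rw [pdist_le_iff hr]
  exact h.le x y _ (mul_self_nonneg r) fun i hi => (pdist_le_iff hr).1 (hxy i hi)

theorem loop_shrinkStep_spec {s : State} {N : ℕ} (hN : s.nreg 3 = N) (h13 : s.nreg 13 = 1)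
    {S : ℕ → Prop} (hS : ∀ q, S q ↔ q < N ∧ 1 ≤ s.nmem 4 q)
    (hI : ShrinkRunning S (s.rmem 0) (s.rmem 1) N 0 (s.rreg 11) (s.rreg 12) (s.rreg 13)
      (s.rreg 14)) :
    Wp (.loop (.natLE (.const 1) (.reg 13)) shrinkStep) s (500 * ((N + 1) * (N + 1))) (fun s' =>
      ShrinkDone S (s.rmem 0) (s.rmem 1) (s'.rreg 17) (s'.rreg 18) (s'.rreg 11) (s'.rreg 12)) := by
  refine (Wp.loop (N + 1) (400 * (N + 1)) (fun j s' =>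
    (s'.nreg 13 = 1 ∧ ShrinkRunning S (s.rmem 0) (s.rmem 1) N j (s'.rreg 11) (s'.rreg 12)
      (s'.rreg 13) (s'.rreg 14)) ∨
    (s'.nreg 13 = 0 ∧ ShrinkDone S (s.rmem 0) (s.rmem 1) (s'.rreg 17) (s'.rreg 18) (s'.rreg 11)
      (s'.rreg 12))) (Or.inl ⟨h13, hI⟩) ?_).imp ?_ ?_
  · rintro j s' (⟨h, hR⟩ | ⟨h, -⟩) hF ht
    · have e0 : s'.rmem 0 = s.rmem 0 := hF.rmem 0 (by decide)
      have e1 : s'.rmem 1 = s.rmem 1 := hF.rmem 1 (by decide)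
      have e4 : s'.nmem 4 = s.nmem 4 := hF.nmem 4 (by decide)
      have e3 : s'.nreg 3 = N := (hF.nreg 3 (by decide)).trans hN
      refine ⟨?_, ?_⟩
      · obtain ⟨-, -, -, -, -, -, -, -, -, -, F, -, hF⟩ := hR
        omega
      · have := shrinkStep_spec e3 h (S := S) (by rw [e4]; exact hS) (by rw [e0, e1]; exact hR)
        rwa [e0, e1] at this
    · simp [h] at ht
  · simp only [Test.cost, NExpr.cost]; nlinarith
  · rintro s' ⟨j, -, ⟨h, -⟩ | ⟨-, h⟩, hn⟩ -
    · simp [h] at hn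
    · exact h

/-- Take any marked point `o` and a marked point `a` farthest from it. The disk about `o` through
`a` is moved towards `a` until a second point `e` is hit (`exists_start`); then the disks with chord
`a e` shrink. There are at most `N + 1` rounds, each a linear search, so quadratic time suffices. -/
theorem smallestDisk_spec {s : State} {N : ℕ} (hN : s.nreg 3 = N) :
    Wp smallestDisk s (2000 * ((N + 1) * (N + 1))) (fun s' =>
      IsEnclosingDisk (fun q => q < N ∧ 1 ≤ s.nmem 4 q) (s.rmem 0) (s.rmem 1)
        (s'.rreg 17) (s'.rreg 18) (s'.rreg 19)) := by
  set X := s.rmem 0 with hX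
  set Y := s.rmem 1 with hY
  set S : ℕ → Prop := fun q => q < N ∧ 1 ≤ s.nmem 4 q with hS
  have hNN : N + 1 ≤ (N + 1) * (N + 1) := Nat.le_mul_self _
  refine Wp.seq (argmax_spec (fun q => 1 ≤ s.nmem 4 q) (fun _ => 0) hN (C := 50) ?_ ?_
    (by decide)) (T₂ := 1800 * ((N + 1) * (N + 1))) (by omega) ?_
  · intro s' hF _
    simp [hF.nmem 4 (by decide)]
  · intro s' _ _ _; simp
  intro s₁ h₁ hF₁
  have e0 : s₁.rmem 0 = X := hF₁.rmem 0 (by decide)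
  have e1 : s₁.rmem 1 = Y := hF₁.rmem 1 (by decide)
  have e4 : s₁.nmem 4 = s.nmem 4 := hF₁.nmem 4 (by decide)
  have e3 : s₁.nreg 3 = N := (hF₁.nreg 3 (by decide)).trans hN
  refine Wp.cond (T₁ := 1700 * ((N + 1) * (N + 1))) (by simp only [Test.cost, NExpr.cost]; omega) ?_ ?_
  swap
  · intro ht
    refine Wp.basic rfl ((by decide : _ ≤ 20).trans (by omega)) ?_
    have hno : ∀ i, ¬ S i := by
      rcases h₁ with ⟨-, h⟩ | ⟨h, -⟩
      · exact fun i hi => h i hi.1 hi.2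
      · simp [h] at ht
    simp only [Program.run]
    refine ⟨fun i hi => absurd hi (hno i), fun x y r hr _ => by simpa using hr, by simp⟩
  intro ht
  rcases h₁ with ⟨h, -⟩ | ⟨-, ho, ho', -, -⟩
  · simp [h] at ht
  generalize hoe : s₁.nreg 11 = o at *
  refine Wp.seq (T₁ := 20) (T₂ := 1600 * ((N + 1) * (N + 1)))
    (Q₁ := fun s' => s'.rreg 20 = X o ∧ s'.rreg 21 = Y o)
    (Wp.basic rfl (by decide) (by simp [Program.run, e0, e1, hoe])) (by omega) ?_
  rintro s₂ ⟨h20, h21⟩ hF₂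
  have f0 : s₂.rmem 0 = X := (hF₂.rmem 0 (by decide)).trans e0
  have f1 : s₂.rmem 1 = Y := (hF₂.rmem 1 (by decide)).trans e1
  have f4 : s₂.nmem 4 = s.nmem 4 := (hF₂.nmem 4 (by decide)).trans e4
  have f3 : s₂.nreg 3 = N := (hF₂.nreg 3 (by decide)).trans e3
  clear hF₁ hF₂ e0 e1 e4 e3
  refine Wp.seq (argmax_spec (fun q => 1 ≤ s.nmem 4 q) (fun q => sqd (X q) (Y q) (X o) (Y o)) f3
    (C := 50) ?_ ?_ (by decide)) (T₂ := 1500 * ((N + 1) * (N + 1))) (by omega) ?_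
  · intro s' hF _
    simp [hF.nmem 4 (by decide), f4]
  · intro s' hF _ _
    simp [hF.rmem 0 (by decide), hF.rmem 1 (by decide), hF.rreg 20 (by decide),
      hF.rreg 21 (by decide), f0, f1, h20, h21]
  rintro s₃ (⟨-, h⟩ | ⟨-, ha, ha', -, hfar⟩) hF₃
  · exact absurd ho' (h o ho)
  generalize hae : s₃.nreg 11 = a at *
  have g0 : s₃.rmem 0 = X := (hF₃.rmem 0 (by decide)).trans f0
  have g1 : s₃.rmem 1 = Y := (hF₃.rmem 1 (by decide)).trans f1
  have g4 : s₃.nmem 4 = s.nmem 4 := (hF₃.nmem 4 (by decide)).trans f4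
  have g3 : s₃.nreg 3 = N := (hF₃.nreg 3 (by decide)).trans f3
  have g20 : s₃.rreg 20 = X o := (hF₃.rreg 20 (by decide)).trans h20
  have g21 : s₃.rreg 21 = Y o := (hF₃.rreg 21 (by decide)).trans h21
  clear hF₃ f0 f1 f4 f3 h20 h21
  refine Wp.seq (T₁ := 20) (T₂ := 1400 * ((N + 1) * (N + 1)))
    (Q₁ := fun s' => s'.rreg 11 = X a ∧ s'.rreg 12 = Y a ∧ s'.rreg 17 = X o ∧ s'.rreg 18 = Y o)
    (Wp.basic rfl (by decide) (by simp [Program.run, g0, g1, hae, g20, g21])) (by omega) ?_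
  rintro s₄ ⟨h11, h12, h17, h18⟩ hF₄
  have e0 : s₄.rmem 0 = X := (hF₄.rmem 0 (by decide)).trans g0
  have e1 : s₄.rmem 1 = Y := (hF₄.rmem 1 (by decide)).trans g1
  have e4 : s₄.nmem 4 = s.nmem 4 := (hF₄.nmem 4 (by decide)).trans g4
  have e3 : s₄.nreg 3 = N := (hF₄.nreg 3 (by decide)).trans g3
  have e20 : s₄.rreg 20 = X o := (hF₄.rreg 20 (by decide)).trans g20
  have e21 : s₄.rreg 21 = Y o := (hF₄.rreg 21 (by decide)).trans g21
  clear hF₄ g0 g1 g4 g3 g20 g21 hae hoe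
  suffices hmain : Wp (.cond (.realLE (sqdE (.reg 11) (.reg 12) (.reg 20) (.reg 21)) (.const 0)) .skip
      _) s₄ (1300 * ((N + 1) * (N + 1))) (fun s' =>
        IsSmallestDisk S X Y (s'.rreg 17) (s'.rreg 18) (s'.rreg 11) (s'.rreg 12) ∧
        (pdist (s'.rreg 17) (s'.rreg 18) (s'.rreg 11) (s'.rreg 12) = 0 ∨ ∃ i j q, S i ∧ S j ∧ S q ∧
          pdist (s'.rreg 17) (s'.rreg 18) (s'.rreg 11) (s'.rreg 12) =
            critRadius (X i) (Y i) (X j) (Y j) (X q) (Y q))) by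
    refine Wp.seq hmain (T₂ := 50) (by omega) ?_
    rintro s₅ ⟨hsm, hcr⟩ -
    refine Wp.basic rfl (by decide) ?_
    simpa [Program.run] using isEnclosingDisk_of_isSmallestDisk hsm hcr
  refine Wp.cond (T₁ := 1200 * ((N + 1) * (N + 1))) ((Nat.add_le_add_right (Nat.add_le_add_right
    (by decide : _ ≤ 30) _) _).trans (by omega)) ?_ ?_
  · intro ht
    simp only [Test.Holds, eval_sqdE, RExpr.eval, h11, h12, e20, e21, Rat.cast_zero] at ht
    refine Wp.basic rfl ((by decide : _ ≤ 1).trans (by omega)) ?_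
    -- The farthest point coincides with `o`, hence all marked points do, and the disk has radius
    -- `0`.
    obtain ⟨q1, q2⟩ := eq_of_sqd_le_zero ht
    have z : ∀ x y, sqd x y x y = 0 := fun x y => by simp [sqd]
    simp only [Program.run, h11, h12, h17, h18, q1, q2]
    refine ⟨⟨fun i hi => ?_, fun x y ρ hρ _ => ?_⟩, Or.inl (by simp [pdist, z])⟩
    · rw [z, sqd_comm]
      exact (hfar i hi.1 hi.2).trans ht
    · rwa [z]
  intro ht
  simp only [Test.Holds, eval_sqdE, RExpr.eval, h11, h12, e20, e21, Rat.cast_zero, not_le] at ht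
  -- The contact parameter is negated because the smallest one is needed. Copies of `a` are excluded
  -- since they stay on the circle throughout.
  refine Wp.seq (argmax_spec (fun q => 1 ≤ s.nmem 4 q ∧ 0 < sqd (X q) (Y q) (X a) (Y a))
    (fun q => -((sqd (X a) (Y a) (X o) (Y o) - sqd (X q) (Y q) (X o) (Y o)) /
      (2 * (sqd (X a) (Y a) (X o) (Y o) -
        ((X q - X o) * (X a - X o) + (Y q - Y o) * (Y a - Y o)))))) e3 (C := 300) ?_ ?_
    (by decide)) (T₂ := 800 * ((N + 1) * (N + 1))) (by omega) ?_
  · intro s' hF _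
    simp [hF.nmem 4 (by decide), e4, hF.rmem 0 (by decide), hF.rmem 1 (by decide),
      hF.rreg 11 (by decide), hF.rreg 12 (by decide), e0, e1, h11, h12]
  · intro s' hF _ _
    simp [hF.rmem 0 (by decide), hF.rmem 1 (by decide),
      hF.rreg 11 (by decide), hF.rreg 12 (by decide), hF.rreg 20 (by decide),
      hF.rreg 21 (by decide), e0, e1, h11, h12, e20, e21]
  rintro s₅ (⟨-, h⟩ | ⟨-, he, ⟨he', hea⟩, h10, hmin⟩) hF₅
  · exact absurd ⟨ho', by rwa [sqd_comm]⟩ (h o ho)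
  generalize hee : s₅.nreg 11 = e at *
  have g0 : s₅.rmem 0 = X := (hF₅.rmem 0 (by decide)).trans e0
  have g1 : s₅.rmem 1 = Y := (hF₅.rmem 1 (by decide)).trans e1
  have g4 : s₅.nmem 4 = s.nmem 4 := (hF₅.nmem 4 (by decide)).trans e4
  have g3 : s₅.nreg 3 = N := (hF₅.nreg 3 (by decide)).trans e3
  have g20 : s₅.rreg 20 = X o := (hF₅.rreg 20 (by decide)).trans e20
  have g21 : s₅.rreg 21 = Y o := (hF₅.rreg 21 (by decide)).trans e21
  have g11 : s₅.rreg 11 = X a := (hF₅.rreg 11 (by decide)).trans h11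
  have g12 : s₅.rreg 12 = Y a := (hF₅.rreg 12 (by decide)).trans h12
  clear hF₅ e0 e1 e4 e3 e20 e21 h11 h12
  have hsa : S a := ⟨ha, ha'⟩
  have hse : S e := ⟨he, he'⟩
  obtain ⟨heq, hcov⟩ := exists_start (S := S) (X := X) (Y := Y) (ox := X o) (oy := Y o)
    (ax := X a) (ay := Y a) (ex := X e) (ey := Y e) (τ := -s₅.rreg 10)
    (fun q hq => hfar q hq.1 hq.2)
    (fun q hq h => by rw [h10, neg_neg]; exact neg_le_neg_iff.1 (hmin q hq.1 ⟨hq.2, h⟩))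
    (hfar e he he') hea (by rw [h10, neg_neg])
  refine Wp.seq (T₁ := 100) (T₂ := 500 * ((N + 1) * (N + 1)))
    (Q₁ := fun s' => s'.nreg 13 = 1 ∧
      ShrinkRunning S X Y N 0 (s'.rreg 11) (s'.rreg 12) (s'.rreg 13) (s'.rreg 14))
    (Wp.basic rfl (by decide) ?_) (by omega) ?_
  · have run : ∀ a e, S a → S e → 0 < sqd (X a) (Y a) (X e) (Y e) → ∀ cx cy,
        sqd cx cy (X a) (Y a) = sqd cx cy (X e) (Y e) →
        (∀ q, S q → sqd cx cy (X q) (Y q) ≤ sqd cx cy (X a) (Y a)) →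
        0 ≤ cross (X a) (Y a) (X e) (Y e) cx cy →
        ShrinkRunning S X Y N 0 (X a) (Y a) (X e) (Y e) := by
      intro a e ha he hpos cx cy heq hcov hc
      obtain ⟨t, ht, htq⟩ := exists_bisector_par hpos heq hc
      exact ⟨a, e, ha, he, rfl, rfl, rfl, rfl, hpos, ⟨t, ht, fun q hq => htq _ _ (hcov q hq)⟩,
        Finset.range N, fun q hq _ => Finset.mem_range.2 hq.1, by simp⟩
    -- `ShrinkRunning` wants the center not to the right of the chord; exchanging `a` and `e`
    -- achieves this.
    by_cases hc : 0 ≤ cross (X a) (Y a) (X e) (Y e) (X o + -s₅.rreg 10 * (X a - X o))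
        (Y o + -s₅.rreg 10 * (Y a - Y o))
    · have := run a e hsa hse (by rwa [sqd_comm]) _ _ heq hcov hc
      simpa [Program.run, g0, g1, g20, g21, g11, g12, hee, hc, -neg_mul] using this
    · have hc' : 0 ≤ cross (X e) (Y e) (X a) (Y a) (X o + -s₅.rreg 10 * (X a - X o))
          (Y o + -s₅.rreg 10 * (Y a - Y o)) := by
        have : cross (X e) (Y e) (X a) (Y a) (X o + -s₅.rreg 10 * (X a - X o))
          (Y o + -s₅.rreg 10 * (Y a - Y o)) = - cross (X a) (Y a) (X e) (Y e)
            (X o + -s₅.rreg 10 * (X a - X o)) (Y o + -s₅.rreg 10 * (Y a - Y o)) := by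
          unfold cross; ring
        linarith
      have := run e a hse hsa hea _ _ heq.symm (fun q hq => heq ▸ hcov q hq) hc'
      simpa [Program.run, g0, g1, g20, g21, g11, g12, hee, hc, -neg_mul] using this
  rintro s₆ ⟨h13, hrun⟩ hF₆
  have e0 : s₆.rmem 0 = X := (hF₆.rmem 0 (by decide)).trans g0
  have e1 : s₆.rmem 1 = Y := (hF₆.rmem 1 (by decide)).trans g1
  have e4 : s₆.nmem 4 = s.nmem 4 := (hF₆.nmem 4 (by decide)).trans g4
  have e3 : s₆.nreg 3 = N := (hF₆.nreg 3 (by decide)).trans g3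
  rw [← e0, ← e1] at hrun
  refine (loop_shrinkStep_spec e3 h13 (S := S) (by rw [e4]; exact fun q => Iff.rfl) hrun).imp
    le_rfl ?_
  rintro s' h -
  rw [e0, e1] at h
  exact ⟨h.1, Or.inr h.2⟩

end RealRAM

/-! ### Reachability in the free space of two curves -/

namespace CurveClustering

/-- The first `t` vertices of a curve can be matched with the first `j` vertices of another one,
where `cl` tells which vertices may be matched. -/
def Reach (cl : ℕ → ℕ → Prop) : ℕ → ℕ → Prop
  | 0, j => j = 0
  | _ + 1, 0 => False
  | t + 1, j + 1 => cl t j ∧ (Reach cl t (j + 1) ∨ Reach cl t j ∨ Reach cl (t + 1) j)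
termination_by t j => (t, j)

variable {cl cl' : ℕ → ℕ → Prop}

theorem reach_zero {j : ℕ} : Reach cl 0 j ↔ j = 0 := by rw [Reach]

theorem not_reach_succ_zero {t : ℕ} : ¬ Reach cl (t + 1) 0 := by rw [Reach]; exact id

theorem reach_succ_succ {t j : ℕ} : Reach cl (t + 1) (j + 1) ↔
    cl t j ∧ (Reach cl t (j + 1) ∨ Reach cl t j ∨ Reach cl (t + 1) j) := by rw [Reach]

theorem Reach.mono {T J : ℕ} (h : ∀ t j, t < T → j < J → cl t j → cl' t j) (hr : Reach cl T J) :
    Reach cl' T J := by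
  induction T generalizing J with
  | zero => rw [reach_zero] at *; exact hr
  | succ T ih =>
    induction J with
    | zero => exact absurd hr not_reach_succ_zero
    | succ J ihJ =>
      rw [reach_succ_succ] at *
      refine ⟨h _ _ (by omega) (by omega) hr.1, ?_⟩
      rcases hr.2 with h1 | h1 | h1
      · exact Or.inl (ih (fun t j ht hj => h t j (by omega) hj) h1)
      · exact Or.inr (Or.inl (ih (fun t j ht hj => h t j (by omega) (by omega)) h1))
      · exact Or.inr (Or.inr (ihJ (fun t j ht hj => h t j ht (by omega)) h1))

/-- Split the matching at the center vertex `t`: its predecessors take a prefix of length `e`, and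
`t` takes the rest. `e = j` is possible, since `t` may share vertex `j - 1` with its predecessor;
this is why `cl t (j - 1)` is stated separately. -/
theorem Reach.exists_suffix {t j : ℕ} (h : Reach cl (t + 1) j) :
    ∃ e, e ≤ j ∧ Reach cl t e ∧ (∀ i, e ≤ i → i < j → cl t i) ∧ 1 ≤ j ∧ cl t (j - 1) := by
  induction j with
  | zero => exact absurd h not_reach_succ_zero
  | succ j ih =>
    rw [reach_succ_succ] at h
    obtain ⟨hc, h | h | h⟩ := h
    · exact ⟨j + 1, le_rfl, h, fun i h1 h2 => by omega, by omega, hc⟩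
    · refine ⟨j, by omega, h, fun i h1 h2 => ?_, by omega, hc⟩
      obtain rfl : i = j := by omega
      exact hc
    · obtain ⟨e, he, hr, hs, -⟩ := ih h
      refine ⟨e, by omega, hr, fun i h1 h2 => ?_, by omega, hc⟩
      rcases Nat.lt_succ_iff_lt_or_eq.1 h2 with h3 | rfl
      · exact hs i h1 h3
      · exact hc

theorem Reach.append {t e j : ℕ} (h : Reach cl t e) (he : e ≤ j) (h1 : 1 ≤ j)
    (hs : ∀ i, e ≤ i → i < j → cl t i) (hl : cl t (j - 1)) : Reach cl (t + 1) j := by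
  rcases he.eq_or_lt with rfl | hlt
  · obtain ⟨e, rfl⟩ := Nat.exists_eq_add_of_le' h1
    exact reach_succ_succ.2 ⟨hl, Or.inl h⟩
  · have key : ∀ d, e + d < j → Reach cl (t + 1) (e + d + 1) := by
      intro d
      induction d with
      | zero => exact fun hd => reach_succ_succ.2 ⟨hs _ (by omega) hd, Or.inr (Or.inl h)⟩
      | succ d ih =>
        exact fun hd => reach_succ_succ.2 ⟨hs _ (by omega) hd, Or.inr (Or.inr (ih (by omega)))⟩
    have := key (j - 1 - e) (by omega)
    rwa [show e + (j - 1 - e) + 1 = j by omega] at this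

open Classical in
/-- `1` for true, `0` for false. -/
noncomputable def bit (p : Prop) : ℕ := if p then 1 else 0

theorem one_le_bit {p : Prop} : 1 ≤ bit p ↔ p := by unfold bit; split_ifs with h <;> simp [h]

theorem one_le_bit_add {p q r : Prop} : 1 ≤ bit p + bit q + bit r ↔ p ∨ q ∨ r := by
  unfold bit; split_ifs <;> simp_all

theorem bit_true {p : Prop} (h : p) : bit p = 1 := by simp [bit, h]
theorem bit_false {p : Prop} (h : ¬ p) : bit p = 0 := by simp [bit, h]

end CurveClustering

/-! ### Computing the table of reachable pairs -/

namespace RealRAM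
open PlaneGeometry CurveClustering

/-- Match the `reg 20` vertices of centers number `reg 21`, ... with the `reg 22` input points
number `reg 23`, .... Array `3` is the last row of the table of reachable pairs. -/
def reachRows : Program :=
  .setN 28 (.reg 22 + .const 1) ;;
  .forN 25 28 (.putN 3 (.reg 25) (.const 0)) ;;
  .putN 3 (.const 0) (.const 1) ;;
  .forN 24 20
    ((.setN 26 (.get 3 (.const 0)) ;; .putN 3 (.const 0) (.const 0)) ;;
      .forN 25 22
        (.setN 27 (.get 3 (.reg 25 + .const 1)) ;;
          .cond (.both (.natLE (.const 1) (.reg 27 + .reg 26 + .get 3 (.reg 25)))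
              (.realLE (pdistE (.get 2 (.reg 21)) (.get 3 (.reg 21)) (ptX (.reg 23 + .reg 25))
                (ptY (.reg 23 + .reg 25))) (.reg 1)))
            (.putN 3 (.reg 25 + .const 1) (.const 1)) (.putN 3 (.reg 25 + .const 1) (.const 0)) ;;
          .setN 26 (.reg 27)) ;;
      .setN 21 (.reg 21 + .const 1))

/-- Center vertex `c + t` may be matched with input point `o + j`. -/
def closeTo (s : State) (c o t j : ℕ) : Prop :=
  pdist (s.rmem 2 (c + t)) (s.rmem 3 (c + t)) (s.rmem 0 (o + j)) (s.rmem 1 (o + j)) ≤ s.rreg 1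

theorem closeTo_congr {s s' : State} (h0 : s'.rmem 0 = s.rmem 0) (h1 : s'.rmem 1 = s.rmem 1)
    (h2 : s'.rmem 2 = s.rmem 2) (h3 : s'.rmem 3 = s.rmem 3) (hr : s'.rreg 1 = s.rreg 1) :
    closeTo s' = closeTo s := by
  unfold closeTo; rw [h0, h1, h2, h3, hr]

/-- Dynamic programming with a single row that is updated in place. Register `26` saves the old
value of the left neighbor, the diagonal predecessor, before it is lost. Column `0` stands for the
empty prefix. -/
theorem reachRows_spec {s : State} {cnt c b o : ℕ} (h20 : s.nreg 20 = cnt) (h21 : s.nreg 21 = c)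
    (h22 : s.nreg 22 = b) (h23 : s.nreg 23 = o) :
    Wp reachRows s (200 * ((cnt + 1) * (b + 1))) (fun s' => s'.nreg 21 = c + cnt ∧
      s'.nreg 28 = b + 1 ∧ ∀ j ≤ b, s'.nmem 3 j = bit (Reach (closeTo s c o) cnt j)) := by
  set cl := closeTo s c o with hcl
  refine Wp.seq (T₁ := 10) (T₂ := 190 * ((cnt + 1) * (b + 1))) (Q₁ := fun s' => s'.nreg 28 = b + 1)
    (Wp.basic rfl (by decide) (by simp [Program.run, h22])) (by nlinarith) ?_
  intro s₁ h28 hF₁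
  refine Wp.seq (T₁ := 25 * (b + 1)) (T₂ := 165 * ((cnt + 1) * (b + 1)))
    (Q₁ := fun s' => ∀ j < b + 1, s'.nmem 3 j = 0) ?_ (by nlinarith) ?_
  · refine Wp.forN (B := 5) (fun m s' => ∀ j < m, s'.nmem 3 j = 0) h28 (by decide) (by decide)
      (by intro j s' v; simp) (by simp) ?_ (by omega) (fun s' h _ => h)
    intro m s' hm hI hF hj
    refine Wp.basic rfl (by decide) ?_
    intro j hjm
    rcases Nat.lt_succ_iff_lt_or_eq.1 hjm with h | rfl
    · have : j ≠ s'.nreg 25 := by omega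
      simp [Program.run, this, hI j h]
    · simp [Program.run, hj]
  intro s₂ hz hF₂
  refine Wp.seq (T₁ := 5) (T₂ := 160 * ((cnt + 1) * (b + 1)))
    (Q₁ := fun s' => ∀ j ≤ b, s'.nmem 3 j = bit (Reach cl 0 j)) (Wp.basic rfl (by decide) ?_)
    (by nlinarith) ?_
  · intro j hj
    by_cases h : j = 0
    · subst h; simp [Program.run, bit, reach_zero]
    · simp [Program.run, bit, reach_zero, h, hz j (by omega)]
  intro s₃ hz hF₃
  have hF := (hF₁.seqLeft (q := .forN 25 28 (.putN 3 (.reg 25) (.const 0)) ;;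
    .putN 3 (.const 0) (.const 1))).trans ((hF₂.seqLeft.trans hF₃.seqRight).seqRight)
  have f20 : s₃.nreg 20 = cnt := (hF.nreg 20 (by decide)).trans h20
  have f21 : s₃.nreg 21 = c := (hF.nreg 21 (by decide)).trans h21
  have f22 : s₃.nreg 22 = b := (hF.nreg 22 (by decide)).trans h22
  have f23 : s₃.nreg 23 = o := (hF.nreg 23 (by decide)).trans h23
  have f28 : s₃.nreg 28 = b + 1 := (hF₃.nreg 28 (by decide)).trans
    ((hF₂.nreg 28 (by decide)).trans h28)
  have fcl : closeTo s₃ c o = cl := by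
    rw [hcl, closeTo_congr (hF.rmem 0 (by decide)) (hF.rmem 1 (by decide)) (hF.rmem 2 (by decide))
      (hF.rmem 3 (by decide)) (hF.rreg 1 (by decide))]
  clear hF hF₁ hF₂ hF₃
  refine Wp.forN (B := 100 * (b + 1)) (fun t s' => s'.nreg 21 = c + t ∧
    ∀ j ≤ b, s'.nmem 3 j = bit (Reach cl t j)) f20 (by decide) (by decide)
      (by intro j s' v; simp) ⟨f21, hz⟩ ?_ (by nlinarith) ?_
  swap
  · rintro s' ⟨h1, h2⟩ hF
    exact ⟨h1, (hF.nreg 28 (by decide)).trans f28, h2⟩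
  rintro t s₄ ht ⟨g21, grow⟩ hF htj
  have g22 : s₄.nreg 22 = b := (hF.nreg 22 (by decide)).trans f22
  have g23 : s₄.nreg 23 = o := (hF.nreg 23 (by decide)).trans f23
  have gcl : closeTo s₄ c o = cl := by
    rw [← fcl, closeTo_congr (hF.rmem 0 (by decide)) (hF.rmem 1 (by decide)) (hF.rmem 2 (by decide))
      (hF.rmem 3 (by decide)) (hF.rreg 1 (by decide))]
  clear hF htj
  refine Wp.seq (T₁ := 8) (T₂ := 90 * (b + 1)) (Q₁ := fun s' => s'.nreg 26 = bit (Reach cl t 0) ∧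
    s'.nmem 3 0 = bit (Reach cl (t + 1) 0) ∧ ∀ j, 0 < j → j ≤ b → s'.nmem 3 j = bit (Reach cl t j))
    (Wp.basic rfl (by decide) ?_) (by omega) ?_
  · refine ⟨by simp [Program.run, grow 0 (by omega)], ?_, ?_⟩
    · simp [Program.run, bit_false (not_reach_succ_zero (cl := cl) (t := t))]
    · intro j h1 h2
      have : j ≠ 0 := by omega
      simp [Program.run, this, grow j h2]
  rintro s₅ ⟨k26, krow0, krow⟩ hF
  have k21 : s₅.nreg 21 = c + t := (hF.nreg 21 (by decide)).trans g21
  have k22 : s₅.nreg 22 = b := (hF.nreg 22 (by decide)).trans g22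
  have k23 : s₅.nreg 23 = o := (hF.nreg 23 (by decide)).trans g23
  have kcl : closeTo s₅ c o = cl := by
    rw [← gcl, closeTo_congr (hF.rmem 0 (by decide)) (hF.rmem 1 (by decide)) (hF.rmem 2 (by decide))
      (hF.rmem 3 (by decide)) (hF.rreg 1 (by decide))]
  clear hF
  refine Wp.seq (T₁ := 80 * (b + 1)) (T₂ := 10) (Q₁ := fun s' =>
    s'.nreg 21 = c + t ∧ ∀ j ≤ b, s'.nmem 3 j = bit (Reach cl (t + 1) j)) ?_ (by omega) ?_
  swap
  · rintro s' ⟨h1, h2⟩ -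
    refine Wp.basic rfl (by decide) ⟨by simp [Program.run, h1, add_assoc], h2⟩
  refine Wp.forN (B := 60) (fun i s' => s'.nreg 26 = bit (Reach cl t i) ∧
      (∀ j ≤ i, s'.nmem 3 j = bit (Reach cl (t + 1) j)) ∧
      ∀ j, i < j → j ≤ b → s'.nmem 3 j = bit (Reach cl t j)) k22 (by decide) (by decide)
      (by intro j s' v; simp) ⟨k26, ?_, krow⟩ ?_ (by omega) ?_
  · intro j hj
    obtain rfl : j = 0 := by omega
    exact krow0
  · rintro i s₆ hi ⟨l26, hlow, hhigh⟩ hF hij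
    have l21 : s₆.nreg 21 = c + t := (hF.nreg 21 (by decide)).trans k21
    have l23 : s₆.nreg 23 = o := (hF.nreg 23 (by decide)).trans k23
    have lcl : closeTo s₆ c o = cl := by
      rw [← kcl, closeTo_congr (hF.rmem 0 (by decide)) (hF.rmem 1 (by decide))
        (hF.rmem 2 (by decide)) (hF.rmem 3 (by decide)) (hF.rreg 1 (by decide))]
    have hold := hhigh (i + 1) (by omega) (by omega)
    have hcl' : cl t i ↔ pdist (s₆.rmem 2 (c + t)) (s₆.rmem 3 (c + t)) (s₆.rmem 0 (o + i))
      (s₆.rmem 1 (o + i)) ≤ s₆.rreg 1 := by rw [← lcl]; rfl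
    have hcond : (1 ≤ bit (Reach cl t (i + 1)) + bit (Reach cl t i) + bit (Reach cl (t + 1) i) ∧
        pdist (s₆.rmem 2 (c + t)) (s₆.rmem 3 (c + t)) (s₆.rmem 0 (o + i)) (s₆.rmem 1 (o + i)) ≤
          s₆.rreg 1) ↔ Reach cl (t + 1) (i + 1) := by
      rw [reach_succ_succ, ← hcl', and_comm, one_le_bit_add]
    refine Wp.basic rfl (by decide) ?_
    by_cases hre : Reach cl (t + 1) (i + 1)
    · have hc' := hcond.2 hre
      refine ⟨?_, fun j hj => ?_, fun j h1 h2 => ?_⟩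
      · simp [Program.run, hij, hold, l26, hlow i le_rfl, l21, l23, hc'.1, hc'.2]
      · rcases Nat.le_succ_iff.1 hj with h | rfl
        · have : j ≠ i + 1 := by omega
          simp [Program.run, hij, hold, l26, hlow i le_rfl, l21, l23, hc'.1, hc'.2, hlow j h, this]
        · simp [Program.run, hij, hold, l26, hlow i le_rfl, l21, l23, hc'.1, hc'.2, bit_true hre]
      · have : j ≠ i + 1 := by omega
        simp [Program.run, hij, hold, l26, hlow i le_rfl, l21, l23, hc'.1, hc'.2, this,
          hhigh j (by omega) h2]
    · have hc' := mt hcond.1 hre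
      refine ⟨?_, fun j hj => ?_, fun j h1 h2 => ?_⟩
      · simp [Program.run, hij, hold, l26, hlow i le_rfl, l21, l23, hc']
      · rcases Nat.le_succ_iff.1 hj with h | rfl
        · have : j ≠ i + 1 := by omega
          simp [Program.run, hij, hold, l26, hlow i le_rfl, l21, l23, hc', hlow j h, this]
        · simp [Program.run, hij, hold, l26, hlow i le_rfl, l21, l23, hc', bit_false hre]
      · have : j ≠ i + 1 := by omega
        simp [Program.run, hij, hold, l26, hlow i le_rfl, l21, l23, hc', this,
          hhigh j (by omega) h2]
  · rintro s' ⟨-, h, -⟩ hF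
    exact ⟨(hF.nreg 21 (by decide)).trans k21, h⟩

end RealRAM

/-! ### The points left to the last center vertex -/

namespace RealRAM
open PlaneGeometry CurveClustering

/-- The values that stay fixed after the initialization. -/
structure Env (n k ℓ N : ℕ) (comp : ℕ → ℕ) (X Y : ℕ → ℝ) (s : State) : Prop where
  n_eq : s.nreg 0 = n
  k_eq : s.nreg 1 = k
  ℓ_eq : s.nreg 2 = ℓ
  N_eq : s.nreg 3 = N
  km_eq : s.nreg 4 = k - 1
  lm_eq : s.nreg 5 = ℓ - 1
  kl_eq : s.nreg 6 = k * ℓ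
  klm_eq : s.nreg 7 = k * ℓ - 1
  L_eq : s.nreg 8 = 2 * (k * ℓ - 1)
  comp_eq : s.nmem 0 = comp
  X_eq : s.rmem 0 = X
  Y_eq : s.rmem 1 = Y

theorem Env.of_frame {n k ℓ N : ℕ} {comp : ℕ → ℕ} {X Y : ℕ → ℝ} {s s' : State} {p : Program}
    (h : Env n k ℓ N comp X Y s) (hF : Frame p s s') (h1 : ∀ r < 9, r ∉ p.wn) (h2 : 0 ∉ p.wna)
    (h3 : 0 ∉ p.wra) (h4 : 1 ∉ p.wra) : Env n k ℓ N comp X Y s' :=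
  ⟨(hF.nreg 0 (h1 _ (by omega))).trans h.n_eq, (hF.nreg 1 (h1 _ (by omega))).trans h.k_eq,
   (hF.nreg 2 (h1 _ (by omega))).trans h.ℓ_eq, (hF.nreg 3 (h1 _ (by omega))).trans h.N_eq,
   (hF.nreg 4 (h1 _ (by omega))).trans h.km_eq, (hF.nreg 5 (h1 _ (by omega))).trans h.lm_eq,
   (hF.nreg 6 (h1 _ (by omega))).trans h.kl_eq, (hF.nreg 7 (h1 _ (by omega))).trans h.klm_eq,
   (hF.nreg 8 (h1 _ (by omega))).trans h.L_eq, (hF.nmem 0 h2).trans h.comp_eq,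
   (hF.rmem 0 h3).trans h.X_eq, (hF.rmem 1 h4).trans h.Y_eq⟩

/-- The number of the first vertex of curve `g`. -/
def off (comp : ℕ → ℕ) (g : ℕ) : ℕ := ∑ i ∈ Finset.range g, comp i

theorem off_succ (comp : ℕ → ℕ) (g : ℕ) : off comp (g + 1) = off comp g + comp g :=
  Finset.sum_range_succ _ _

theorem off_mono (comp : ℕ → ℕ) {g g' : ℕ} (h : g ≤ g') : off comp g ≤ off comp g' :=
  Finset.sum_le_sum_of_subset (Finset.range_mono h)

/-- Decide for curve number `reg 30`, whose first vertex is number `reg 23`, which of its vertices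
have to be matched with the last vertex of the last center. -/
def markCurve : Program :=
  (.setN 22 (.get 0 (.reg 30)) ;; .setN 33 (.const 0) ;; .setN 21 (.const 0) ;;
    .setN 20 (.reg 2)) ;;
  .forN 31 4 (reachRows ;; .cond (.natLE (.const 1) (.get 3 (.reg 22))) (.setN 33 (.const 1)) .skip) ;;
  .setN 20 (.reg 5) ;;
  reachRows ;;
  (.setN 34 (.const 0) ;; .setN 35 (.const 0)) ;;
  .forN 32 28 (.cond (.natLE (.const 1) (.get 3 (.reg 32)))
    (.setN 34 (.reg 32) ;; .setN 35 (.const 1)) .skip) ;;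
  .cond (.both (.natLE (.reg 35) (.const 0)) (.natLE (.reg 33) (.const 0)))
    (.setN 36 (.const 0)) .skip ;;
  .forN 32 22
    (.cond (.both (.natLE (.reg 33) (.const 0)) (.neg (.both (.neg (.natLE (.reg 34) (.reg 32)))
        (.neg (.natLE (.reg 22) (.reg 32 + .const 1))))))
      (.putN 4 (.reg 23 + .reg 32) (.const 1)) (.putN 4 (.reg 23 + .reg 32) (.const 0))) ;;
  .setN 23 (.reg 23 + .reg 22)

/-- Mark the input points that have to be matched with the last vertex of the last center. -/
def mark : Program :=
  (.setN 36 (.const 1) ;; .setN 23 (.const 0)) ;; .forN 30 0 markCurve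

/-- One of the centers except for the last one is close to the curve `g`. -/
def Covered (s : State) (k ℓ : ℕ) (comp : ℕ → ℕ) (g : ℕ) : Prop :=
  ∃ i < k - 1, Reach (closeTo s (i * ℓ) (off comp g)) ℓ (comp g)

/-- The last center, without its last vertex, can be matched with the first `e` vertices of `g`. -/
def LastReach (s : State) (k ℓ : ℕ) (comp : ℕ → ℕ) (g e : ℕ) : Prop :=
  Reach (closeTo s ((k - 1) * ℓ) (off comp g)) (ℓ - 1) e

/-- Vertex `j` of `g` has to be matched with the last vertex of the last center. -/
def Needed (s : State) (k ℓ : ℕ) (comp : ℕ → ℕ) (g j : ℕ) : Prop :=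
  ¬ Covered s k ℓ comp g ∧
    ((∀ e ≤ comp g, LastReach s k ℓ comp g e → e ≤ j) ∨ comp g ≤ j + 1)

/-- Only the longest reachable prefix matters, because a longer prefix leaves fewer vertices to the
last center vertex. Register `33` records whether an earlier center serves the curve, `34` the
longest prefix, `35` whether there is one, and `36` drops to `0` if the curve cannot be served at
all. -/
theorem markCurve_spec {n k ℓ N : ℕ} {comp : ℕ → ℕ} {X Y : ℕ → ℝ} {s : State}
    (hE : Env n k ℓ N comp X Y s) {g : ℕ} (h30 : s.nreg 30 = g) (h23 : s.nreg 23 = off comp g) :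
    Wp markCurve s (1000 * (k * ((ℓ + 1) * (comp g + 1))) + 1000 * ((ℓ + 1) * (comp g + 1))) (fun s' =>
      s'.nreg 23 = off comp (g + 1) ∧
      (((Covered s k ℓ comp g ∨ ∃ e ≤ comp g, LastReach s k ℓ comp g e) ∧ s'.nreg 36 = s.nreg 36) ∨
        ((¬ Covered s k ℓ comp g ∧ ∀ e ≤ comp g, ¬ LastReach s k ℓ comp g e) ∧ s'.nreg 36 = 0)) ∧
      (∀ p < off comp g, s'.nmem 4 p = s.nmem 4 p) ∧
      ∀ j < comp g, 1 ≤ s'.nmem 4 (off comp g + j) ↔ Needed s k ℓ comp g j) := by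
  set b := comp g with hb
  set q := (ℓ + 1) * (b + 1) with hq
  have hbq : b + 1 ≤ q := Nat.le_mul_of_pos_left _ (by omega)
  set cl := fun i => closeTo s (i * ℓ) (off comp g) with hcl
  refine Wp.seq (T₁ := 20) (T₂ := 1000 * (k * q) + 900 * q)
    (Q₁ := fun s' => s'.nreg 22 = b ∧ s'.nreg 33 = 0 ∧ s'.nreg 21 = 0 ∧ s'.nreg 20 = ℓ)
    (Wp.basic rfl (by decide) (by simp [Program.run, hE.comp_eq, hE.ℓ_eq, h30, hb])) (by omega) ?_
  rintro s₁ ⟨a22, a33, a21, a20⟩ hF₁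
  refine Wp.seq (T₁ := (k - 1) * ((200 * q + 20) + 10) + 8) (T₂ := 800 * q)
    (Q₁ := fun s' => s'.nreg 21 = (k - 1) * ℓ ∧ (1 ≤ s'.nreg 33 ↔ Covered s k ℓ comp g))
    ?_ (by
      have : (k - 1) * ((200 * q + 20) + 10) ≤ k * (1000 * q) :=
        Nat.mul_le_mul (by omega) (by omega)
      nlinarith) ?_
  · refine Wp.forN (fun i s' => s'.nreg 21 = i * ℓ ∧
      (1 ≤ s'.nreg 33 ↔ ∃ i' < i, Reach (cl i') ℓ b))
      ((hF₁.nreg 4 (by decide)).trans hE.km_eq) (by decide) (by decide)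
      (by intro j s' v; simp) (by simp [a21, a33]) ?_ le_rfl (fun s' h _ => h)
    rintro i s₂ hi ⟨b21, b33⟩ hF hi'
    have b22 : s₂.nreg 22 = b := (hF.nreg 22 (by decide)).trans a22
    have b20 : s₂.nreg 20 = ℓ := (hF.nreg 20 (by decide)).trans a20
    have b23 : s₂.nreg 23 = off comp g := ((hF.nreg 23 (by decide)).trans
      (hF₁.nreg 23 (by decide))).trans h23
    have bcl : closeTo s₂ = closeTo s := by
      rw [closeTo_congr (hF.rmem 0 (by decide)) (hF.rmem 1 (by decide)) (hF.rmem 2 (by decide))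
        (hF.rmem 3 (by decide)) (hF.rreg 1 (by decide)),
        closeTo_congr (hF₁.rmem 0 (by decide)) (hF₁.rmem 1 (by decide)) (hF₁.rmem 2 (by decide))
        (hF₁.rmem 3 (by decide)) (hF₁.rreg 1 (by decide))]
    refine Wp.seq (reachRows_spec b20 b21 b22 b23) (T₂ := 20) (by omega) ?_
    rintro s₃ ⟨c21, -, c3⟩ hF'
    have c22 : s₃.nreg 22 = b := (hF'.nreg 22 (by decide)).trans b22
    have c33 : s₃.nreg 33 = s₂.nreg 33 := hF'.nreg 33 (by decide)
    have c3b := c3 b le_rfl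
    rw [bcl] at c3b
    refine Wp.basic rfl (by decide) ?_
    by_cases hr : Reach (cl i) ℓ b
    · have hc : 1 ≤ s₃.nmem 3 b := by rw [c3b]; exact one_le_bit.2 hr
      refine ⟨by simp [Program.run, c22, hc, c21]; ring, ?_⟩
      simp only [Program.run, Test.Holds, NExpr.eval, c22, hc, if_true, Function.update_self,
        le_refl, true_iff]
      exact ⟨i, by omega, hr⟩
    · have hc : ¬ 1 ≤ s₃.nmem 3 b := by rw [c3b, one_le_bit]; exact hr
      refine ⟨by simp only [Program.run, Test.Holds, NExpr.eval, c22, hc, if_false, c21]; ring, ?_⟩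
      simp only [Program.run, Test.Holds, NExpr.eval, c22, hc, if_false, c33, b33]
      constructor
      · rintro ⟨i', h1, h2⟩; exact ⟨i', by omega, h2⟩
      · rintro ⟨i', h1, h2⟩
        refine ⟨i', lt_of_le_of_ne (by omega) ?_, h2⟩
        rintro rfl; exact hr h2
  rintro s₂ ⟨b21, b33⟩ hF₂
  refine Wp.seq (T₁ := 5) (T₂ := 780 * q) (Q₁ := fun s' => s'.nreg 20 = ℓ - 1)
    (Wp.basic rfl (by decide) ?_) (by omega) ?_
  · simp [Program.run, hF₂.nreg 5 (by decide), hF₁.nreg 5 (by decide), hE.lm_eq]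
  intro s₃ c20 hF₃
  have c21 : s₃.nreg 21 = (k - 1) * ℓ := (hF₃.nreg 21 (by decide)).trans b21
  have c22 : s₃.nreg 22 = b := (hF₃.nreg 22 (by decide)).trans ((hF₂.nreg 22 (by decide)).trans a22)
  have c23 : s₃.nreg 23 = off comp g := (hF₃.nreg 23 (by decide)).trans
    ((hF₂.nreg 23 (by decide)).trans ((hF₁.nreg 23 (by decide)).trans h23))
  have c33 : 1 ≤ s₃.nreg 33 ↔ Covered s k ℓ comp g := by rw [hF₃.nreg 33 (by decide)]; exact b33
  have c36 : s₃.nreg 36 = s.nreg 36 := (hF₃.nreg 36 (by decide)).trans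
    ((hF₂.nreg 36 (by decide)).trans (hF₁.nreg 36 (by decide)))
  have c4 : s₃.nmem 4 = s.nmem 4 := (hF₃.nmem 4 (by decide)).trans
    ((hF₂.nmem 4 (by decide)).trans (hF₁.nmem 4 (by decide)))
  have ccl : closeTo s₃ = closeTo s := by
    rw [closeTo_congr (hF₃.rmem 0 (by decide)) (hF₃.rmem 1 (by decide)) (hF₃.rmem 2 (by decide))
      (hF₃.rmem 3 (by decide)) (hF₃.rreg 1 (by decide)),
      closeTo_congr (hF₂.rmem 0 (by decide)) (hF₂.rmem 1 (by decide)) (hF₂.rmem 2 (by decide))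
      (hF₂.rmem 3 (by decide)) (hF₂.rreg 1 (by decide)),
      closeTo_congr (hF₁.rmem 0 (by decide)) (hF₁.rmem 1 (by decide)) (hF₁.rmem 2 (by decide))
      (hF₁.rmem 3 (by decide)) (hF₁.rreg 1 (by decide))]
  clear hF₁ hF₂ hF₃ b21 b33 a22 a33 a21 a20
  refine Wp.seq (reachRows_spec c20 c21 c22 c23) (T₂ := 570 * q)
    (by
      have : (ℓ - 1 + 1) * (b + 1) ≤ q := Nat.mul_le_mul_right _ (by omega)
      omega) ?_
  rintro s₄ ⟨-, d28, d3⟩ hF₄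
  rw [ccl] at d3
  refine Wp.seq (T₁ := 5) (T₂ := 560 * q) (Q₁ := fun s' => s'.nreg 34 = 0 ∧ s'.nreg 35 = 0)
    (Wp.basic rfl (by decide) (by simp [Program.run])) (by omega) ?_
  rintro s₅ ⟨e34, e35⟩ hF₅
  have e28 : s₅.nreg 28 = b + 1 := (hF₅.nreg 28 (by decide)).trans d28
  have e3 : ∀ j ≤ b, (1 ≤ s₅.nmem 3 j ↔ LastReach s k ℓ comp g j) := by
    intro j hj
    rw [hF₅.nmem 3 (by decide), d3 j hj]
    exact one_le_bit
  refine Wp.seq (T₁ := (b + 1) * (20 + 10) + 8) (T₂ := 500 * q) (Q₁ := fun s' =>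
    (s'.nreg 35 = 0 ∧ s'.nreg 34 = 0 ∧ ∀ e ≤ b, ¬ LastReach s k ℓ comp g e) ∨
    (s'.nreg 35 = 1 ∧ s'.nreg 34 ≤ b ∧ LastReach s k ℓ comp g (s'.nreg 34) ∧
      ∀ e ≤ b, LastReach s k ℓ comp g e → e ≤ s'.nreg 34)) ?_ (by omega) ?_
  · refine Wp.forN (fun m s' =>
      (s'.nreg 35 = 0 ∧ s'.nreg 34 = 0 ∧ ∀ e < m, ¬ LastReach s k ℓ comp g e) ∨
      (s'.nreg 35 = 1 ∧ s'.nreg 34 ≤ b ∧ LastReach s k ℓ comp g (s'.nreg 34) ∧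
      ∀ e < m, LastReach s k ℓ comp g e → e ≤ s'.nreg 34)) e28 (by decide) (by decide)
      (by intro j s' v; simp) (Or.inl ⟨e35, e34, by simp⟩) ?_ le_rfl ?_
    · intro m s' hm hI hF hj
      have hm3 := e3 m (by omega)
      rw [← hF.nmem 3 (by decide)] at hm3
      refine Wp.basic rfl (by decide) ?_
      by_cases hr : LastReach s k ℓ comp g m
      · have := hm3.2 hr
        refine Or.inr ?_
        simp only [Program.run, Test.Holds, NExpr.eval, hj, this, if_true]
        refine ⟨by simp, by simp; omega, by simpa using hr, fun e he _ => by simp; omega⟩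
      · have : ¬ 1 ≤ s'.nmem 3 m := fun h => hr (hm3.1 h)
        simp only [Program.run, Test.Holds, NExpr.eval, hj, this, if_false]
        rcases hI with ⟨h1, h2, h3⟩ | ⟨h1, h2, h3, h4⟩
        · refine Or.inl ⟨h1, h2, fun e he => ?_⟩
          rcases Nat.lt_succ_iff_lt_or_eq.1 he with h | rfl
          · exact h3 e h
          · exact hr
        · refine Or.inr ⟨h1, h2, h3, fun e he hre => ?_⟩
          rcases Nat.lt_succ_iff_lt_or_eq.1 he with h | rfl
          · exact h4 e h hre
          · exact absurd hre hr
    · rintro s' (⟨h1, h2, h3⟩ | ⟨h1, h2, h3, h4⟩) -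
      · exact Or.inl ⟨h1, h2, fun e he => h3 e (by omega)⟩
      · exact Or.inr ⟨h1, h2, h3, fun e he => h4 e (by omega)⟩
  intro s₆ hlast hF₆
  have f33 : 1 ≤ s₆.nreg 33 ↔ Covered s k ℓ comp g := by
    rw [hF₆.nreg 33 (by decide), hF₅.nreg 33 (by decide), hF₄.nreg 33 (by decide)]; exact c33
  have f36 : s₆.nreg 36 = s.nreg 36 := by
    rw [hF₆.nreg 36 (by decide), hF₅.nreg 36 (by decide), hF₄.nreg 36 (by decide)]; exact c36
  have f22 : s₆.nreg 22 = b := by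
    rw [hF₆.nreg 22 (by decide), hF₅.nreg 22 (by decide), hF₄.nreg 22 (by decide)]; exact c22
  have f23 : s₆.nreg 23 = off comp g := by
    rw [hF₆.nreg 23 (by decide), hF₅.nreg 23 (by decide), hF₄.nreg 23 (by decide)]; exact c23
  have f4 : s₆.nmem 4 = s.nmem 4 := by
    rw [hF₆.nmem 4 (by decide), hF₅.nmem 4 (by decide), hF₄.nmem 4 (by decide)]; exact c4
  clear hF₄ hF₅ hF₆ c20 c21 c22 c23 c33 c36 c4 ccl d28 d3 e34 e35 e28 e3
  refine Wp.seq (T₁ := 20) (T₂ := 450 * q) (Q₁ := fun s' =>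
    ((Covered s k ℓ comp g ∨ ∃ e ≤ comp g, LastReach s k ℓ comp g e) ∧ s'.nreg 36 = s.nreg 36) ∨
    ((¬ Covered s k ℓ comp g ∧ ∀ e ≤ comp g, ¬ LastReach s k ℓ comp g e) ∧ s'.nreg 36 = 0))
    (Wp.basic rfl (by decide) ?_) (by omega) ?_
  · by_cases hc : Covered s k ℓ comp g
    · have := f33.2 hc
      refine Or.inl ⟨Or.inl hc, ?_⟩
      have h' : ¬ s₆.nreg 33 = 0 := by omega
      simp [Program.run, h', f36]
    · have h' : s₆.nreg 33 = 0 := by have := mt f33.1 hc; omega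
      rcases hlast with ⟨h1, h2, h3⟩ | ⟨h1, h2, h3, h4⟩
      · exact Or.inr ⟨⟨hc, h3⟩, by simp [Program.run, h', h1]⟩
      · exact Or.inl ⟨Or.inr ⟨_, h2, h3⟩, by simp [Program.run, h1, f36]⟩
  intro s₇ h36 hF₇
  have g33 : 1 ≤ s₇.nreg 33 ↔ Covered s k ℓ comp g := by rw [hF₇.nreg 33 (by decide)]; exact f33
  have g22 : s₇.nreg 22 = b := (hF₇.nreg 22 (by decide)).trans f22
  have g23 : s₇.nreg 23 = off comp g := (hF₇.nreg 23 (by decide)).trans f23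
  have g4 : s₇.nmem 4 = s.nmem 4 := (hF₇.nmem 4 (by decide)).trans f4
  -- If no prefix is reachable, register `34` has its default `0`, and both sides are true.
  have g34 : ∀ j, s₇.nreg 34 ≤ j ↔ ∀ e ≤ b, LastReach s k ℓ comp g e → e ≤ j := by
    intro j
    rw [hF₇.nreg 34 (by decide)]
    rcases hlast with ⟨h1, h2, h3⟩ | ⟨h1, h2, h3, h4⟩
    · rw [h2]; exact ⟨fun _ e he hr => absurd hr (h3 e he), fun _ => by omega⟩
    · exact ⟨fun h e he hr => (h4 e he hr).trans h, fun h => h _ h2 h3⟩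
  refine Wp.seq (T₁ := b * (50 + 10) + 8) (T₂ := 20) (Q₁ := fun s' =>
    (∀ p < off comp g, s'.nmem 4 p = s.nmem 4 p) ∧
      ∀ j < comp g, 1 ≤ s'.nmem 4 (off comp g + j) ↔ Needed s k ℓ comp g j) ?_ (by omega) ?_
  · refine Wp.forN (fun m s' => (∀ p < off comp g, s'.nmem 4 p = s.nmem 4 p) ∧
      ∀ j < m, 1 ≤ s'.nmem 4 (off comp g + j) ↔ Needed s k ℓ comp g j) g22 (by decide) (by decide)
      (by intro j s' v; simp) (by simp [g4]) ?_ le_rfl (fun s' h _ => h)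
    rintro m s' hm ⟨hI1, hI2⟩ hF hj
    have k33 : s'.nreg 33 = s₇.nreg 33 := hF.nreg 33 (by decide)
    have k34 : s'.nreg 34 = s₇.nreg 34 := hF.nreg 34 (by decide)
    have k22 : s'.nreg 22 = b := (hF.nreg 22 (by decide)).trans g22
    have k23 : s'.nreg 23 = off comp g := (hF.nreg 23 (by decide)).trans g23
    have hcond : ((Test.both (.natLE (.reg 33) (.const 0)) (.neg (.both (.neg (.natLE (.reg 34)
        (.reg 32))) (.neg (.natLE (.reg 22) (.reg 32 + .const 1)))))).Holds s') ↔
        Needed s k ℓ comp g m := by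
      simp only [Test.Holds, NExpr.eval, k33, k34, k22, hj, Needed, g34, ← hb]
      rw [← g33]
      constructor
      · rintro ⟨h1, h2⟩; exact ⟨by omega, by tauto⟩
      · rintro ⟨h1, h2⟩; exact ⟨by omega, by tauto⟩
    refine Wp.basic rfl (by decide) ?_
    have hne : ∀ p < off comp g + m, p ≠ off comp g + m := fun p hp => hp.ne
    simp only [Program.run]
    by_cases hN : Needed s k ℓ comp g m
    · rw [if_pos (hcond.2 hN)]
      refine ⟨fun p hp => ?_, fun j hjm => ?_⟩
      · simp [k23, hj, hne p (by omega), hI1 p hp]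
      · rcases Nat.lt_succ_iff_lt_or_eq.1 hjm with h | rfl
        · simp [k23, hj, h.ne, hI2 j h]
        · simp [k23, hj, hN]
    · rw [if_neg (mt hcond.1 hN)]
      refine ⟨fun p hp => ?_, fun j hjm => ?_⟩
      · simp [k23, hj, hne p (by omega), hI1 p hp]
      · rcases Nat.lt_succ_iff_lt_or_eq.1 hjm with h | rfl
        · simp [k23, hj, h.ne, hI2 j h]
        · simp [k23, hj, hN]
  rintro s₈ ⟨h1, h2⟩ hF₈
  have k22 : s₈.nreg 22 = b := (hF₈.nreg 22 (by decide)).trans g22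
  have k23 : s₈.nreg 23 = off comp g := (hF₈.nreg 23 (by decide)).trans g23
  have k36 : s₈.nreg 36 = s₇.nreg 36 := hF₈.nreg 36 (by decide)
  refine Wp.basic rfl (by decide) ⟨by simp [Program.run, k22, k23, off_succ, hb], ?_, h1, h2⟩
  simpa [Program.run, k36] using h36

theorem needed_congr {s s' : State} (h : closeTo s' = closeTo s) (k ℓ : ℕ) (comp : ℕ → ℕ) :
    Covered s' k ℓ comp = Covered s k ℓ comp ∧ LastReach s' k ℓ comp = LastReach s k ℓ comp ∧
      Needed s' k ℓ comp = Needed s k ℓ comp := by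
  have h1 : Covered s' k ℓ comp = Covered s k ℓ comp := by ext g; simp only [Covered, h]
  have h2 : LastReach s' k ℓ comp = LastReach s k ℓ comp := by ext g e; simp only [LastReach, h]
  exact ⟨h1, h2, by ext g j; simp only [Needed, h1, h2]⟩

theorem mark_spec {n k ℓ N m : ℕ} {comp : ℕ → ℕ} {X Y : ℕ → ℝ} {s : State}
    (hE : Env n k ℓ N comp X Y s) (hn : 1 ≤ n) (hk : 1 ≤ k) (hℓ : 1 ≤ ℓ) (hm : 1 ≤ m)
    (hcomp : ∀ g < n, comp g ≤ m) :
    Wp mark s (10000 * (n * (k * (ℓ * m)))) (fun s' =>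
      ((s'.nreg 36 = 1 ∧ ∀ g < n, Covered s k ℓ comp g ∨ ∃ e ≤ comp g, LastReach s k ℓ comp g e) ∨
        (s'.nreg 36 = 0 ∧ ∃ g < n, ¬ Covered s k ℓ comp g ∧
          ∀ e ≤ comp g, ¬ LastReach s k ℓ comp g e)) ∧
      ∀ g < n, ∀ j < comp g, 1 ≤ s'.nmem 4 (off comp g + j) ↔ Needed s k ℓ comp g j) := by
  have hlm : 1 ≤ ℓ * m := Nat.mul_pos hℓ hm
  have hklm : 1 ≤ k * (ℓ * m) := Nat.mul_pos hk hlm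
  have hnk : 1 ≤ n * (k * (ℓ * m)) := Nat.mul_pos hn hklm
  refine Wp.seq (T₁ := 10) (T₂ := n * (8000 * (k * (ℓ * m)) + 10) + 8)
    (Q₁ := fun s' => s'.nreg 36 = 1 ∧ s'.nreg 23 = 0)
    (Wp.basic rfl (by decide) (by simp [Program.run])) (by nlinarith) ?_
  rintro s₁ ⟨h36, h23⟩ hF₁
  refine Wp.forN (fun g s' => s'.nreg 23 = off comp g ∧
      ((s'.nreg 36 = 1 ∧ ∀ g' < g, Covered s k ℓ comp g' ∨
          ∃ e ≤ comp g', LastReach s k ℓ comp g' e) ∨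
        (s'.nreg 36 = 0 ∧ ∃ g' < n, ¬ Covered s k ℓ comp g' ∧
          ∀ e ≤ comp g', ¬ LastReach s k ℓ comp g' e)) ∧
      ∀ g' < g, ∀ j < comp g', 1 ≤ s'.nmem 4 (off comp g' + j) ↔ Needed s k ℓ comp g' j)
    ((hF₁.nreg 0 (by decide)).trans hE.n_eq) (by decide) (by decide) (by intro j s' v; simp)
    ⟨by simp [h23, off], Or.inl ⟨h36, by simp⟩, by simp⟩ ?_ le_rfl (fun s' h _ => h.2)
  rintro g s₂ hg ⟨b23, b36, b4⟩ hF₂ hg30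
  have hE₂ : Env n k ℓ N comp X Y s₂ :=
    (hE.of_frame hF₁ (by decide) (by decide) (by decide) (by decide)).of_frame hF₂
      (by decide) (by decide) (by decide) (by decide)
  have hcl : closeTo s₂ = closeTo s := by
    rw [closeTo_congr (hF₂.rmem 0 (by decide)) (hF₂.rmem 1 (by decide)) (hF₂.rmem 2 (by decide))
      (hF₂.rmem 3 (by decide)) (hF₂.rreg 1 (by decide)),
      closeTo_congr (hF₁.rmem 0 (by decide)) (hF₁.rmem 1 (by decide)) (hF₁.rmem 2 (by decide))
      (hF₁.rmem 3 (by decide)) (hF₁.rreg 1 (by decide))]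
  obtain ⟨hcov, hlast, hneed⟩ := needed_congr hcl k ℓ comp
  refine (markCurve_spec hE₂ hg30 b23).imp ?_ ?_
  · have h1 : (ℓ + 1) * (comp g + 1) ≤ 4 * (ℓ * m) :=
      (Nat.mul_le_mul (by omega : ℓ + 1 ≤ 2 * ℓ) (by have := hcomp g hg; omega :
        comp g + 1 ≤ 2 * m)).trans (by ring_nf; omega)
    have h2 := Nat.mul_le_mul_left k h1
    have h3 : ℓ * m ≤ k * (ℓ * m) := Nat.le_mul_of_pos_left _ hk
    have h4 : k * (4 * (ℓ * m)) = 4 * (k * (ℓ * m)) := by ring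
    omega
  · rintro s' ⟨c23, c36, c4, c4'⟩ -
    rw [hcov, hlast] at c36
    rw [hneed] at c4'
    refine ⟨c23, ?_, fun g' hg' j hj => ?_⟩
    · rcases b36 with ⟨b1, b2⟩ | ⟨b1, b2⟩
      · rcases c36 with ⟨c1, c2⟩ | ⟨c1, c2⟩
        · refine Or.inl ⟨c2.trans b1, fun g' hg' => ?_⟩
          rcases Nat.lt_succ_iff_lt_or_eq.1 hg' with h | rfl
          · exact b2 g' h
          · exact c1
        · exact Or.inr ⟨c2, g, hg, c1⟩
      · refine Or.inr ⟨?_, b2⟩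
        rcases c36 with ⟨c1, c2⟩ | ⟨c1, c2⟩
        · exact c2.trans b1
        · exact c2
    · rcases Nat.lt_succ_iff_lt_or_eq.1 hg' with h | rfl
      · rw [c4 _ (by have := off_mono comp (Nat.succ_le_of_lt h); rw [off_succ] at this; omega)]
        exact b4 g' h j hj
      · exact c4' j hj

end RealRAM

namespace RealRAM

/-! ### Counting in base `N` -/

/-- Counting up to `N ^ L` therefore meets every tuple of candidates. -/
theorem exists_digits {N : ℕ} (L : ℕ) (F : ℕ → ℕ) (hF : ∀ i < L, F i < N) :
    ∃ v < N ^ L, ∀ i < L, v / N ^ i % N = F i := by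
  let f : Fin L → Fin N := fun i => ⟨F i, hF i i.2⟩
  refine ⟨finFunctionFinEquiv f, (finFunctionFinEquiv f).2, fun i hi => ?_⟩
  have h := congrArg Fin.val (congrFun (finFunctionFinEquiv.symm_apply_apply f) ⟨i, hi⟩)
  simpa [finFunctionFinEquiv, f] using h

theorem mod_pow_of_digits {N v j : ℕ} (hN : 1 ≤ N) (h : ∀ i < j, v / N ^ i % N = N - 1) :
    v % N ^ j = N ^ j - 1 := by
  induction j with
  | zero => simp [Nat.mod_one]
  | succ j ih =>
    rw [Nat.mod_pow_succ, ih fun i hi => h i (by omega), h j (by omega), pow_succ, Nat.mul_sub,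
      mul_one]
    have h1 : 1 ≤ N ^ j := Nat.one_le_pow _ _ hN
    have h2 : N ^ j ≤ N ^ j * N := Nat.le_mul_of_pos_right _ hN
    omega

theorem succ_eq_mul_of_digits {N v j : ℕ} (hN : 1 ≤ N) (h : ∀ i < j, v / N ^ i % N = N - 1) :
    v + 1 = N ^ j * (v / N ^ j + 1) := by
  have h1 := mod_pow_of_digits hN h
  have h2 := Nat.div_add_mod v (N ^ j)
  have h3 : 1 ≤ N ^ j := Nat.one_le_pow _ _ hN
  rw [mul_add, mul_one]
  omega

/-- With `j` maximal low digits, `v + 1` equals `N ^ j * (v / N ^ j + 1)`: the low digits vanish,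
and the carry is absorbed by digit `j`. -/
theorem succ_digits {N v j i : ℕ} (hN : 1 ≤ N) (h : ∀ i < j, v / N ^ i % N = N - 1)
    (hj : v / N ^ j % N + 1 < N) :
    (v + 1) / N ^ i % N =
      if i < j then 0 else if i = j then v / N ^ j % N + 1 else v / N ^ i % N := by
  have hs := succ_eq_mul_of_digits hN h
  have hpos : ∀ d, 0 < N ^ d := fun d => Nat.pow_pos hN
  split_ifs with h1 h2
  · obtain ⟨d, rfl⟩ := Nat.exists_eq_add_of_lt h1
    rw [hs, show N ^ (i + d + 1) * (v / N ^ (i + d + 1) + 1) =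
      N ^ i * (N * (N ^ d * (v / N ^ (i + d + 1) + 1))) by ring,
      Nat.mul_div_cancel_left _ (hpos i), Nat.mul_mod_right]
  · subst h2
    rw [hs, Nat.mul_div_cancel_left _ (hpos i), Nat.add_mod, Nat.mod_eq_of_lt (a := 1) (by omega),
      Nat.mod_eq_of_lt hj]
  · obtain ⟨d, rfl⟩ := Nat.exists_eq_add_of_lt (show j < i by omega)
    have e : N ^ (j + d + 1) = N ^ j * (N * N ^ d) := by ring
    rw [e, ← Nat.div_div_eq_div_mul, ← Nat.div_div_eq_div_mul, ← Nat.div_div_eq_div_mul,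
      ← Nat.div_div_eq_div_mul, hs, Nat.mul_div_cancel_left _ (hpos j)]
    congr 2
    set w := v / N ^ j with hw
    have h4 := Nat.div_add_mod w N
    rw [Nat.div_eq_iff hN] 
    rw [mul_comm] at h4
    constructor <;> omega

/-- Add `1` to the number whose `reg 8` digits in base `reg 3` are in array `2`. Register `44` is
set to `0` if this causes an overflow. -/
def nextDigits : Program :=
  .setN 43 (.const 0) ;;
  .loop (.both (.natLT (.reg 43) (.reg 8)) (.natLE (.reg 3) (.get 2 (.reg 43) + .const 1)))
    (.putN 2 (.reg 43) (.const 0) ;; .setN 43 (.reg 43 + .const 1)) ;;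
  .cond (.natLT (.reg 43) (.reg 8)) (.putN 2 (.reg 43) (.get 2 (.reg 43) + .const 1))
    (.setN 44 (.const 0))

/-- The loop clears maximal digits up to the first digit that can be increased. If there is none,
then `v = N ^ L - 1` and the enumeration is complete. -/
theorem nextDigits_spec {s : State} {N L v : ℕ} (hN : s.nreg 3 = N) (hL : s.nreg 8 = L)
    (hN1 : 1 ≤ N) (hv : v < N ^ L) (hD : ∀ i < L, s.nmem 2 i = v / N ^ i % N) :
    Wp nextDigits s (100 * (L + 1)) (fun s' =>
      (v + 1 < N ^ L ∧ s'.nreg 44 = s.nreg 44 ∧ ∀ i < L, s'.nmem 2 i = (v + 1) / N ^ i % N) ∨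
      (v + 1 = N ^ L ∧ s'.nreg 44 = 0)) := by
  refine Wp.seq (T₁ := 2) (T₂ := 90 * (L + 1)) (Q₁ := fun s' => s' = s.setN 43 0)
    (Wp.basic rfl le_rfl rfl) (by omega) ?_
  rintro _ rfl -
  have hb : (Test.both (.natLT (.reg 43) (.reg 8))
    (.natLE (.reg 3) (.get 2 (.reg 43) + .const 1))).cost ≤ 20 := by decide
  refine Wp.seq (T₁ := L * (10 + 20 + 1) + 20 + 1) (T₂ := 30) (Q₁ := fun s' => ∃ j ≤ L,
    s'.nreg 43 = j ∧ (∀ i < j, v / N ^ i % N = N - 1) ∧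
    (∀ i < L, s'.nmem 2 i = if i < j then 0 else v / N ^ i % N) ∧
    ¬ (j < L ∧ N ≤ v / N ^ j % N + 1)) ?_ (by omega) ?_
  · refine (Wp.loop L 10 (fun j s' => j ≤ L ∧ s'.nreg 43 = j ∧ (∀ i < j, v / N ^ i % N = N - 1) ∧
      (∀ i < L, s'.nmem 2 i = if i < j then 0 else v / N ^ i % N)) ?_ ?_).imp ?_ ?_
    · exact ⟨by omega, by simp, by simp, by simpa using hD⟩
    · rintro j s₁ ⟨hjL, h43, hd, hmem⟩ hF ht
      have e3 : s₁.nreg 3 = N := (hF.nreg 3 (by decide)).trans (by simpa using hN)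
      have e8 : s₁.nreg 8 = L := (hF.nreg 8 (by decide)).trans (by simpa using hL)
      simp only [Test.Holds, Test.holds_natLT, NExpr.eval, h43, e3, e8] at ht
      obtain ⟨hlt, hle⟩ := ht
      rw [hmem j hlt, if_neg (lt_irrefl j)] at hle
      have hlt' := Nat.mod_lt (v / N ^ j) hN1
      refine ⟨hlt, Wp.basic rfl (by decide) ⟨hlt, by simp [Program.run, h43], ?_, ?_⟩⟩
      · intro i hi
        rcases Nat.lt_succ_iff_lt_or_eq.1 hi with h | rfl
        · exact hd i h
        · omega
      · intro i hi
        by_cases hij : i = j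
        · subst hij; simp [Program.run, h43]
        · simp only [Program.run, NExpr.eval, h43, Function.update_self, ne_eq, hij,
            not_false_eq_true, Function.update_of_ne, hmem i hi]
          split_ifs <;> first | rfl | omega
    · have := Nat.mul_le_mul_left L (show 10 + _ + 1 ≤ 10 + 20 + 1 by omega : 10 + (Test.both
        (.natLT (.reg 43) (.reg 8)) (.natLE (.reg 3) (.get 2 (.reg 43) + .const 1))).cost + 1 ≤ _)
      omega
    · rintro s' ⟨j, hj, ⟨h1, h2, h3, h4⟩, hn⟩ hF
      have e3 : s'.nreg 3 = N := (hF.nreg 3 (by decide)).trans (by simpa using hN)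
      have e8 : s'.nreg 8 = L := (hF.nreg 8 (by decide)).trans (by simpa using hL)
      refine ⟨j, hj, h2, h3, h4, fun h => hn ?_⟩
      simp only [Test.Holds, Test.holds_natLT, NExpr.eval, h2, e3, e8]
      rw [h4 j h.1, if_neg (lt_irrefl j)]
      exact h
  rintro s₁ ⟨j, hj, h43, hd, hmem, hn⟩ hF
  have e8 : s₁.nreg 8 = L := (hF.nreg 8 (by decide)).trans (by simpa using hL)
  have e44 : s₁.nreg 44 = s.nreg 44 := (hF.nreg 44 (by decide)).trans (by simp)
  have hs := succ_eq_mul_of_digits hN1 hd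
  refine Wp.basic rfl (by decide) ?_
  rcases hj.lt_or_eq with hlt | rfl
  · have hj' : v / N ^ j % N + 1 < N := by
      by_contra h; exact hn ⟨hlt, not_lt.1 h⟩
    refine Or.inl ⟨?_, by simp [Program.run, h43, e8, hlt, e44], fun i hi => ?_⟩
    · refine lt_of_le_of_ne hv fun h => ?_
      obtain ⟨d, rfl⟩ := Nat.exists_eq_add_of_lt hlt
      have h5 : v / N ^ j + 1 = N * N ^ d := by
        refine Nat.eq_of_mul_eq_mul_left (Nat.pow_pos hN1 : 0 < N ^ j) ?_
        rw [← hs]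
        have : N ^ (j + d + 1) = N ^ j * (N * N ^ d) := by ring
        omega
      have h6 : (v / N ^ j + 1) % N = 0 := by rw [h5, Nat.mul_mod_right]
      rw [Nat.add_mod, Nat.mod_eq_of_lt (a := 1) (by omega), Nat.mod_eq_of_lt hj'] at h6
      omega
    · rw [succ_digits hN1 hd hj']
      have hm := hmem i hi
      have hmj := hmem j hlt
      rw [if_neg (lt_irrefl j)] at hmj
      by_cases hij : i = j
      · subst hij; simp [Program.run, h43, e8, hlt, hmj]
      · simp [Program.run, h43, e8, hlt, hij, hm]
  · refine Or.inr ⟨?_, by simp [Program.run, h43, e8]⟩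
    rw [Nat.div_eq_of_lt hv] at hs
    simpa using hs

end RealRAM

namespace RealRAM
open PlaneGeometry CurveClustering

/-! ### The decision problem -/

/-- Compute the candidate points given by the digits in array `2` for all center vertices except
for the last one. -/
def setCands : Program :=
  .forN 40 7
    (.setN 41 (.get 2 (.reg 40 + .reg 40)) ;; .setN 42 (.get 2 (.reg 40 + .reg 40 + .const 1)) ;;
      .cond (.realLE (sqdE (ptX (.reg 41)) (ptY (.reg 41)) (ptX (.reg 42)) (ptY (.reg 42)))
          (.const 0))
        (.putR 2 (.reg 40) (ptX (.reg 41) - .reg 1) ;; .putR 3 (.reg 40) (ptY (.reg 41)))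
        (.setR 30 (.sqrt (.reg 1 * .reg 1 /
            sqdE (ptX (.reg 41)) (ptY (.reg 41)) (ptX (.reg 42)) (ptY (.reg 42)) -
            .const 1 / .const 4)) ;;
          .putR 2 (.reg 40) (bisXE (ptX (.reg 41)) (ptY (.reg 41)) (ptX (.reg 42)) (ptY (.reg 42))
            (.reg 30)) ;;
          .putR 3 (.reg 40) (bisYE (ptX (.reg 41)) (ptY (.reg 41)) (ptX (.reg 42)) (ptY (.reg 42))
            (.reg 30))))

/-- The candidate point for center vertex `u` given by the digits `D`. -/
noncomputable def candDX (r : ℝ) (X Y : ℕ → ℝ) (D : ℕ → ℕ) (u : ℕ) : ℝ :=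
  candX r (X (D (u + u))) (Y (D (u + u))) (X (D (u + u + 1))) (Y (D (u + u + 1)))

/-- The candidate point for center vertex `u` given by the digits `D`. -/
noncomputable def candDY (r : ℝ) (X Y : ℕ → ℝ) (D : ℕ → ℕ) (u : ℕ) : ℝ :=
  candY r (X (D (u + u))) (Y (D (u + u))) (X (D (u + u + 1))) (Y (D (u + u + 1)))

theorem setCands_spec {s : State} {M : ℕ} (h7 : s.nreg 7 = M) :
    Wp setCands s (500 * (M + 1)) (fun s' => ∀ u < M,
      s'.rmem 2 u = candDX (s.rreg 1) (s.rmem 0) (s.rmem 1) (s.nmem 2) u ∧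
      s'.rmem 3 u = candDY (s.rreg 1) (s.rmem 0) (s.rmem 1) (s.nmem 2) u) := by
  refine Wp.forN (B := 400) (fun m s' => ∀ u < m,
      s'.rmem 2 u = candDX (s.rreg 1) (s.rmem 0) (s.rmem 1) (s.nmem 2) u ∧
      s'.rmem 3 u = candDY (s.rreg 1) (s.rmem 0) (s.rmem 1) (s.nmem 2) u) h7 (by decide) (by decide)
    (by intro j s' v; simp) (by simp) ?_ (by omega) (fun s' h _ => h)
  intro m s₁ hm hI hF h40
  have e0 : s₁.rmem 0 = s.rmem 0 := hF.rmem 0 (by decide)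
  have e1 : s₁.rmem 1 = s.rmem 1 := hF.rmem 1 (by decide)
  have e2 : s₁.nmem 2 = s.nmem 2 := hF.nmem 2 (by decide)
  have er : s₁.rreg 1 = s.rreg 1 := hF.rreg 1 (by decide)
  refine Wp.basic rfl (by decide) ?_
  intro u hu
  have hq : (1 : ℝ) / 4 = 4⁻¹ := by norm_num
  by_cases hc : sqd (s.rmem 0 (s.nmem 2 (m + m))) (s.rmem 1 (s.nmem 2 (m + m)))
      (s.rmem 0 (s.nmem 2 (m + m + 1))) (s.rmem 1 (s.nmem 2 (m + m + 1))) ≤ 0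
  · rcases Nat.lt_succ_iff_lt_or_eq.1 hu with h | rfl
    · simp [Program.run, h40, e0, e1, e2, er, hc, h.ne, hI u h]
    · simp [Program.run, h40, e0, e1, e2, er, hc, candDX, candDY, candX, candY]
  · rcases Nat.lt_succ_iff_lt_or_eq.1 hu with h | rfl
    · simp [Program.run, h40, e0, e1, e2, er, hc, h.ne, hI u h]
    · simp [Program.run, h40, e0, e1, e2, er, hc, candDX, candDY, candX, candY]

/-- The centers with vertices `CX`, `CY` have distance at most `r` from every curve. -/
def Feas (n k ℓ : ℕ) (comp : ℕ → ℕ) (X Y : ℕ → ℝ) (r : ℝ) (CX CY : ℕ → ℝ) : Prop :=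
  ∀ g < n, ∃ i < k, Reach (fun t j => pdist (CX (i * ℓ + t)) (CY (i * ℓ + t))
    (X (off comp g + j)) (Y (off comp g + j)) ≤ r) ℓ (comp g)

theorem exists_off {comp : ℕ → ℕ} {n p : ℕ} (h : p < off comp n) :
    ∃ g < n, ∃ j < comp g, p = off comp g + j := by
  induction n with
  | zero => simp [off] at h
  | succ n ih =>
    rw [off_succ] at h
    by_cases hp : p < off comp n
    · obtain ⟨g, hg, hj⟩ := ih hp
      exact ⟨g, by omega, hj⟩
    · exact ⟨n, by omega, p - off comp n, by omega, by omega⟩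

theorem off_add_lt {comp : ℕ → ℕ} {n g j : ℕ} (hg : g < n) (hj : j < comp g) :
    off comp g + j < off comp n := by
  have := off_mono comp (Nat.succ_le_of_lt hg)
  rw [off_succ] at this
  omega

section Certificate

variable {n k ℓ : ℕ} {comp : ℕ → ℕ} {s : State}

theorem vertex_lt {i t : ℕ} (hi : i < k) (ht : t < ℓ) : i * ℓ + t < k * ℓ := by
  have := Nat.mul_le_mul_right ℓ (Nat.succ_le_of_lt hi)
  rw [Nat.succ_mul] at this
  omega

theorem last_vertex (hk : 1 ≤ k) (hℓ : 1 ≤ ℓ) : (k - 1) * ℓ + (ℓ - 1) = k * ℓ - 1 := by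
  obtain ⟨k, rfl⟩ := Nat.exists_eq_add_of_le' hk
  obtain ⟨ℓ, rfl⟩ := Nat.exists_eq_add_of_le' hℓ
  simp only [Nat.add_sub_cancel, Nat.add_mul, Nat.mul_add]
  omega

theorem vertex_lt_last {i t : ℕ} (hi : i < k) (ht : t < ℓ) (h : i < k - 1 ∨ t < ℓ - 1) :
    i * ℓ + t < k * ℓ - 1 := by
  have h1 := vertex_lt hi ht
  rcases h with h | h
  · have := vertex_lt h ht
    have h2 := last_vertex (show 1 ≤ k by omega) (show 1 ≤ ℓ by omega)
    omega
  · have := vertex_lt hi (show t + 1 < ℓ by omega)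
    omega

/-- If the marked points are close to a point `x`, `y`, then this point completes the centers. -/
theorem feas_of_marked (hk : 1 ≤ k) (hℓ : 1 ≤ ℓ) (hcomp : ∀ g < n, 1 ≤ comp g)
    (hok : ∀ g < n, Covered s k ℓ comp g ∨ ∃ e ≤ comp g, LastReach s k ℓ comp g e) {x y : ℝ}
    (hxy : ∀ g < n, ∀ j < comp g, Needed s k ℓ comp g j →
      pdist x y (s.rmem 0 (off comp g + j)) (s.rmem 1 (off comp g + j)) ≤ s.rreg 1) :
    Feas n k ℓ comp (s.rmem 0) (s.rmem 1) (s.rreg 1)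
      (Function.update (s.rmem 2) (k * ℓ - 1) x) (Function.update (s.rmem 3) (k * ℓ - 1) y) := by
  have hupd : ∀ (f : ℕ → ℝ) (z : ℝ) (i t : ℕ), i < k → t < ℓ → (i < k - 1 ∨ t < ℓ - 1) →
      Function.update f (k * ℓ - 1) z (i * ℓ + t) = f (i * ℓ + t) := by
    intro f z i t hi ht h
    rw [Function.update_of_ne (vertex_lt_last hi ht h).ne]
  intro g hg
  by_cases hc : Covered s k ℓ comp g
  · obtain ⟨i, hi, hr⟩ := hc
    refine ⟨i, by omega, hr.mono fun t j ht hj h => ?_⟩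
    rw [hupd _ _ _ _ (by omega) ht (Or.inl hi), hupd _ _ _ _ (by omega) ht (Or.inl hi)]
    exact h
  · have hex : ∃ e, e ≤ comp g ∧ LastReach s k ℓ comp g e :=
      ((hok g hg).resolve_left hc).imp fun e h => h
    classical
    -- With the longest prefix, the last center vertex has to take only the vertices from `e` on,
    -- and the final vertex of the curve even if `e = comp g`. These are exactly the needed ones.
    set e := Nat.findGreatest (fun e => LastReach s k ℓ comp g e) (comp g) with he
    have hre : LastReach s k ℓ comp g e := by
      obtain ⟨e', h1, h2⟩ := hex
      exact Nat.findGreatest_spec h1 h2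
    have hec : e ≤ comp g := Nat.findGreatest_le _
    have hmax : ∀ e' ≤ comp g, LastReach s k ℓ comp g e' → e' ≤ e :=
      fun e' h1 h2 => Nat.le_findGreatest h1 h2
    have hlast := last_vertex hk hℓ
    obtain ⟨ℓ', hℓ'⟩ := Nat.exists_eq_add_of_le' hℓ
    have hg1 := hcomp g hg
    refine ⟨k - 1, by omega, ?_⟩
    have key : ∀ j < comp g, (e ≤ j ∨ comp g ≤ j + 1) →
        pdist (Function.update (s.rmem 2) (k * ℓ - 1) x ((k - 1) * ℓ + (ℓ - 1)))
          (Function.update (s.rmem 3) (k * ℓ - 1) y ((k - 1) * ℓ + (ℓ - 1)))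
          (s.rmem 0 (off comp g + j)) (s.rmem 1 (off comp g + j)) ≤ s.rreg 1 := by
      intro j hj h
      rw [hlast, Function.update_self, Function.update_self]
      exact hxy g hg j hj ⟨hc, h.imp_left fun h e' h1 h2 => (hmax e' h1 h2).trans h⟩
    have h2 : Reach (fun t j => pdist (Function.update (s.rmem 2) (k * ℓ - 1) x ((k - 1) * ℓ + t))
        (Function.update (s.rmem 3) (k * ℓ - 1) y ((k - 1) * ℓ + t))
        (s.rmem 0 (off comp g + j)) (s.rmem 1 (off comp g + j)) ≤ s.rreg 1) (ℓ - 1) e := by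
      refine Reach.mono (fun t j ht hj h => ?_) hre
      rw [hupd _ _ _ _ (by omega) (by omega) (Or.inr ht),
        hupd _ _ _ _ (by omega) (by omega) (Or.inr ht)]
      exact h
    have h3 := h2.append hec hg1 (fun j h4 h5 => key j h5 (Or.inl h4))
      (key _ (by omega) (Or.inr (by omega)))
    rwa [Nat.sub_add_cancel hℓ] at h3

/-- If centers exist whose vertices other than the last one are matched to no more points than
those of `s`, then the last vertex is close to all marked points. -/
theorem marked_of_feas (hk : 1 ≤ k) (hℓ : 1 ≤ ℓ) {CX CY : ℕ → ℝ}
    (hf : Feas n k ℓ comp (s.rmem 0) (s.rmem 1) (s.rreg 1) CX CY)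
    (hs : ∀ u < k * ℓ - 1, ∀ p < off comp n, pdist (CX u) (CY u) (s.rmem 0 p) (s.rmem 1 p) ≤ s.rreg 1 →
      pdist (s.rmem 2 u) (s.rmem 3 u) (s.rmem 0 p) (s.rmem 1 p) ≤ s.rreg 1) :
    (∀ g < n, Covered s k ℓ comp g ∨ ∃ e ≤ comp g, LastReach s k ℓ comp g e) ∧
    ∀ g < n, ∀ j < comp g, Needed s k ℓ comp g j →
      pdist (CX (k * ℓ - 1)) (CY (k * ℓ - 1)) (s.rmem 0 (off comp g + j))
        (s.rmem 1 (off comp g + j)) ≤ s.rreg 1 := by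
  -- The prefix that a feasible matching leaves to the first `ℓ - 1` vertices stays reachable for
  -- `s`, so it is at most the longest one. Hence every needed vertex was matched with the last
  -- center vertex.
  have key : ∀ g < n, Covered s k ℓ comp g ∨ ∃ e ≤ comp g, LastReach s k ℓ comp g e ∧
      ∀ j < comp g, (e ≤ j ∨ comp g ≤ j + 1) →
        pdist (CX (k * ℓ - 1)) (CY (k * ℓ - 1)) (s.rmem 0 (off comp g + j))
          (s.rmem 1 (off comp g + j)) ≤ s.rreg 1 := by
    intro g hg
    obtain ⟨i, hi, hr⟩ := hf g hg
    by_cases hi' : i < k - 1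
    · refine Or.inl ⟨i, hi', hr.mono fun t j ht hj h => ?_⟩
      exact hs _ (vertex_lt_last hi ht (Or.inl hi')) _ (off_add_lt hg hj) h
    · obtain rfl : i = k - 1 := by omega
      rw [← Nat.sub_add_cancel hℓ] at hr
      obtain ⟨e, he, hre, hsuf, h1, hl⟩ := hr.exists_suffix
      rw [Nat.sub_add_cancel hℓ] at hre hsuf hl
      rw [last_vertex hk hℓ] at hsuf hl
      refine Or.inr ⟨e, he, hre.mono fun t j ht hj h => ?_, fun j hj h => ?_⟩
      · exact hs _ (vertex_lt_last hi (by omega) (Or.inr ht)) _ (off_add_lt hg (by omega)) h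
      · rcases h with h | h
        · exact hsuf j h hj
        · obtain rfl : j = comp g - 1 := by omega
          exact hl
  refine ⟨fun g hg => (key g hg).imp_right fun ⟨e, h1, h2, _⟩ => ⟨e, h1, h2⟩, fun g hg j hj hN => ?_⟩
  obtain ⟨e, h1, h2, h3⟩ := (key g hg).resolve_left hN.1
  exact h3 j hj (hN.2.imp_left fun h => h e h1 h2)

end Certificate

end RealRAM

namespace RealRAM
open PlaneGeometry CurveClustering

/-- Test the centers given by the digits in array `2` for radius `reg 1` and go on to the next
digits. Register `44` is set to `0` at the end of the search, register `45` to `1` on success. -/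
def tryTuple : Program :=
  setCands ;; mark ;;
  .cond (.natLE (.const 1) (.reg 36))
    (smallestDisk ;;
      .cond (.realLE (.reg 19) (.reg 1))
        (.putR 2 (.reg 7) (.reg 17) ;; .putR 3 (.reg 7) (.reg 18) ;; .setN 45 (.const 1) ;;
          .setN 44 (.const 0)) .skip) .skip ;;
  .cond (.natLE (.const 1) (.reg 44)) nextDigits .skip

/-- Decide whether there are centers of radius `reg 1`. If so, register `45` is `1` and the centers
are in the real arrays `2` and `3`. -/
def decideRadius : Program :=
  .forN 40 8 (.putN 2 (.reg 40) (.const 0)) ;;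
  (.setN 44 (.const 1) ;; .setN 45 (.const 0)) ;;
  .loop (.natLE (.const 1) (.reg 44)) tryTuple

/-- No feasible centers are matched only to points to which the candidates number `v` can be
matched. -/
def Refuted (n k ℓ N : ℕ) (comp : ℕ → ℕ) (X Y : ℕ → ℝ) (r : ℝ) (v : ℕ) : Prop :=
  ∀ CX CY, Feas n k ℓ comp X Y r CX CY → ¬ ∀ u < k * ℓ - 1, ∀ p < N,
    pdist (CX u) (CY u) (X p) (Y p) ≤ r →
    pdist (candDX r X Y (fun i => v / N ^ i % N) u) (candDY r X Y (fun i => v / N ^ i % N) u)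
      (X p) (Y p) ≤ r

/-- The input sizes. -/
structure Sizes (n k ℓ N m : ℕ) (comp : ℕ → ℕ) : Prop where
  n_pos : 1 ≤ n
  k_pos : 1 ≤ k
  ℓ_pos : 1 ≤ ℓ
  m_pos : 1 ≤ m
  comp_le : ∀ g < n, comp g ≤ m
  comp_pos : ∀ g < n, 1 ≤ comp g
  N_eq : N = off comp n

theorem Sizes.N_pos {n k ℓ N m : ℕ} {comp : ℕ → ℕ} (h : Sizes n k ℓ N m comp) : 1 ≤ N := by
  have h1 := h.comp_pos 0 h.n_pos
  have h2 := off_mono comp h.n_pos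
  rw [h.N_eq]
  simp only [off, Finset.sum_range_one] at h2
  exact h1.trans h2

theorem Sizes.N_le {n k ℓ N m : ℕ} {comp : ℕ → ℕ} (h : Sizes n k ℓ N m comp) : N ≤ m * n := by
  rw [h.N_eq, off]
  refine (Finset.sum_le_card_nsmul _ _ m fun g hg => h.comp_le g (Finset.mem_range.1 hg)).trans ?_
  simp [mul_comm]

/-- A failed test refutes only the feasible centers whose matches the tuple `v` preserves. That is
enough, since all feasible centers have such a tuple (`exists_not_refuted`). -/
theorem tryTuple_spec {n k ℓ N m v : ℕ} {comp : ℕ → ℕ} {X Y : ℕ → ℝ} {s : State}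
    (hE : Env n k ℓ N comp X Y s) (hS : Sizes n k ℓ N m comp) (hr : 0 ≤ s.rreg 1)
    (h44 : s.nreg 44 = 1) (h45 : s.nreg 45 = 0) (hv : v < N ^ (2 * (k * ℓ - 1)))
    (hD : ∀ i < 2 * (k * ℓ - 1), s.nmem 2 i = v / N ^ i % N) :
    Wp tryTuple s (30000 * (k * ℓ * ((m * n) * (m * n)))) (fun s' =>
      (s'.nreg 44 = 1 ∧ s'.nreg 45 = 0 ∧ v + 1 < N ^ (2 * (k * ℓ - 1)) ∧
        (∀ i < 2 * (k * ℓ - 1), s'.nmem 2 i = (v + 1) / N ^ i % N) ∧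
        Refuted n k ℓ N comp X Y (s.rreg 1) v) ∨
      (s'.nreg 44 = 0 ∧ s'.nreg 45 = 0 ∧ v + 1 = N ^ (2 * (k * ℓ - 1)) ∧
        Refuted n k ℓ N comp X Y (s.rreg 1) v) ∨
      (s'.nreg 44 = 0 ∧ s'.nreg 45 = 1 ∧
        Feas n k ℓ comp X Y (s.rreg 1) (s'.rmem 2) (s'.rmem 3))) := by
  have hkl : 1 ≤ k * ℓ := Nat.mul_pos hS.k_pos hS.ℓ_pos
  have hQ : 1 ≤ m * n := Nat.mul_pos hS.m_pos hS.n_pos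
  have hQQ : m * n ≤ (m * n) * (m * n) := Nat.le_mul_self _
  set W := k * ℓ * ((m * n) * (m * n)) with hW
  have hW1 : k * ℓ ≤ W := Nat.le_mul_of_pos_right _ (by omega)
  have hW2 : n * (k * (ℓ * m)) ≤ W := by
    calc n * (k * (ℓ * m)) = k * ℓ * (m * n) := by ring
      _ ≤ W := Nat.mul_le_mul_left _ hQQ
  have hW3 : (N + 1) * (N + 1) ≤ 4 * W := by
    have hN := hS.N_le
    calc (N + 1) * (N + 1) ≤ (2 * (m * n)) * (2 * (m * n)) :=
          Nat.mul_le_mul (by omega) (by omega)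
      _ = 4 * ((m * n) * (m * n)) := by ring
      _ ≤ 4 * W := Nat.mul_le_mul_left _ (Nat.le_mul_of_pos_left _ hkl)
  refine Wp.seq (setCands_spec hE.klm_eq) (T₂ := 29000 * W) (by omega) ?_
  intro s₁ hc hF₁
  have hE₁ := hE.of_frame hF₁ (by decide) (by decide) (by decide) (by decide)
  have r₁ : s₁.rreg 1 = s.rreg 1 := hF₁.rreg 1 (by decide)
  rw [hE.X_eq, hE.Y_eq] at hc
  have hcand : ∀ u < k * ℓ - 1,
      s₁.rmem 2 u = candDX (s.rreg 1) X Y (fun i => v / N ^ i % N) u ∧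
      s₁.rmem 3 u = candDY (s.rreg 1) X Y (fun i => v / N ^ i % N) u := by
    intro u hu
    obtain ⟨h1, h2⟩ := hc u hu
    rw [h1, h2]
    unfold candDX candDY
    rw [hD (u + u) (by omega), hD (u + u + 1) (by omega)]
    exact ⟨rfl, rfl⟩
  have hmof := fun CX CY (hf : Feas n k ℓ comp X Y (s.rreg 1) CX CY) hsnap =>
    marked_of_feas (s := s₁) hS.k_pos hS.ℓ_pos (CX := CX) (CY := CY)
      (by rw [hE₁.X_eq, hE₁.Y_eq, r₁]; exact hf) hsnap
  rw [hE₁.X_eq, hE₁.Y_eq, r₁, ← hS.N_eq] at hmof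
  have hsnap : ∀ CX CY : ℕ → ℝ, (∀ u < k * ℓ - 1, ∀ p < N,
      pdist (CX u) (CY u) (X p) (Y p) ≤ s.rreg 1 →
      pdist (candDX (s.rreg 1) X Y (fun i => v / N ^ i % N) u)
        (candDY (s.rreg 1) X Y (fun i => v / N ^ i % N) u) (X p) (Y p) ≤ s.rreg 1) →
      ∀ u < k * ℓ - 1, ∀ p < N, pdist (CX u) (CY u) (X p) (Y p) ≤ s.rreg 1 →
      pdist (s₁.rmem 2 u) (s₁.rmem 3 u) (X p) (Y p) ≤ s.rreg 1 := by
    intro CX CY h u hu p hp hle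
    rw [(hcand u hu).1, (hcand u hu).2]
    exact h u hu p hp hle
  refine Wp.seq (mark_spec hE₁ hS.n_pos hS.k_pos hS.ℓ_pos hS.m_pos hS.comp_le) (T₂ := 18000 * W)
    (by omega) ?_
  rintro s₂ ⟨hok, hmask⟩ hF₂
  have hE₂ := hE₁.of_frame hF₂ (by decide) (by decide) (by decide) (by decide)
  have r₂ : s₂.rreg 1 = s.rreg 1 := (hF₂.rreg 1 (by decide)).trans r₁
  have c₂ : s₂.rmem 2 = s₁.rmem 2 := hF₂.rmem 2 (by decide)
  have c₃ : s₂.rmem 3 = s₁.rmem 3 := hF₂.rmem 3 (by decide)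
  have d₂ : s₂.nmem 2 = s.nmem 2 := (hF₂.nmem 2 (by decide)).trans (hF₁.nmem 2 (by decide))
  have e44 : s₂.nreg 44 = 1 :=
    (hF₂.nreg 44 (by decide)).trans ((hF₁.nreg 44 (by decide)).trans h44)
  have e45 : s₂.nreg 45 = 0 :=
    (hF₂.nreg 45 (by decide)).trans ((hF₁.nreg 45 (by decide)).trans h45)
  refine Wp.seq (T₁ := 10000 * W) (T₂ := 5000 * W) (Q₁ := fun s' =>
    Env n k ℓ N comp X Y s' ∧ s'.nmem 2 = s.nmem 2 ∧
    ((s'.nreg 44 = 1 ∧ s'.nreg 45 = 0 ∧ Refuted n k ℓ N comp X Y (s.rreg 1) v) ∨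
    (s'.nreg 44 = 0 ∧ s'.nreg 45 = 1 ∧
        Feas n k ℓ comp X Y (s.rreg 1) (s'.rmem 2) (s'.rmem 3)))) ?_ (by omega) ?_
  · refine Wp.cond (T₁ := 9000 * W) (by simp only [Test.cost, NExpr.cost]; omega) ?_ ?_
    · intro ht
      rcases hok with ⟨-, hok⟩ | ⟨h0, -⟩
      swap
      · simp [h0] at ht
      refine Wp.seq (smallestDisk_spec hE₂.N_eq) (T₂ := 100) (by omega) ?_
      intro s₃ hdisk hF₃
      have hE₃ := hE₂.of_frame hF₃ (by decide) (by decide) (by decide) (by decide)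
      have r₃ : s₃.rreg 1 = s.rreg 1 := (hF₃.rreg 1 (by decide)).trans r₂
      have f2 : s₃.rmem 2 = s₁.rmem 2 := (hF₃.rmem 2 (by decide)).trans c₂
      have f3 : s₃.rmem 3 = s₁.rmem 3 := (hF₃.rmem 3 (by decide)).trans c₃
      have d₃ : s₃.nmem 2 = s.nmem 2 := (hF₃.nmem 2 (by decide)).trans d₂
      have f44 : s₃.nreg 44 = 1 := (hF₃.nreg 44 (by decide)).trans e44
      have f45 : s₃.nreg 45 = 0 := (hF₃.nreg 45 (by decide)).trans e45
      rw [hE₂.X_eq, hE₂.Y_eq] at hdisk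
      refine Wp.cond (T₁ := 50) ((Nat.add_le_add_right (Nat.add_le_add_right
        (by decide : _ ≤ 20) _) _).trans (by omega)) ?_ ?_
      · intro hle
        simp only [Test.Holds, RExpr.eval, r₃] at hle
        refine Wp.basic rfl (by decide) ⟨?_, ?_, Or.inr ⟨?_, ?_, ?_⟩⟩
        · exact ⟨by simp [Program.run, hE₃.n_eq], by simp [Program.run, hE₃.k_eq],
            by simp [Program.run, hE₃.ℓ_eq], by simp [Program.run, hE₃.N_eq],
            by simp [Program.run, hE₃.km_eq], by simp [Program.run, hE₃.lm_eq],
            by simp [Program.run, hE₃.kl_eq], by simp [Program.run, hE₃.klm_eq],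
            by simp [Program.run, hE₃.L_eq], by simp [Program.run, hE₃.comp_eq],
            by simp [Program.run, hE₃.X_eq], by simp [Program.run, hE₃.Y_eq]⟩
        · simp [Program.run, d₃]
        · simp [Program.run]
        · simp [Program.run]
        · have := feas_of_marked (s := s₁) hS.k_pos hS.ℓ_pos hS.comp_pos hok
            (x := s₃.rreg 17) (y := s₃.rreg 18) (fun g hg j hj hN => by
              rw [hE₁.X_eq, hE₁.Y_eq, r₁]
              refine (hdisk.cover _ ⟨?_, (hmask g hg j hj).2 hN⟩).trans hle
              rw [hS.N_eq]; exact off_add_lt hg hj)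
          rw [hE₁.X_eq, hE₁.Y_eq, r₁] at this
          simpa [Program.run, hE₃.klm_eq, f2, f3] using this
      · intro hle
        simp only [Test.Holds, RExpr.eval, r₃] at hle
        refine Wp.basic rfl (by decide) ⟨hE₃, d₃, Or.inl ⟨f44, f45, fun CX CY hf hsn => hle ?_⟩⟩
        -- The last vertex of the feasible centers would be the center of a disk of radius `r`
        -- around all marked points.
        have hm := (hmof CX CY hf (hsnap CX CY hsn)).2
        refine hdisk.le (CX (k * ℓ - 1)) (CY (k * ℓ - 1)) _ hr fun p hp => ?_
        obtain ⟨hpN, hp1⟩ := hp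
        rw [hS.N_eq] at hpN
        obtain ⟨g, hg, j, hj, rfl⟩ := exists_off hpN
        exact hm g hg j hj ((hmask g hg j hj).1 hp1)
    · intro ht
      refine Wp.basic rfl (show 1 ≤ _ by omega) ⟨hE₂, d₂, Or.inl ⟨e44, e45, fun CX CY hf hsn => ?_⟩⟩
      rcases hok with ⟨h1, -⟩ | ⟨-, g, hg, h1, h2⟩
      · simp [h1] at ht
      · rcases (hmof CX CY hf (hsnap CX CY hsn)).1 g hg with h | ⟨e, he, h⟩
        · exact h1 h
        · exact h2 e he h
  rintro s₃ ⟨hE₃, d₃, h⟩ -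
  refine Wp.cond (T₁ := 4000 * W) (by simp only [Test.cost, NExpr.cost]; omega) ?_ ?_
  · intro ht
    rcases h with ⟨g44, g45, href⟩ | ⟨g44, -⟩
    swap
    · simp [g44] at ht
    refine (nextDigits_spec hE₃.N_eq hE₃.L_eq hS.N_pos hv (by rw [d₃]; exact hD)).imp (by omega) ?_
    rintro s₄ (⟨h1, h2, h3⟩ | ⟨h1, h2⟩) hF₄
    · exact Or.inl ⟨h2.trans g44, (hF₄.nreg 45 (by decide)).trans g45, h1, h3, href⟩
    · exact Or.inr (Or.inl ⟨h2, (hF₄.nreg 45 (by decide)).trans g45, h1, href⟩)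
  · intro ht
    rcases h with ⟨g44, -, -⟩ | ⟨g44, g45, hf⟩
    · simp [g44] at ht
    exact Wp.basic rfl (show 1 ≤ _ by omega) (Or.inr (Or.inr ⟨g44, g45, hf⟩))

/-- Among the candidates there are points that are close to all points to which given centers are
close. -/
theorem exists_not_refuted {n k ℓ N : ℕ} {comp : ℕ → ℕ} {X Y CX CY : ℕ → ℝ} {r : ℝ} (hr : 0 ≤ r)
    (hN : 1 ≤ N) (hf : Feas n k ℓ comp X Y r CX CY) :
    ∃ v < N ^ (2 * (k * ℓ - 1)), ¬ Refuted n k ℓ N comp X Y r v := by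
  classical
  have hex : ∀ u, ∃ i < N, ∃ j < N, ∀ p < N, pdist (CX u) (CY u) (X p) (Y p) ≤ r →
      pdist (candX r (X i) (Y i) (X j) (Y j)) (candY r (X i) (Y i) (X j) (Y j)) (X p) (Y p) ≤ r := by
    intro u
    set S := (Finset.range N).filter fun p => pdist (CX u) (CY u) (X p) (Y p) ≤ r with hS
    rcases S.eq_empty_or_nonempty with h | h
    -- A center vertex close to no input point may be replaced by any candidate.
    · refine ⟨0, hN, 0, hN, fun p hp hle => ?_⟩
      have : p ∈ S := by simp [hS, hp, hle]
      simp [h] at this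
    · obtain ⟨i, hi, j, hj, hall⟩ := exists_cand S h X Y hr
        ⟨CX u, CY u, fun p hp => (Finset.mem_filter.1 hp).2⟩
      exact ⟨i, Finset.mem_range.1 (Finset.mem_filter.1 hi).1, j,
        Finset.mem_range.1 (Finset.mem_filter.1 hj).1,
        fun p hp hle => hall p (by simp [hS, hp, hle])⟩
  choose I hI J hJ hIJ using hex
  -- Digits `2 * u` and `2 * u + 1` hold the pair that determines the candidate for vertex `u`.
  obtain ⟨v, hv, hd⟩ := exists_digits (N := N) (2 * (k * ℓ - 1))
    (fun i => if i % 2 = 0 then I (i / 2) else J (i / 2))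
    (fun i _ => by split_ifs; exacts [hI _, hJ _])
  refine ⟨v, hv, fun h => h CX CY hf fun u hu p hp hle => ?_⟩
  have h1 := hd (u + u) (by omega)
  have h2 := hd (u + u + 1) (by omega)
  rw [if_pos (by omega), show (u + u) / 2 = u by omega] at h1
  rw [if_neg (by omega), show (u + u + 1) / 2 = u by omega] at h2
  simp only [candDX, candDY, h1, h2]
  exact hIJ u p hp hle

/-- Not enumerating the last vertex saves a factor `N ^ 2`, which pays for the quadratic smallest
disk computation in each test; in exponents, `2 * (k * ℓ - 1) + 2 = 2 * (k * ℓ)`. -/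
theorem decideRadius_spec {n k ℓ N m : ℕ} {comp : ℕ → ℕ} {X Y : ℕ → ℝ} {s : State}
    (hE : Env n k ℓ N comp X Y s) (hS : Sizes n k ℓ N m comp) (hr : 0 ≤ s.rreg 1) :
    Wp decideRadius s (40000 * ((m * n) ^ (2 * (k * ℓ)) * (k * ℓ))) (fun s' =>
      (s'.nreg 45 = 1 ∧ Feas n k ℓ comp X Y (s.rreg 1) (s'.rmem 2) (s'.rmem 3)) ∨
      (s'.nreg 45 = 0 ∧ ∀ CX CY, ¬ Feas n k ℓ comp X Y (s.rreg 1) CX CY)) := by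
  have hkl : 1 ≤ k * ℓ := Nat.mul_pos hS.k_pos hS.ℓ_pos
  have hQ : 1 ≤ m * n := Nat.mul_pos hS.m_pos hS.n_pos
  set W := k * ℓ * ((m * n) * (m * n)) with hW
  set L := 2 * (k * ℓ - 1) with hL
  have hpow : (m * n) ^ (2 * (k * ℓ)) * (k * ℓ) = (m * n) ^ L * W := by
    rw [show 2 * (k * ℓ) = L + 2 by omega, pow_add, hW]; ring
  have hNL : N ^ L ≤ (m * n) ^ L := Nat.pow_le_pow_left hS.N_le _
  have hNL1 : 1 ≤ N ^ L := Nat.one_le_pow _ _ hS.N_pos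
  have hW1 : k * ℓ ≤ W := Nat.le_mul_of_pos_right _ (Nat.mul_pos hQ hQ)
  have hT : N ^ L * W ≤ (m * n) ^ L * W := Nat.mul_le_mul_right _ hNL
  have hWT : W ≤ N ^ L * W := Nat.le_mul_of_pos_left _ hNL1
  rw [hpow]
  refine Wp.seq (T₁ := L * (10 + 10) + 8) (T₂ := 39000 * ((m * n) ^ L * W))
    (Q₁ := fun s' => ∀ i < L, s'.nmem 2 i = 0) ?_ (by omega) ?_
  · refine Wp.forN (fun j s' => ∀ i < j, s'.nmem 2 i = 0) hE.L_eq (by decide) (by decide)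
      (by intro j s' v; simp) (by simp) ?_ le_rfl (fun s' h _ => h)
    intro j s' hj hI hF h40
    refine Wp.basic rfl (by decide) fun i hi => ?_
    rcases Nat.lt_succ_iff_lt_or_eq.1 hi with h | rfl
    · simp [Program.run, h40, h.ne, hI i h]
    · simp [Program.run, h40]
  intro s₁ hz hF₁
  refine Wp.seq (T₁ := 10) (T₂ := 38000 * ((m * n) ^ L * W))
    (Q₁ := fun s' => s'.nreg 44 = 1 ∧ s'.nreg 45 = 0) (Wp.basic rfl (by decide)
      (by simp [Program.run])) (by omega) ?_
  rintro s₂ ⟨h44, h45⟩ hF₂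
  have hE₂ := (hE.of_frame hF₁ (by decide) (by decide) (by decide) (by decide)).of_frame hF₂
    (by decide) (by decide) (by decide) (by decide)
  have r₂ : s₂.rreg 1 = s.rreg 1 := (hF₂.rreg 1 (by decide)).trans (hF₁.rreg 1 (by decide))
  have z₂ : ∀ i < L, s₂.nmem 2 i = 0 := by rw [hF₂.nmem 2 (by decide)]; exact hz
  clear hF₁ hF₂ hE hz
  refine (Wp.loop (N ^ L) (30000 * W) (fun v s' =>
    (s'.nreg 44 = 1 ∧ s'.nreg 45 = 0 ∧ v < N ^ L ∧ (∀ i < L, s'.nmem 2 i = v / N ^ i % N) ∧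
      ∀ v' < v, Refuted n k ℓ N comp X Y (s.rreg 1) v') ∨
    (s'.nreg 44 = 0 ∧ s'.nreg 45 = 0 ∧
      ∀ v' < N ^ L, Refuted n k ℓ N comp X Y (s.rreg 1) v') ∨
    (s'.nreg 44 = 0 ∧ s'.nreg 45 = 1 ∧
      Feas n k ℓ comp X Y (s.rreg 1) (s'.rmem 2) (s'.rmem 3))) ?_ ?_).imp ?_ ?_
  · refine Or.inl ⟨h44, h45, hNL1, fun i hi => ?_, by simp⟩
    simp [z₂ i hi]
  · rintro v s₃ (⟨a44, a45, hv, hd, href⟩ | ⟨a44, -⟩ | ⟨a44, -⟩) hF ht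
    · have hE₃ := hE₂.of_frame hF (by decide) (by decide) (by decide) (by decide)
      have r₃ : s₃.rreg 1 = s.rreg 1 := (hF.rreg 1 (by decide)).trans r₂
      refine ⟨hv, (tryTuple_spec hE₃ hS (by rw [r₃]; exact hr) a44 a45 hv hd).imp le_rfl ?_⟩
      rw [r₃]
      rintro s₄ (⟨b1, b2, b3, b4, b5⟩ | ⟨b1, b2, b3, b4⟩ | h) -
      · refine Or.inl ⟨b1, b2, b3, b4, fun v' hv' => ?_⟩
        rcases Nat.lt_succ_iff_lt_or_eq.1 hv' with h | rfl
        exacts [href v' h, b5]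
      · refine Or.inr (Or.inl ⟨b1, b2, fun v' hv' => ?_⟩)
        rcases Nat.lt_succ_iff_lt_or_eq.1 (b3 ▸ hv') with h | rfl
        exacts [href v' h, b4]
      · exact Or.inr (Or.inr h)
    · simp [a44] at ht
    · simp [a44] at ht
  · simp only [Test.cost, NExpr.cost]
    have : N ^ L * (30000 * W + (1 + 1 + 1) + 1) ≤ N ^ L * (30004 * W) :=
      Nat.mul_le_mul_left _ (by omega)
    have e : N ^ L * (30004 * W) = 30004 * (N ^ L * W) := by ring
    omega
  · rintro s' ⟨v, -, ⟨a44, -⟩ | ⟨-, a45, href⟩ | ⟨-, a45, hf⟩, hn⟩ -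
    · simp [a44] at hn
    · refine Or.inr ⟨a45, fun CX CY hf => ?_⟩
      obtain ⟨v, hv, h⟩ := exists_not_refuted hr hS.N_pos hf
      exact h (href v hv)
    · exact Or.inl ⟨a45, hf⟩

end RealRAM

namespace CurveClustering
open PlaneGeometry RealRAM

theorem Reach.of_one {cl : ℕ → ℕ → Prop} {J : ℕ} (h : Reach cl 1 J) : ∀ j < J, cl 0 j := by
  induction J with
  | zero => simp
  | succ J ih =>
    rw [reach_succ_succ] at h
    intro j hj
    rcases Nat.lt_succ_iff_lt_or_eq.1 hj with hj | rfl
    · rcases h.2 with h | h | h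
      · simp [reach_zero] at h
      · rw [reach_zero] at h; omega
      · exact ih h j hj
    · exact h.1

end CurveClustering

/-! ### Critical radii -/

namespace RealRAM
open PlaneGeometry CurveClustering

theorem Feas.snap {n k ℓ : ℕ} {comp : ℕ → ℕ} {X Y CX CY CX' CY' : ℕ → ℝ} {c r : ℝ}
    (h : Feas n k ℓ comp X Y c CX CY)
    (hs : ∀ u < k * ℓ, ∀ p < off comp n, pdist (CX u) (CY u) (X p) (Y p) ≤ c →
      pdist (CX' u) (CY' u) (X p) (Y p) ≤ r) : Feas n k ℓ comp X Y r CX' CY' := by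
  intro g hg
  obtain ⟨i, hi, hR⟩ := h g hg
  exact ⟨i, hi, hR.mono fun t j ht hj => hs _ (vertex_lt hi ht) _ (off_add_lt hg hj)⟩

theorem Feas.nonneg {n k ℓ N m : ℕ} {comp : ℕ → ℕ} {X Y CX CY : ℕ → ℝ} {c : ℝ}
    (hS : Sizes n k ℓ N m comp) (h : Feas n k ℓ comp X Y c CX CY) : 0 ≤ c := by
  obtain ⟨i, -, hR⟩ := h 0 hS.n_pos
  have h1 := hS.comp_pos 0 hS.n_pos
  have h2 := hS.ℓ_pos
  rw [show ℓ = (ℓ - 1) + 1 by omega, show comp 0 = (comp 0 - 1) + 1 by omega,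
    reach_succ_succ] at hR
  exact (pdist_nonneg _ _ _ _).trans hR.1

/-- Existence is read off from the program: `smallestDisk` is run on an artificial state whose array
`4` marks the points of `S`. -/
theorem exists_isEnclosingDisk {N : ℕ} {S : ℕ → Prop} (hS : ∀ i, S i → i < N) (X Y : ℕ → ℝ) :
    ∃ cx cy R, IsEnclosingDisk S X Y cx cy R := by
  obtain ⟨s', -, -, -, h⟩ := smallestDisk_spec (N := N)
    (s := ⟨fun _ => N, fun _ => 0, fun _ i => bit (S i), fun a => if a = 0 then X else Y⟩) rfl
  have e : (fun q => q < N ∧ 1 ≤ bit (S q)) = S := by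
    funext q
    simp only [one_le_bit, eq_iff_iff]
    exact ⟨fun h => h.2, fun h => ⟨hS q h, h⟩⟩
  simp only [e] at h
  exact ⟨_, _, _, h⟩

/-- The numbers `A 0, …, A (M - 1)` are nonnegative and one of them is the optimal radius. -/
structure IsCritList (n k ℓ : ℕ) (comp : ℕ → ℕ) (X Y : ℕ → ℝ) (M : ℕ) (A : ℕ → ℝ) : Prop where
  nonneg : ∀ p < M, 0 ≤ A p
  exists_le : ∀ c CX CY, Feas n k ℓ comp X Y c CX CY →
    ∃ p < M, A p ≤ c ∧ ∃ CX' CY', Feas n k ℓ comp X Y (A p) CX' CY'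

/-- Only the set of values matters, so the specification of sorting can ignore multiplicities. -/
theorem IsCritList.congr {n k ℓ M : ℕ} {comp : ℕ → ℕ} {X Y A B : ℕ → ℝ}
    (h : IsCritList n k ℓ comp X Y M A)
    (hAB : ∀ x, (∃ p < M, A p = x) ↔ ∃ p < M, B p = x) : IsCritList n k ℓ comp X Y M B := by
  refine ⟨fun p hp => ?_, fun c CX CY hf => ?_⟩
  · obtain ⟨q, hq, e⟩ := (hAB (B p)).2 ⟨p, hp, rfl⟩
    rw [← e]
    exact h.nonneg q hq
  · obtain ⟨p, hp, hle, hf'⟩ := h.exists_le c CX CY hf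
    obtain ⟨q, hq, e⟩ := (hAB (A p)).1 ⟨p, hp, rfl⟩
    exact ⟨q, hq, by rw [e]; exact hle, by rw [e]; exact hf'⟩

theorem critRadius_self (x y : ℝ) : critRadius x y x y x y = 0 := by
  simp [critRadius, circumPar, apex, cross, bisX, bisY, pdist, sqd]

/-- Each center vertex moves to the center of the smallest disk around the points close to it. The
largest radius of these disks is critical, at most `c`, and suffices for all matches. -/
theorem isCritList_of_critRadius {n k ℓ N m M : ℕ} {comp : ℕ → ℕ} {X Y A : ℕ → ℝ}
    (hS : Sizes n k ℓ N m comp) (h0 : ∀ p < M, 0 ≤ A p)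
    (hA : ∀ i < N, ∀ j < N, ∀ q < N, ∃ p < M,
      A p = critRadius (X i) (Y i) (X j) (Y j) (X q) (Y q)) :
    IsCritList n k ℓ comp X Y M A := by
  refine ⟨h0, fun c CX CY hf => ?_⟩
  have hc := hf.nonneg hS
  choose DX DY R hD using fun u => exists_isEnclosingDisk (N := N)
    (S := fun p => p < N ∧ pdist (CX u) (CY u) (X p) (Y p) ≤ c) (fun i h => h.1) X Y
  have hkl : 1 ≤ k * ℓ := Nat.mul_pos hS.k_pos hS.ℓ_pos
  obtain ⟨u, hu, hmax⟩ := (Finset.range (k * ℓ)).exists_max_image R ⟨0, Finset.mem_range.2 hkl⟩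
  have hle : R u ≤ c := (hD u).le (CX u) (CY u) c hc fun i hi => hi.2
  have hin : ∃ p < M, A p = R u := by
    rcases (hD u).crit with h | ⟨i, j, q, hi, hj, hq, h⟩
    · obtain ⟨p, hp, e⟩ := hA 0 hS.N_pos 0 hS.N_pos 0 hS.N_pos
      exact ⟨p, hp, by rw [e, h, critRadius_self]⟩
    · rw [h]
      exact hA i hi.1 j hj.1 q hq.1
  obtain ⟨p, hp, e⟩ := hin
  refine ⟨p, hp, e.trans_le hle, DX, DY, ?_⟩
  rw [e]
  refine hf.snap fun v hv q hq hvq => ?_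
  rw [← hS.N_eq] at hq
  exact ((hD v).cover q ⟨hq, hvq⟩).trans (hmax v (Finset.mem_range.2 hv))

/-- A single center vertex must be matched with every input point. -/
theorem isCritList_one {n k ℓ N m : ℕ} {comp : ℕ → ℕ} {X Y A : ℕ → ℝ} {cx cy : ℝ}
    (hS : Sizes n k ℓ N m comp) (hkl : k * ℓ = 1)
    (hD : IsEnclosingDisk (fun p => p < N) X Y cx cy (A 0)) :
    IsCritList n k ℓ comp X Y 1 A := by
  obtain ⟨rfl, rfl⟩ := mul_eq_one.1 hkl
  have hnn : 0 ≤ A 0 := (pdist_nonneg _ _ _ _).trans (hD.cover 0 hS.N_pos)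
  refine ⟨fun p hp => by rwa [Nat.lt_one_iff.1 hp], fun c CX CY hf => ⟨0, one_pos, ?_, ?_⟩⟩
  · refine hD.le (CX 0) (CY 0) c (hf.nonneg hS) fun p hp => ?_
    rw [hS.N_eq] at hp
    obtain ⟨g, hg, j, hj, rfl⟩ := exists_off hp
    obtain ⟨i, hi, hR⟩ := hf g hg
    obtain rfl : i = 0 := by omega
    simpa using hR.of_one j hj
  · refine ⟨fun _ => cx, fun _ => cy, hf.snap fun u _ p hp _ => ?_⟩
    rw [← hS.N_eq] at hp
    exact hD.cover p hp

/-- Append the critical radius of the points with numbers `reg 60`, `reg 61`, `reg 62`. -/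
def pushRadius : Program :=
  .setR 31 (apexE (ptX (.reg 60)) (ptY (.reg 60)) (ptX (.reg 61)) (ptY (.reg 61))
      (ptX (.reg 62)) (ptY (.reg 62)) /
    crossE (ptX (.reg 60)) (ptY (.reg 60)) (ptX (.reg 61)) (ptY (.reg 61))
      (ptX (.reg 62)) (ptY (.reg 62)) / .const 2) ;;
  .putR 6 (.reg 50) (pdistE
    (bisXE (ptX (.reg 60)) (ptY (.reg 60)) (ptX (.reg 61)) (ptY (.reg 61)) (.reg 31))
    (bisYE (ptX (.reg 60)) (ptY (.reg 60)) (ptX (.reg 61)) (ptY (.reg 61)) (.reg 31))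
    (ptX (.reg 60)) (ptY (.reg 60))) ;;
  .setN 50 (.reg 50 + .const 1)

/-- Write candidates for the optimal radius into array `6`, their number into register `50`. -/
def listRadii : Program :=
  .cond (.natLE (.const 2) (.reg 6))
    (.setN 50 (.const 0) ;; .forN 60 3 (.forN 61 3 (.forN 62 3 pushRadius)))
    (.forN 60 3 (.putN 4 (.reg 60) (.const 1)) ;; smallestDisk ;;
      (.putR 6 (.const 0) (.reg 19) ;; .setN 50 (.const 1)))

/-- Register `50` is `M`, and the critical radii of the first `M` triples are in array `6`. -/
def RadiiDone (N : ℕ) (X Y : ℕ → ℝ) (M : ℕ) (s : State) : Prop :=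
  s.nreg 50 = M ∧ ∀ p < M, s.rmem 6 p = critRadius (X (p / N / N)) (Y (p / N / N))
    (X (p / N % N)) (Y (p / N % N)) (X (p % N)) (Y (p % N))

theorem pushRadius_spec {N i j q : ℕ} {X Y : ℕ → ℝ} {s : State} (hX : s.rmem 0 = X)
    (hY : s.rmem 1 = Y) (hj : j < N) (hq : q < N) (h60 : s.nreg 60 = i)
    (h61 : s.nreg 61 = j) (h62 : s.nreg 62 = q) (h : RadiiDone N X Y ((i * N + j) * N + q) s) :
    Wp pushRadius s 200 (RadiiDone N X Y ((i * N + j) * N + q + 1)) := by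
  obtain ⟨h50, hA⟩ := h
  have e1 : ((i * N + j) * N + q) / N = i * N + j := by
    rw [mul_comm, Nat.mul_add_div (by omega), Nat.div_eq_of_lt hq, add_zero]
  have e2 : (i * N + j) / N = i := by
    rw [mul_comm, Nat.mul_add_div (by omega), Nat.div_eq_of_lt hj, add_zero]
  have e3 : (i * N + j) % N = j := by rw [mul_comm, Nat.mul_add_mod, Nat.mod_eq_of_lt hj]
  have e4 : ((i * N + j) * N + q) % N = q := by
    rw [mul_comm, Nat.mul_add_mod, Nat.mod_eq_of_lt hq]
  refine Wp.basic rfl (by decide) ⟨by simp [pushRadius, Program.run, h50], fun p hp => ?_⟩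
  rcases Nat.lt_succ_iff_lt_or_eq.1 hp with hp | rfl
  · simp [pushRadius, Program.run, h50, hp.ne, hA p hp]
  · rw [e1, e2, e3, e4]
    simp [pushRadius, Program.run, h50, h60, h61, h62, hX, hY, critRadius, circumPar]

theorem listTriples_spec {N : ℕ} {X Y : ℕ → ℝ} {s : State} (hN : s.nreg 3 = N) (hX : s.rmem 0 = X)
    (hY : s.rmem 1 = Y) :
    Wp (.setN 50 (.const 0) ;; .forN 60 3 (.forN 61 3 (.forN 62 3 pushRadius))) s
      (210 * (N * N * N) + 18 * (N * N) + 18 * N + 10) (RadiiDone N X Y (N * N * N)) := by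
  refine Wp.seq (T₁ := 2) (T₂ := 210 * (N * N * N) + 18 * (N * N) + 18 * N + 8)
    (Q₁ := RadiiDone N X Y 0) (Wp.basic rfl (by decide) ⟨by simp [Program.run], by simp⟩)
    (by omega) ?_
  intro s₁ h₁ hF₁
  have hI : ∀ M s i v, i ≠ 50 → RadiiDone N X Y M s → RadiiDone N X Y M (s.setN i v) := by
    intro M s i v hi h
    exact ⟨by simp [Function.update_of_ne hi.symm, h.1], h.2⟩
  refine Wp.forN (n := N) (B := 210 * (N * N) + 18 * N + 8) (fun i => RadiiDone N X Y (i * N * N))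
    ((hF₁.nreg 3 (by decide)).trans hN) (by decide) (by decide)
    (fun _ _ _ => hI _ _ _ _ (by decide)) (by simpa using h₁) ?_ (by ring_nf; omega)
    (fun s' h _ => h)
  intro i s₂ hi h₂ hF₂ e60
  refine Wp.forN (n := N) (B := 210 * N + 8) (fun j => RadiiDone N X Y ((i * N + j) * N))
    ((hF₂.nreg 3 (by decide)).trans ((hF₁.nreg 3 (by decide)).trans hN)) (by decide) (by decide)
    (fun _ _ _ => hI _ _ _ _ (by decide)) (by simpa using h₂) ?_ (by ring_nf; omega) ?_
  swap
  · intro s' h _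
    rwa [show (i + 1) * N * N = (i * N + N) * N by ring]
  intro j s₃ hj h₃ hF₃ e61
  refine Wp.forN (n := N) (B := 200) (fun q => RadiiDone N X Y ((i * N + j) * N + q))
    ((hF₃.nreg 3 (by decide)).trans ((hF₂.nreg 3 (by decide)).trans
      ((hF₁.nreg 3 (by decide)).trans hN))) (by decide) (by decide)
    (fun _ _ _ => hI _ _ _ _ (by decide)) (by simpa using h₃) ?_ (by ring_nf; omega) ?_
  swap
  · intro s' h _
    rwa [show (i * N + (j + 1)) * N = (i * N + j) * N + N by ring]
  intro q s₄ hq h₄ hF₄ e62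
  refine pushRadius_spec ?_ ?_ hj hq ?_ ?_ e62 h₄
  · rw [hF₄.rmem 0 (by decide), hF₃.rmem 0 (by decide), hF₂.rmem 0 (by decide),
      hF₁.rmem 0 (by decide), hX]
  · rw [hF₄.rmem 1 (by decide), hF₃.rmem 1 (by decide), hF₂.rmem 1 (by decide),
      hF₁.rmem 1 (by decide), hY]
  · rw [hF₄.nreg 60 (by decide), hF₃.nreg 60 (by decide), e60]
  · rw [hF₄.nreg 61 (by decide), e61]

/-- A cubic list fits into the budget as soon as `2 * (k * ℓ) ≥ 4`; for `k * ℓ = 1` the budget is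
quadratic and one smallest disk is computed instead. The cubic bound on the length keeps its
logarithm small, the other one bounds the time for sorting. -/
theorem listRadii_spec {n k ℓ N m : ℕ} {comp : ℕ → ℕ} {X Y : ℕ → ℝ} {s : State}
    (hE : Env n k ℓ N comp X Y s) (hS : Sizes n k ℓ N m comp) :
    Wp listRadii s (10000 * (m * n) ^ (2 * (k * ℓ))) (fun s' =>
      1 ≤ s'.nreg 50 ∧ s'.nreg 50 ≤ (m * n) ^ 3 ∧ s'.nreg 50 ≤ (m * n) ^ (2 * (k * ℓ)) ∧
      IsCritList n k ℓ comp X Y (s'.nreg 50) (s'.rmem 6)) := by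
  have hkl : 1 ≤ k * ℓ := Nat.mul_pos hS.k_pos hS.ℓ_pos
  have hQ : 1 ≤ m * n := Nat.mul_pos hS.m_pos hS.n_pos
  have hNQ := hS.N_le
  have hN1 := hS.N_pos
  have hP1 : 1 ≤ (m * n) ^ (2 * (k * ℓ)) := Nat.one_le_pow _ _ hQ
  refine Wp.cond (T₁ := 9990 * (m * n) ^ (2 * (k * ℓ)))
    (by simp only [Test.cost, NExpr.cost]; omega) ?_ ?_
  · intro h2
    simp only [Test.Holds, NExpr.eval, hE.kl_eq] at h2
    have h3 : N * N * N ≤ (m * n) ^ 3 := by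
      rw [show N * N * N = N ^ 3 by ring]; exact Nat.pow_le_pow_left hNQ 3
    have h4 : (m * n) ^ 3 ≤ (m * n) ^ (2 * (k * ℓ)) := Nat.pow_le_pow_right hQ (by omega)
    have h5 : N * N ≤ N * N * N := Nat.le_mul_of_pos_right _ hN1
    have h6 : N ≤ N * N := Nat.le_mul_of_pos_right _ hN1
    refine (listTriples_spec hE.N_eq hE.X_eq hE.Y_eq).imp (by omega) ?_
    rintro s' ⟨h50, hA⟩ -
    rw [h50]
    refine ⟨Nat.mul_pos (Nat.mul_pos hN1 hN1) hN1, h3, h3.trans h4,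
      isCritList_of_critRadius hS (fun p hp => ?_) fun i hi j hj q hq => ?_⟩
    · rw [hA p hp]; exact pdist_nonneg _ _ _ _
    · have e1 : ((i * N + j) * N + q) / N = i * N + j := by
        rw [mul_comm, Nat.mul_add_div (by omega), Nat.div_eq_of_lt hq, add_zero]
      have e2 : (i * N + j) / N = i := by
        rw [mul_comm, Nat.mul_add_div (by omega), Nat.div_eq_of_lt hj, add_zero]
      have e3 : (i * N + j) % N = j := by rw [mul_comm, Nat.mul_add_mod, Nat.mod_eq_of_lt hj]
      have e4 : ((i * N + j) * N + q) % N = q := by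
        rw [mul_comm, Nat.mul_add_mod, Nat.mod_eq_of_lt hq]
      have hlt : (i * N + j) * N + q < N * N * N := vertex_lt (vertex_lt hi hj) hq
      exact ⟨_, hlt, by rw [hA _ hlt, e1, e2, e3, e4]⟩
  · intro h2
    simp only [Test.Holds, NExpr.eval, hE.kl_eq] at h2
    have h1 : k * ℓ = 1 := by omega
    have hP : (m * n) ^ (2 * (k * ℓ)) = (m * n) * (m * n) := by rw [h1]; ring
    have hQQ : m * n ≤ (m * n) * (m * n) := Nat.le_mul_self _
    have hW3 : (N + 1) * (N + 1) ≤ 4 * ((m * n) * (m * n)) := by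
      calc (N + 1) * (N + 1) ≤ (2 * (m * n)) * (2 * (m * n)) :=
            Nat.mul_le_mul (by omega) (by omega)
        _ = 4 * ((m * n) * (m * n)) := by ring
    rw [hP]
    refine Wp.seq (T₁ := N * (10 + 10) + 8) (T₂ := 9000 * (m * n * (m * n)))
      (Q₁ := fun s' => ∀ i < N, s'.nmem 4 i = 1) ?_ (by omega) ?_
    · refine Wp.forN (fun j s' => ∀ i < j, s'.nmem 4 i = 1) hE.N_eq (by decide) (by decide)
        (by intro j s' v; simp) (by simp) ?_ le_rfl (fun s' h _ => h)
      intro j s' hj hI hF h40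
      refine Wp.basic rfl (by decide) fun i hi => ?_
      rcases Nat.lt_succ_iff_lt_or_eq.1 hi with h | rfl
      · simp [Program.run, h40, h.ne, hI i h]
      · simp [Program.run, h40]
    intro s₁ h₁ hF₁
    have hE₁ := hE.of_frame hF₁ (by decide) (by decide) (by decide) (by decide)
    refine Wp.seq (smallestDisk_spec hE₁.N_eq) (T₂ := 50) (by omega) ?_
    intro s₂ h₂ hF₂
    rw [hE₁.X_eq, hE₁.Y_eq] at h₂
    have e : (fun q => q < N ∧ 1 ≤ s₁.nmem 4 q) = fun q => q < N := by
      funext q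
      exact propext ⟨fun h => h.1, fun h => ⟨h, (h₁ q h).ge⟩⟩
    rw [e] at h₂
    refine Wp.basic rfl (by decide) ?_
    have hA := isCritList_one (A := Function.update (s₂.rmem 6) 0 (s₂.rreg 19)) hS h1
      (cx := s₂.rreg 17) (cy := s₂.rreg 18) (by simpa using h₂)
    have h50 : (Program.run (.putR 6 (.const 0) (.reg 19) ;; .setN 50 (.const 1)) s₂).nreg 50 = 1 := by
      simp [Program.run]
    rw [h50]
    refine ⟨le_rfl, Nat.one_le_pow _ _ hQ, Nat.mul_pos hQ hQ, ?_⟩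
    simpa [Program.run] using hA

end RealRAM

namespace RealRAM

/-! ### Merge sort -/

/-- The blocks of length `w` of the sequence `A 0, …, A (M - 1)` are sorted. -/
def BlockSorted (w M : ℕ) (A : ℕ → ℝ) : Prop :=
  ∀ c, w ∣ c → ∀ p q, c ≤ p → p ≤ q → q < c + w → q < M → A p ≤ A q

/-- Both blocks begin at `d * (o / d)`. -/
theorem block_unique {d c c' o : ℕ} (h : d ∣ c) (h' : d ∣ c') (h1 : c ≤ o) (h2 : o < c + d)
    (h3 : c' ≤ o) (h4 : o < c' + d) : c = c' := by
  obtain ⟨a, rfl⟩ := h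
  obtain ⟨b, rfl⟩ := h'
  have ha : o / d = a := Nat.div_eq_of_lt_le (by linarith) (by linarith)
  have hb : o / d = b := Nat.div_eq_of_lt_le (by linarith) (by linarith)
  rw [← ha, ← hb]

/-- `B 0, …, B (o - 1)` result from merging pairs of blocks of length `w` of `A`. The remaining
entries of the current pair of blocks are those from `i` to `mid - 1` and from `j` to `e - 1`. -/
structure Merging (A : ℕ → ℝ) (w M o i mid j e : ℕ) (B : ℕ → ℝ) (c : ℕ) : Prop where
  dvd : 2 * w ∣ c
  le_i : c ≤ i
  i_le : i ≤ mid
  mid_eq : mid = min (c + w) M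
  le_j : mid ≤ j
  j_le : j ≤ e
  e_eq : e = min (c + 2 * w) M
  o_eq : o = i + (j - mid)
  sorted : BlockSorted (2 * w) o B
  le_left : ∀ p q, c ≤ p → p < o → i ≤ q → q < mid → B p ≤ A q
  le_right : ∀ p q, c ≤ p → p < o → j ≤ q → q < e → B p ≤ A q
  values : ∀ x, (∃ p < o, B p = x) ↔ ∃ p, (p < i ∨ mid ≤ p ∧ p < j) ∧ A p = x

theorem BlockSorted.push {d o c : ℕ} {B B' : ℕ → ℝ} (h : BlockSorted d o B) (hc : d ∣ c)
    (h1 : c ≤ o) (h2 : o < c + d) (hB : ∀ p < o, B' p = B p)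
    (hle : ∀ p, c ≤ p → p < o → B p ≤ B' o) : BlockSorted d (o + 1) B' := by
  intro c' hc' p q hp hpq hq hqo
  rcases Nat.lt_succ_iff_lt_or_eq.1 hqo with hlt | rfl
  · rw [hB p (by omega), hB q hlt]
    exact h c' hc' p q hp hpq hq hlt
  · rcases hpq.lt_or_eq with hpo | rfl
    · obtain rfl := block_unique hc hc' h1 h2 (by omega) hq
      rw [hB p hpo]
      exact hle p hp hpo
    · exact le_rfl

theorem values_push {o : ℕ} {A B B' : ℕ → ℝ} {P P' : ℕ → Prop} {r : ℕ}
    (h : ∀ x, (∃ p < o, B p = x) ↔ ∃ p, P p ∧ A p = x) (hB : ∀ p < o, B' p = B p)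
    (hr : B' o = A r) (hP : ∀ p, P' p ↔ P p ∨ p = r) (x : ℝ) :
    (∃ p < o + 1, B' p = x) ↔ ∃ p, P' p ∧ A p = x := by
  constructor
  · rintro ⟨p, hp, rfl⟩
    rcases Nat.lt_succ_iff_lt_or_eq.1 hp with hp | rfl
    · obtain ⟨q, hq, e⟩ := (h (B p)).1 ⟨p, hp, rfl⟩
      exact ⟨q, (hP q).2 (Or.inl hq), by rw [e, hB p hp]⟩
    · exact ⟨r, (hP r).2 (Or.inr rfl), hr.symm⟩
  · rintro ⟨p, hp, rfl⟩
    rcases (hP p).1 hp with hp | rfl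
    · obtain ⟨q, hq, e⟩ := (h (A p)).2 ⟨p, hp, rfl⟩
      exact ⟨q, by omega, by rw [hB q hq, e]⟩
    · exact ⟨o, by omega, hr⟩

/-- `A j` is a minimum of the remaining entries of the pair: those on the right follow it in a
sorted block, those on the left are at least `A i`, hence at least `A j`. -/
theorem Merging.takeRight {A B B' : ℕ → ℝ} {w M o i mid j e c : ℕ} (hA : BlockSorted w M A)
    (h : Merging A w M o i mid j e B c) (hj : j < e) (hle : i < mid → A j ≤ A i)
    (hB : ∀ p < o, B' p = B p) (hr : B' o = A j) : Merging A w M (o + 1) i mid (j + 1) e B' c := by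
  have := h.i_le
  have := h.le_i
  have hm := h.mid_eq
  have := h.le_j
  have he := h.e_eq
  have ho := h.o_eq
  have hcw : w ∣ c := (Dvd.intro_left 2 rfl).trans h.dvd
  refine ⟨h.dvd, h.le_i, h.i_le, h.mid_eq, by omega, hj, h.e_eq, by omega, ?_, ?_, ?_, ?_⟩
  · refine h.sorted.push h.dvd (by omega) (by omega) hB fun p hp hpo => ?_
    rw [hr]
    exact h.le_right p j hp hpo le_rfl hj
  · intro p q hp hpo hq hqm
    rcases Nat.lt_succ_iff_lt_or_eq.1 hpo with hpo | rfl
    · rw [hB p hpo]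
      exact h.le_left p q hp hpo hq hqm
    · rw [hr]
      exact (hle (by omega)).trans (hA c hcw i q (by omega) hq (by omega) (by omega))
  · intro p q hp hpo hq hqe
    rcases Nat.lt_succ_iff_lt_or_eq.1 hpo with hpo | rfl
    · rw [hB p hpo]
      exact h.le_right p q hp hpo (by omega) hqe
    · rw [hr]
      exact hA (c + w) (hcw.add dvd_rfl) j q (by omega) (by omega) (by omega) (by omega)
  · exact values_push h.values hB hr fun p => by omega

theorem Merging.takeLeft {A B B' : ℕ → ℝ} {w M o i mid j e c : ℕ} (hA : BlockSorted w M A)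
    (h : Merging A w M o i mid j e B c) (hi : i < mid) (hle : j < e → A i ≤ A j)
    (hB : ∀ p < o, B' p = B p) (hr : B' o = A i) : Merging A w M (o + 1) (i + 1) mid j e B' c := by
  have := h.i_le
  have := h.le_i
  have hm := h.mid_eq
  have := h.le_j
  have he := h.e_eq
  have ho := h.o_eq
  have := h.j_le
  have hcw : w ∣ c := (Dvd.intro_left 2 rfl).trans h.dvd
  refine ⟨h.dvd, by omega, hi, h.mid_eq, h.le_j, h.j_le, h.e_eq, by omega, ?_, ?_, ?_, ?_⟩
  · refine h.sorted.push h.dvd (by omega) (by omega) hB fun p hp hpo => ?_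
    rw [hr]
    exact h.le_left p i hp hpo le_rfl hi
  · intro p q hp hpo hq hqm
    rcases Nat.lt_succ_iff_lt_or_eq.1 hpo with hpo | rfl
    · rw [hB p hpo]
      exact h.le_left p q hp hpo (by omega) hqm
    · rw [hr]
      exact hA c hcw i q (by omega) (by omega) (by omega) (by omega)
  · intro p q hp hpo hq hqe
    rcases Nat.lt_succ_iff_lt_or_eq.1 hpo with hpo | rfl
    · rw [hB p hpo]
      exact h.le_right p q hp hpo hq hqe
    · rw [hr]
      exact (hle (by omega)).trans
        (hA (c + w) (hcw.add dvd_rfl) j q (by omega) (by omega) (by omega) (by omega))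
  · exact values_push h.values hB hr fun p => by omega

theorem Merging.nextBlock {A B : ℕ → ℝ} {w M o c e j i mid : ℕ}
    (h : Merging A w M o i mid j e B c) (hi : mid ≤ i) (hj : e ≤ j) (ho : o < M) :
    Merging A w M o e (min (e + w) M) (min (e + w) M) (min (min (e + w) M + w) M) B e := by
  have := h.i_le
  have := h.le_i
  have hm := h.mid_eq
  have := h.le_j
  have he := h.e_eq
  have ho := h.o_eq
  have := h.j_le
  -- Since the pair is used up and `o < M`, it was not truncated at `M`; so the next pair begins at
  -- a multiple of `2 * w`.
  have hec : e = c + 2 * w := by omega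
  refine ⟨by rw [hec]; exact h.dvd.add dvd_rfl, le_rfl, by omega, rfl, le_rfl, by omega, by omega,
    by omega, h.sorted, fun p q => by omega, fun p q => by omega, fun x => (h.values x).trans ?_⟩
  have : ∀ p, (p < i ∨ mid ≤ p ∧ p < j) ↔ (p < e ∨ min (e + w) M ≤ p ∧ p < min (e + w) M) :=
    fun p => by omega
  simp only [this]

theorem merging_zero (A B : ℕ → ℝ) (w M : ℕ) :
    Merging A w M 0 0 (min w M) (min w M) (min (min w M + w) M) B 0 :=
  ⟨dvd_zero _, le_rfl, by omega, by simp, le_rfl, by omega, by omega, by omega,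
    fun c _ p q _ _ _ h => by omega, fun p q => by omega, fun p q => by omega,
    fun x => by simp; intro p h1 h2; omega⟩

/-- The minimum of two natural numbers. -/
def minE (a b : NExpr) : NExpr := a - (a - b)

@[simp] theorem eval_minE (a b : NExpr) (s : State) :
    (minE a b).eval s = min (a.eval s) (b.eval s) := by
  simp [minE]; omega

/-- Write the next entry of the merged blocks to array `7`. -/
def mergeStep : Program :=
  .cond (.both (.natLE (.reg 53) (.reg 52)) (.natLE (.reg 55) (.reg 54)))
    (.setN 52 (.reg 55) ;; .setN 53 (minE (.reg 52 + .reg 56) (.reg 50)) ;; .setN 54 (.reg 53) ;;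
      .setN 55 (minE (.reg 53 + .reg 56) (.reg 50))) .skip ;;
  .cond (.both (.natLT (.reg 54) (.reg 55))
      (.neg (.both (.natLT (.reg 52) (.reg 53)) (.realLE (.get 6 (.reg 52)) (.get 6 (.reg 54))))))
    (.putR 7 (.reg 51) (.get 6 (.reg 54)) ;; .setN 54 (.reg 54 + .const 1))
    (.putR 7 (.reg 51) (.get 6 (.reg 52)) ;; .setN 52 (.reg 52 + .const 1))

/-- Merge pairs of blocks whose length is in register `56`. -/
def mergePass : Program :=
  (.setN 52 (.const 0) ;; .setN 53 (minE (.reg 56) (.reg 50)) ;; .setN 54 (.reg 53) ;;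
    .setN 55 (minE (.reg 53 + .reg 56) (.reg 50))) ;;
  .forN 51 50 mergeStep ;;
  .forN 51 50 (.putR 6 (.reg 51) (.get 7 (.reg 51)))

/-- Sort the first `reg 50` entries of array `6`. Powers of two are written to array `5`, the
number of passes to register `57`. -/
def mergeSort : Program :=
  (.setN 56 (.const 1) ;; .setN 57 (.const 0)) ;;
  .loop (.natLT (.reg 56) (.reg 50))
    (mergePass ;;
      (.putN 5 (.reg 57) (.reg 56) ;; .setN 57 (.reg 57 + .const 1) ;; .setN 56 (.reg 56 + .reg 56)))

theorem mergeStep_spec {s : State} {A : ℕ → ℝ} {w M o c : ℕ} (h6 : s.rmem 6 = A)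
    (h50 : s.nreg 50 = M) (h56 : s.nreg 56 = w) (hw : 1 ≤ w) (hA : BlockSorted w M A)
    (ho : o < M) (h51 : s.nreg 51 = o)
    (h : Merging A w M o (s.nreg 52) (s.nreg 53) (s.nreg 54) (s.nreg 55) (s.rmem 7) c) :
    Wp mergeStep s 100 (fun s' => ∃ c, Merging A w M (o + 1) (s'.nreg 52) (s'.nreg 53)
      (s'.nreg 54) (s'.nreg 55) (s'.rmem 7) c) := by
  -- After the possible change to the next pair, one of the two blocks still has an entry to offer.
  refine Wp.seq (T₁ := 50) (T₂ := 50) (Q₁ := fun s' => ∃ c, Merging A w M o (s'.nreg 52)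
    (s'.nreg 53) (s'.nreg 54) (s'.nreg 55) (s'.rmem 7) c ∧
    (s'.nreg 52 < s'.nreg 53 ∨ s'.nreg 54 < s'.nreg 55)) ?_ (by omega) ?_
  · refine Wp.cond (T₁ := 40) (by decide) ?_ ?_
    · rintro ⟨h1, h2⟩
      simp only [Test.Holds, NExpr.eval] at h1 h2
      refine Wp.basic rfl (by decide) ⟨s.nreg 55, ?_⟩
      have hn := h.nextBlock h1 h2 ho
      have h3 := h.o_eq
      have h4 := h.i_le
      have h5 := h.j_le
      have h6 := h.le_j
      have hw : s.nreg 55 < min (s.nreg 55 + w) M := by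
        have h7 := h.le_i
        have h8 := h.e_eq
        have h9 := h.mid_eq
        omega
      simp [Program.run, h50, h56, hn, hw]
    · intro hn
      simp only [Test.Holds, NExpr.eval, not_and_or, not_le] at hn
      exact Wp.basic rfl (by decide) ⟨c, h, hn⟩
  rintro s₁ ⟨c, h, hlt⟩ hF
  have g6 : s₁.rmem 6 = A := (hF.rmem 6 (by decide)).trans h6
  have g51 : s₁.nreg 51 = o := (hF.nreg 51 (by decide)).trans h51
  refine Wp.cond (T₁ := 20) (by decide) ?_ ?_
  · rintro ⟨h1, h2⟩
    simp only [Test.Holds, Test.holds_natLT, NExpr.eval, RExpr.eval, g6, not_and, not_le] at h1 h2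
    refine Wp.basic rfl (by decide) ⟨c, ?_⟩
    have := h.takeRight hA h1 (fun hi => (h2 hi).le)
      (B' := Function.update (s₁.rmem 7) o (A (s₁.nreg 54)))
      (fun p hp => Function.update_of_ne hp.ne _ _) (Function.update_self _ _ _)
    simpa [Program.run, g6, g51] using this
  · intro hn
    simp only [Test.Holds, Test.holds_natLT, NExpr.eval, RExpr.eval, g6, not_and] at hn
    refine Wp.basic rfl (by decide) ⟨c, ?_⟩
    have hi : s₁.nreg 52 < s₁.nreg 53 := by
      rcases hlt with h | h
      exacts [h, (by have := hn h; tauto)]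
    have := h.takeLeft hA hi (fun hj => by have := hn hj; tauto)
      (B' := Function.update (s₁.rmem 7) o (A (s₁.nreg 52)))
      (fun p hp => Function.update_of_ne hp.ne _ _) (Function.update_self _ _ _)
    simpa [Program.run, g6, g51] using this

theorem mergePass_spec {s : State} {A : ℕ → ℝ} {w M : ℕ} (h6 : s.rmem 6 = A)
    (h50 : s.nreg 50 = M) (h56 : s.nreg 56 = w) (hw : 1 ≤ w) (hA : BlockSorted w M A) :
    Wp mergePass s (200 * (M + 1)) (fun s' => BlockSorted (2 * w) M (s'.rmem 6) ∧
      ∀ x, (∃ p < M, s'.rmem 6 p = x) ↔ ∃ p < M, A p = x) := by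
  refine Wp.seq (T₁ := 50) (T₂ := 130 * M + 16) (Q₁ := fun s' => Merging A w M 0
    (s'.nreg 52) (s'.nreg 53) (s'.nreg 54) (s'.nreg 55) (s'.rmem 7) 0)
    (Wp.basic rfl (by decide) ?_) (by omega) ?_
  · have := merging_zero A (s.rmem 7) w M
    simpa [Program.run, h50, h56] using this
  intro s₁ h₁ hF₁
  have a50 : s₁.nreg 50 = M := (hF₁.nreg 50 (by decide)).trans h50
  have a6 : s₁.rmem 6 = A := (hF₁.rmem 6 (by decide)).trans h6
  have a56 : s₁.nreg 56 = w := (hF₁.nreg 56 (by decide)).trans h56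
  refine Wp.seq (T₁ := M * (100 + 10) + 8) (T₂ := M * (10 + 10) + 8) (Q₁ := fun s' =>
    BlockSorted (2 * w) M (s'.rmem 7) ∧
      ∀ x, (∃ p < M, s'.rmem 7 p = x) ↔ ∃ p < M, A p = x) ?_ (by omega) ?_
  · refine Wp.forN (fun o s' => ∃ c, Merging A w M o (s'.nreg 52) (s'.nreg 53) (s'.nreg 54)
      (s'.nreg 55) (s'.rmem 7) c) a50 (by decide) (by decide) ?_ ⟨0, h₁⟩ ?_ le_rfl ?_
    · rintro o s' v ⟨c, h⟩
      exact ⟨c, by simpa using h⟩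
    · rintro o s' ho ⟨c, h⟩ hF h51
      exact mergeStep_spec ((hF.rmem 6 (by decide)).trans a6)
        ((hF.nreg 50 (by decide)).trans a50) ((hF.nreg 56 (by decide)).trans a56) hw hA ho h51 h
    · rintro s' ⟨c, h⟩ -
      refine ⟨h.sorted, fun x => (h.values x).trans ?_⟩
      have h1 := h.i_le
      have h2 := h.mid_eq
      have h3 := h.le_j
      have h4 := h.j_le
      have h5 := h.e_eq
      have h6 := h.o_eq
      have : ∀ p, (p < s'.nreg 52 ∨ s'.nreg 53 ≤ p ∧ p < s'.nreg 54) ↔ p < M := fun p => by omega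
      simp only [this]
  rintro s₂ ⟨hs, hv⟩ hF₂
  refine Wp.forN (fun j s' => ∀ i < j, s'.rmem 6 i = s₂.rmem 7 i)
    ((hF₂.nreg 50 (by decide)).trans a50) (by decide) (by decide) (by intro j s' v; simp) (by simp)
    ?_ le_rfl ?_
  · intro j s' hj hI hF h51
    have a7 : s'.rmem 7 = s₂.rmem 7 := hF.rmem 7 (by decide)
    refine Wp.basic rfl (by decide) fun i hi => ?_
    rcases Nat.lt_succ_iff_lt_or_eq.1 hi with h | rfl
    · simp [Program.run, h51, h.ne, hI i h]
    · simp [Program.run, h51, a7]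
  · intro s' h _
    constructor
    · intro c hc p q hp hpq hq hqM
      rw [h p (by omega), h q hqM]
      exact hs c hc p q hp hpq hq hqM
    · intro x
      rw [← hv x]
      exact exists_congr fun p => and_congr_right fun hp => by rw [h p hp]

/-- Each pass doubles the length of the sorted blocks, so `Nat.clog 2 M` passes suffice. The block
lengths are kept in array `5` because the binary search needs powers of two in decreasing order and
indices cannot be halved. -/
theorem mergeSort_spec {s : State} {M : ℕ} (h50 : s.nreg 50 = M) :
    Wp mergeSort s (300 * ((M + 1) * (Nat.clog 2 M + 1))) (fun s' =>
      s'.nreg 57 ≤ Nat.clog 2 M ∧ M ≤ 2 ^ s'.nreg 57 ∧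
      (∀ i < s'.nreg 57, s'.nmem 5 i = 2 ^ i) ∧
      (∀ p q, p ≤ q → q < M → s'.rmem 6 p ≤ s'.rmem 6 q) ∧
      ∀ x, (∃ p < M, s.rmem 6 p = x) ↔ ∃ p < M, s'.rmem 6 p = x) := by
  refine Wp.seq (T₁ := 10) (T₂ := Nat.clog 2 M * ((200 * (M + 1) + 30) + 5 + 1) + 5 + 1)
    (Q₁ := fun s' => s'.nreg 56 = 1 ∧ s'.nreg 57 = 0)
    (Wp.basic rfl (by decide) (by simp [Program.run])) (by nlinarith) ?_
  rintro s₁ ⟨h56, h57⟩ hF₁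
  have a50 : s₁.nreg 50 = M := (hF₁.nreg 50 (by decide)).trans h50
  have a6 : s₁.rmem 6 = s.rmem 6 := hF₁.rmem 6 (by decide)
  refine (Wp.loop (Nat.clog 2 M) (200 * (M + 1) + 30) (fun j s' =>
    s'.nreg 56 = 2 ^ j ∧ s'.nreg 57 = j ∧ (∀ i < j, s'.nmem 5 i = 2 ^ i) ∧
    BlockSorted (2 ^ j) M (s'.rmem 6) ∧
    ∀ x, (∃ p < M, s.rmem 6 p = x) ↔ ∃ p < M, s'.rmem 6 p = x) ?_ ?_).imp le_rfl ?_
  · refine ⟨h56, h57, by simp, fun c _ p q hp hpq hq _ => ?_, fun x => by rw [a6]⟩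
    obtain rfl : p = q := by simp at hq; omega
    exact le_rfl
  · rintro j s₂ ⟨b56, b57, hpw, hs, hv⟩ hF ht
    have b50 : s₂.nreg 50 = M := (hF.nreg 50 (by decide)).trans a50
    simp only [Test.holds_natLT, NExpr.eval, b56, b50] at ht
    refine ⟨(Nat.lt_clog_iff_pow_lt (by norm_num)).2 ht, ?_⟩
    refine Wp.seq (mergePass_spec rfl b50 b56 Nat.one_le_two_pow hs) (T₂ := 30) le_rfl ?_
    rintro s₃ ⟨hs', hv'⟩ hF₃
    have c56 : s₃.nreg 56 = 2 ^ j := (hF₃.nreg 56 (by decide)).trans b56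
    have c57 : s₃.nreg 57 = j := (hF₃.nreg 57 (by decide)).trans b57
    have c5 : s₃.nmem 5 = s₂.nmem 5 := hF₃.nmem 5 (by decide)
    refine Wp.basic rfl (by decide) ⟨?_, ?_, fun i hi => ?_, ?_, fun x => ?_⟩
    · simp [Program.run, c56]; ring
    · simp [Program.run, c57]
    · rcases Nat.lt_succ_iff_lt_or_eq.1 hi with h | rfl
      · simp [Program.run, c57, h.ne, c5, hpw i h]
      · simp [Program.run, c57, c56]
    · rw [pow_succ']
      simpa [Program.run] using hs'
    · rw [hv x, ← hv' x]
      simp [Program.run]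
  · rintro s' ⟨j, hj, ⟨b56, b57, hpw, hs, hv⟩, hn⟩ hF
    have b50 : s'.nreg 50 = M := (hF.nreg 50 (by decide)).trans a50
    simp only [Test.holds_natLT, NExpr.eval, b56, b50, not_lt] at hn
    refine ⟨by omega, by rwa [b57], by rwa [b57], fun p q hpq hq => ?_, hv⟩
    exact hs 0 (dvd_zero _) p q (Nat.zero_le _) hpq (by omega) hq

end RealRAM

/-! ### Binary search for the optimal radius -/

namespace RealRAM
open PlaneGeometry CurveClustering

/-- Binary search for the smallest feasible radius in the sorted array `6` of length `reg 50`. -/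
def searchRadius : Program :=
  .setN 58 (.const 0) ;;
  .forN 59 57
    (.setN 63 (.get 5 (.reg 57 - .reg 59 - .const 1)) ;;
      .cond (.natLE (.reg 58 + .reg 63) (.reg 50))
        (.setR 1 (.get 6 (.reg 58 + .reg 63 - .const 1)) ;; decideRadius ;;
          .cond (.natLE (.reg 45) (.const 0)) (.setN 58 (.reg 58 + .reg 63)) .skip) .skip) ;;
  .setR 1 (.get 6 (.reg 58)) ;;
  decideRadius

theorem Feas.mono {n k ℓ : ℕ} {comp : ℕ → ℕ} {X Y CX CY : ℕ → ℝ} {c r : ℝ}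
    (h : Feas n k ℓ comp X Y c CX CY) (hcr : c ≤ r) : Feas n k ℓ comp X Y r CX CY :=
  h.snap fun _ _ _ _ hle => hle.trans hcr

/-- Let `P` be the first feasible index. Since the list is sorted, the feasible indices are those
from `P` on. An interval of length `2 ^ (H - j)` that contains `P` is halved by testing the last
entry of its left half. -/
theorem searchRadius_spec {n k ℓ N m M H : ℕ} {comp : ℕ → ℕ} {X Y A : ℕ → ℝ} {s : State}
    (hE : Env n k ℓ N comp X Y s) (hS : Sizes n k ℓ N m comp) (h50 : s.nreg 50 = M)
    (h57 : s.nreg 57 = H) (hMH : M ≤ 2 ^ H) (hpw : ∀ i < H, s.nmem 5 i = 2 ^ i)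
    (hA : s.rmem 6 = A) (hs : ∀ p q, p ≤ q → q < M → A p ≤ A q)
    (hC : IsCritList n k ℓ comp X Y M A) (hex : ∃ c CX CY, Feas n k ℓ comp X Y c CX CY) :
    Wp searchRadius s (41000 * ((H + 1) * ((m * n) ^ (2 * (k * ℓ)) * (k * ℓ)))) (fun s' =>
      Feas n k ℓ comp X Y (s'.rreg 1) (s'.rmem 2) (s'.rmem 3) ∧
      ∀ c CX CY, Feas n k ℓ comp X Y c CX CY → s'.rreg 1 ≤ c) := by
  classical
  have hgood : ∃ p, p < M ∧ ∃ CX CY, Feas n k ℓ comp X Y (A p) CX CY := by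
    obtain ⟨c, CX, CY, hf⟩ := hex
    obtain ⟨p, hp, -, h⟩ := hC.exists_le c CX CY hf
    exact ⟨p, hp, h⟩
  obtain ⟨P, ⟨hPM, CX₀, CY₀, hP⟩, hmin⟩ : ∃ P, (P < M ∧ ∃ CX CY, Feas n k ℓ comp X Y (A P) CX CY) ∧
      ∀ p, (p < M ∧ ∃ CX CY, Feas n k ℓ comp X Y (A p) CX CY) → P ≤ p :=
    ⟨Nat.find hgood, Nat.find_spec hgood, fun p hp => Nat.find_min' hgood hp⟩
  have hQ : 1 ≤ m * n := Nat.mul_pos hS.m_pos hS.n_pos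
  have hD : 1 ≤ (m * n) ^ (2 * (k * ℓ)) * (k * ℓ) :=
    Nat.mul_pos (Nat.one_le_pow _ _ hQ) (Nat.mul_pos hS.k_pos hS.ℓ_pos)
  set D := (m * n) ^ (2 * (k * ℓ)) * (k * ℓ) with hDdef
  have hsplit : 41000 * ((H + 1) * D) = H * (41000 * D) + 41000 * D := by ring
  have hHD : H * (40070 * D + 10) ≤ H * (41000 * D) := Nat.mul_le_mul_left _ (by omega)
  refine Wp.seq (T₁ := 2) (T₂ := H * (41000 * D) + 40900 * D) (Q₁ := fun s' => s'.nreg 58 = 0)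
    (Wp.basic rfl (by decide) (by simp [Program.run])) (by omega) ?_
  intro s₁ h58 hF₁
  have hE₁ := hE.of_frame hF₁ (by decide) (by decide) (by decide) (by decide)
  have a50 : s₁.nreg 50 = M := (hF₁.nreg 50 (by decide)).trans h50
  have a57 : s₁.nreg 57 = H := (hF₁.nreg 57 (by decide)).trans h57
  have aA : s₁.rmem 6 = A := (hF₁.rmem 6 (by decide)).trans hA
  have apw : s₁.nmem 5 = s.nmem 5 := hF₁.nmem 5 (by decide)
  refine Wp.seq (T₁ := H * ((40070 * D) + 10) + 8) (T₂ := 40050 * D)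
    (Q₁ := fun s' => s'.nreg 58 = P) ?_ (by omega) ?_
  · refine Wp.forN (fun j s' => s'.nreg 58 ≤ P ∧ P < s'.nreg 58 + 2 ^ (H - j)) a57 (by decide)
      (by decide) (by intro j s' v; simp) ⟨by omega, by rw [h58]; simp; omega⟩ ?_ le_rfl ?_
    swap
    · rintro s' ⟨h1, h2⟩ -
      simp at h2
      omega
    rintro j s₂ hj ⟨hlo, hhi⟩ hF₂ h59
    have hE₂ := hE₁.of_frame hF₂ (by decide) (by decide) (by decide) (by decide)
    have b50 : s₂.nreg 50 = M := (hF₂.nreg 50 (by decide)).trans a50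
    have b57 : s₂.nreg 57 = H := (hF₂.nreg 57 (by decide)).trans a57
    have bA : s₂.rmem 6 = A := (hF₂.rmem 6 (by decide)).trans aA
    have bpw : s₂.nmem 5 = s.nmem 5 := (hF₂.nmem 5 (by decide)).trans apw
    set w := 2 ^ (H - (j + 1)) with hw
    have hw1 : 1 ≤ w := Nat.one_le_two_pow
    have hww : 2 ^ (H - j) = w + w := by
      rw [show H - j = (H - (j + 1)) + 1 by omega, pow_succ, mul_two]
    rw [hww] at hhi
    refine Wp.seq (T₁ := 20) (T₂ := 40040 * D) (Q₁ := fun s' => s'.nreg 63 = w)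
      (Wp.basic rfl (by decide) ?_) (by omega) ?_
    · have : H - j - 1 = H - (j + 1) := by omega
      simp [Program.run, b57, h59, bpw, this, hpw (H - (j + 1)) (by omega), hw]
    intro s₃ h63 hF₃
    have hE₃ := hE₂.of_frame hF₃ (by decide) (by decide) (by decide) (by decide)
    have c50 : s₃.nreg 50 = M := (hF₃.nreg 50 (by decide)).trans b50
    have cA : s₃.rmem 6 = A := (hF₃.rmem 6 (by decide)).trans bA
    have c58 : s₃.nreg 58 = s₂.nreg 58 := hF₃.nreg 58 (by decide)
    generalize hlodef : s₂.nreg 58 = lo at *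
    refine Wp.cond (T₁ := 40030 * D) ((Nat.add_le_add_right (Nat.add_le_add_right
      (by decide : _ ≤ 9) _) _).trans (by omega)) ?_ ?_
    · intro ht
      have hle : lo + w ≤ M := by simpa [c58, h63, c50] using ht
      refine Wp.seq (T₁ := 10) (T₂ := 40020 * D)
        (Q₁ := fun s' => s'.rreg 1 = A (lo + w - 1)) (Wp.basic rfl (by decide)
          (by simp [Program.run, cA, c58, h63])) (by omega) ?_
      intro s₄ r₄ hF₄
      have hE₄ := hE₃.of_frame hF₄ (by decide) (by decide) (by decide) (by decide)
      refine Wp.seq (decideRadius_spec hE₄ hS (by rw [r₄]; exact hC.nonneg _ (by omega)))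
        (T₂ := 20) (by omega) ?_
      intro s₅ h₅ hF₅
      have d58 : s₅.nreg 58 = lo :=
        (hF₅.nreg 58 (by decide)).trans ((hF₄.nreg 58 (by decide)).trans c58)
      have d63 : s₅.nreg 63 = w :=
        (hF₅.nreg 63 (by decide)).trans ((hF₄.nreg 63 (by decide)).trans h63)
      rw [r₄] at h₅
      refine Wp.cond (T₁ := 10) (by decide) ?_ ?_
      · intro ht
        rcases h₅ with ⟨h45, -⟩ | ⟨-, hno⟩
        · simp [h45] at ht
        refine Wp.basic rfl (by decide) ?_
        have : lo + w ≤ P := by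
          by_contra hlt
          exact hno CX₀ CY₀ (hP.mono (hs P (lo + w - 1) (by omega) (by omega)))
        simp [Program.run, d58, d63, this]
        omega
      · intro ht
        rcases h₅ with ⟨-, hf⟩ | ⟨h45, -⟩
        · refine Wp.basic rfl (by decide) ?_
          have := hmin (lo + w - 1) ⟨by omega, _, _, hf⟩
          show s₅.nreg 58 ≤ P ∧ P < s₅.nreg 58 + w
          omega
        · simp [h45] at ht
    · intro ht
      -- The right half lies beyond the array, so `P` is in the left half without a test.
      have hle : M < lo + w := by simpa [c58, h63, c50] using ht
      refine Wp.basic rfl (show 1 ≤ _ by omega) ?_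
      show s₃.nreg 58 ≤ P ∧ P < s₃.nreg 58 + w
      omega
  intro s₂ h58 hF₂
  have hE₂ := hE₁.of_frame hF₂ (by decide) (by decide) (by decide) (by decide)
  have bA : s₂.rmem 6 = A := (hF₂.rmem 6 (by decide)).trans aA
  -- The last decision of the search may have concerned another radius, so the centers are computed
  -- once more for the optimal one.
  refine Wp.seq (T₁ := 10) (T₂ := 40000 * D) (Q₁ := fun s' => s'.rreg 1 = A P)
    (Wp.basic rfl (by decide) (by simp [Program.run, bA, h58])) (by omega) ?_
  intro s₃ r₃ hF₃
  have hE₃ := hE₂.of_frame hF₃ (by decide) (by decide) (by decide) (by decide)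
  refine (decideRadius_spec hE₃ hS (by rw [r₃]; exact hC.nonneg _ hPM)).imp le_rfl ?_
  intro s₄ h₄ hF₄
  rw [hF₄.rreg 1 (by decide), r₃]
  rw [r₃] at h₄
  rcases h₄ with ⟨-, hf⟩ | ⟨-, hno⟩
  · refine ⟨hf, fun c CX CY hf' => ?_⟩
    obtain ⟨p, hp, hle, hg⟩ := hC.exists_le c CX CY hf'
    exact (hs P p (hmin p ⟨hp, hg⟩) hp).trans hle
  · exact absurd hP (hno _ _)

end RealRAM

namespace CurveClustering
open PlaneGeometry RealRAM

/-! ### Warping paths and reachability -/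

/-- The vertices number `t` of `x` and `j` of `y` have distance at most `r`. -/
def Near (x y : Curve) (r : ℝ) (t j : ℕ) : Prop :=
  ∃ (ht : t < x.complexity) (hj : j < y.complexity), dist (x.vertex ⟨t, ht⟩) (y.vertex ⟨j, hj⟩) ≤ r

theorem pathCost_le_iff {x y : Curve} {W : List (Fin x.complexity × Fin y.complexity)} {r : ℝ} :
    pathCost x y W ≤ r ↔ 0 ≤ r ∧ ∀ p ∈ W, dist (x.vertex p.1) (y.vertex p.2) ≤ r := by
  unfold pathCost
  induction W with
  | nil => simp
  | cons p W ih =>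
    simp only [List.map_cons, List.foldr_cons, max_le_iff, ih, List.forall_mem_cons]
    tauto

/-- Path costs lie in a finite set, so the infimum in `discreteFrechet` is attained. -/
theorem pathCost_mem (x y : Curve) (W : List (Fin x.complexity × Fin y.complexity)) :
    pathCost x y W ∈ insert 0 (Set.range fun p : Fin x.complexity × Fin y.complexity =>
      dist (x.vertex p.1) (y.vertex p.2)) := by
  unfold pathCost
  induction W with
  | nil => simp
  | cons p W ih =>
    simp only [List.map_cons, List.foldr_cons]
    rcases max_choice (dist (x.vertex p.1) (y.vertex p.2))
      ((W.map fun p => dist (x.vertex p.1) (y.vertex p.2)).foldr max 0) with h | h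
    · rw [h]; exact Or.inr ⟨p, rfl⟩
    · rw [h]; exact ih

theorem exists_path_of_reach {x y : Curve} {r : ℝ} {t j : ℕ}
    (h : Reach (Near x y r) (t + 1) (j + 1)) :
    ∃ W : List (Fin x.complexity × Fin y.complexity),
      (∃ p, W.head? = some p ∧ p.1.val = 0 ∧ p.2.val = 0) ∧
      (∃ p, W.getLast? = some p ∧ p.1.val = t ∧ p.2.val = j) ∧ W.IsChain WarpStep ∧
      ∀ p ∈ W, dist (x.vertex p.1) (y.vertex p.2) ≤ r := by
  induction hd : t + j using Nat.strong_induction_on generalizing t j with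
  | _ d ih =>
    rw [reach_succ_succ] at h
    obtain ⟨⟨ht, hj, hle⟩, h⟩ := h
    -- A path to any of the three predecessors is extended by the pair `(t, j)`.
    have key : ∀ t' j', t' + j' < d → Reach (Near x y r) (t' + 1) (j' + 1) →
        (∀ p : Fin x.complexity × Fin y.complexity, p.1.val = t' → p.2.val = j' →
          WarpStep p (⟨t, ht⟩, ⟨j, hj⟩)) →
        ∃ W : List (Fin x.complexity × Fin y.complexity),
          (∃ p, W.head? = some p ∧ p.1.val = 0 ∧ p.2.val = 0) ∧
          (∃ p, W.getLast? = some p ∧ p.1.val = t ∧ p.2.val = j) ∧ W.IsChain WarpStep ∧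
          ∀ p ∈ W, dist (x.vertex p.1) (y.vertex p.2) ≤ r := by
      intro t' j' hlt hR hstep
      obtain ⟨W, ⟨p, hp, hp1, hp2⟩, ⟨q, hq, hq1, hq2⟩, hc, hW⟩ := ih _ hlt hR rfl
      refine ⟨W ++ [(⟨t, ht⟩, ⟨j, hj⟩)], ⟨p, by simp [List.head?_append, hp], hp1, hp2⟩,
        ⟨(⟨t, ht⟩, ⟨j, hj⟩), by simp, rfl, rfl⟩, ?_, ?_⟩
      · refine List.isChain_append.2 ⟨hc, by simp, ?_⟩
        intro a ha b hb
        rw [hq] at ha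
        simp only [Option.mem_def, Option.some.injEq, List.head?_cons] at ha hb
        subst ha hb
        exact hstep _ hq1 hq2
      · intro a ha
        rcases List.mem_append.1 ha with ha | ha
        · exact hW a ha
        · rw [List.mem_singleton.1 ha]; exact hle
    rcases h with h | h | h
    · rcases t with _ | t
      · simp [reach_zero] at h
      · exact key t j (by omega) h fun p h1 h2 => Or.inr (Or.inl ⟨by simp [h1], by simp [h2]⟩)
    · rcases t with _ | t
      · rw [reach_zero] at h
        subst h
        exact ⟨[(⟨0, ht⟩, ⟨0, hj⟩)], ⟨_, rfl, rfl, rfl⟩, ⟨_, rfl, rfl, rfl⟩, by simp,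
          by simpa using hle⟩
      · rcases j with _ | j
        · exact absurd h not_reach_succ_zero
        · exact key t j (by omega) h fun p h1 h2 => Or.inr (Or.inr ⟨by simp [h1], by simp [h2]⟩)
    · rcases j with _ | j
      · exact absurd h not_reach_succ_zero
      · exact key t j (by omega) h fun p h1 h2 => Or.inl ⟨by simp [h1], by simp [h2]⟩

theorem reach_of_path {x y : Curve} {r : ℝ} (W : List (Fin x.complexity × Fin y.complexity))
    (h0 : ∃ p, W.head? = some p ∧ p.1.val = 0 ∧ p.2.val = 0) (hc : W.IsChain WarpStep)
    (hW : ∀ p ∈ W, dist (x.vertex p.1) (y.vertex p.2) ≤ r) :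
    ∀ p, W.getLast? = some p → Reach (Near x y r) (p.1.val + 1) (p.2.val + 1) := by
  induction W using List.reverseRecOn with
  | nil => simp
  | append_singleton W q ih =>
    intro p hp
    simp only [List.getLast?_append, List.getLast?_singleton, Option.some_or,
      Option.some.injEq] at hp
    subst hp
    rw [reach_succ_succ]
    refine ⟨⟨q.1.isLt, q.2.isLt, hW q (by simp)⟩, ?_⟩
    rcases W.eq_nil_or_concat with rfl | ⟨W', a, rfl⟩
    · obtain ⟨p, hp, h1, h2⟩ := h0
      simp only [List.nil_append, List.head?_cons, Option.some.injEq] at hp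
      subst hp
      rw [h1, h2]
      exact Or.inr (Or.inl (reach_zero.2 rfl))
    · have ha := ih (by
          obtain ⟨p, hp, h⟩ := h0
          refine ⟨p, ?_, h⟩
          rw [List.head?_append] at hp
          cases hh : (W' ++ [a]).head? with
          | none => simp at hh
          | some b => simpa [hh] using hp)
        (List.isChain_append.1 hc).1 (fun p hp => hW p (by simp at hp ⊢; tauto)) a (by simp)
      have hs : WarpStep a q := (List.isChain_append.1 hc).2.2 a (by simp) q (by simp)
      rcases hs with ⟨h1, h2⟩ | ⟨h1, h2⟩ | ⟨h1, h2⟩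
      · rw [← h1, ← h2] at ha; exact Or.inr (Or.inr ha)
      · rw [← h1, ← h2] at ha; exact Or.inl ha
      · rw [← h1, ← h2] at ha; exact Or.inr (Or.inl ha)

/-- Run along the second curve first and then along the first one. This serves to show that warping
paths exist. -/
theorem reach_of_forall {cl : ℕ → ℕ → Prop} {T J : ℕ} (h : ∀ t j, t < T → j < J → cl t j)
    (hT : 1 ≤ T) (hJ : 1 ≤ J) : Reach cl T J := by
  have h1 : ∀ j < J, Reach cl 1 (j + 1) := by
    intro j hj
    induction j with
    | zero => exact reach_succ_succ.2 ⟨h 0 0 (by omega) hj, Or.inr (Or.inl (reach_zero.2 rfl))⟩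
    | succ j ih => exact reach_succ_succ.2 ⟨h 0 _ (by omega) hj, Or.inr (Or.inr (ih (by omega)))⟩
  have h2 : ∀ t < T, Reach cl (t + 1) J := by
    intro t ht
    obtain ⟨j, rfl⟩ : ∃ j, J = j + 1 := ⟨J - 1, by omega⟩
    induction t with
    | zero => exact h1 j (by omega)
    | succ t ih => exact reach_succ_succ.2 ⟨h _ _ ht (by omega), Or.inl (ih (by omega))⟩
  have := h2 (T - 1) (by omega)
  rwa [show T - 1 + 1 = T by omega] at this

theorem exists_path_iff {x y : Curve} {r : ℝ} :
    (∃ W, IsWarpingPath x y W ∧ pathCost x y W ≤ r) ↔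
      Reach (Near x y r) x.complexity y.complexity := by
  have hx : x.complexity = (x.complexity - 1) + 1 := by have := x.pos; omega
  have hy : y.complexity = (y.complexity - 1) + 1 := by have := y.pos; omega
  constructor
  · rintro ⟨W, hW, hc⟩
    obtain ⟨p, hp, h1, h2⟩ := hW.last
    have := reach_of_path W hW.first hW.step (pathCost_le_iff.1 hc).2 p hp
    rwa [h1, h2] at this
  · intro h
    rw [hx, hy] at h
    have hr : 0 ≤ r := by
      obtain ⟨_, _, h'⟩ := (reach_succ_succ.1 h).1
      exact dist_nonneg.trans h'
    obtain ⟨W, h0, ⟨p, hp, h1, h2⟩, hc, hW⟩ := exists_path_of_reach h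
    exact ⟨W, ⟨h0, ⟨p, hp, by omega, by omega⟩, hc⟩, pathCost_le_iff.2 ⟨hr, hW⟩⟩

theorem discreteFrechet_le_iff {x y : Curve} {r : ℝ} :
    discreteFrechet x y ≤ r ↔ Reach (Near x y r) x.complexity y.complexity := by
  rw [← exists_path_iff]
  set S := {c | ∃ W, IsWarpingPath x y W ∧ c = pathCost x y W} with hS
  have hfin : S.Finite := by
    refine ((Set.finite_range fun p : Fin x.complexity × Fin y.complexity =>
      dist (x.vertex p.1) (y.vertex p.2)).insert 0).subset ?_
    rintro _ ⟨W, -, rfl⟩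
    exact pathCost_mem x y W
  have hne : S.Nonempty := by
    obtain ⟨R, hR⟩ := ((Set.finite_range fun p : Fin x.complexity × Fin y.complexity =>
      dist (x.vertex p.1) (y.vertex p.2))).bddAbove
    obtain ⟨W, hW, -⟩ := exists_path_iff.2 (reach_of_forall (cl := Near x y R)
      (fun t j ht hj => ⟨ht, hj, hR ⟨(⟨t, ht⟩, ⟨j, hj⟩), rfl⟩⟩) x.pos y.pos)
    exact ⟨_, W, hW, rfl⟩
  constructor
  · intro h
    obtain ⟨W, hW, e⟩ := hne.csInf_mem hfin
    exact ⟨W, hW, e ▸ h⟩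
  · rintro ⟨W, hW, h⟩
    exact (csInf_le hfin.bddBelow ⟨W, hW, rfl⟩).trans h

theorem centerCost_le_iff {n k : ℕ} (hn : 1 ≤ n) (hk : 1 ≤ k) {G : Fin n → Curve}
    {C : Fin k → Curve} {r : ℝ} :
    centerCost G C ≤ r ↔ ∀ g, ∃ i, discreteFrechet (C i) (G g) ≤ r := by
  have : Nonempty (Fin n) := ⟨⟨0, hn⟩⟩
  have : Nonempty (Fin k) := ⟨⟨0, hk⟩⟩
  unfold centerCost
  rw [ciSup_le_iff (Set.finite_range _).bddAbove]
  refine forall_congr' fun g => ⟨fun h => ?_, fun ⟨i, hi⟩ => ?_⟩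
  · obtain ⟨i, hi⟩ := exists_eq_ciInf_of_finite (f := fun i => discreteFrechet (C i) (G g))
    exact ⟨i, hi.trans_le h⟩
  · exact (ciInf_le (Set.finite_range _).bddBelow i).trans hi

/-- Repeating the last vertex of a center costs nothing, as each copy can be matched with the final
vertex of the other curve. So centers of exactly `ℓ` vertices suffice. -/
theorem Reach.pad {cl : ℕ → ℕ → Prop} {a b ℓ : ℕ} (ha : 1 ≤ a) (hb : 1 ≤ b) (h : Reach cl a b)
    (hℓ : a ≤ ℓ) : Reach (fun t j => cl (min t (a - 1)) j) ℓ b := by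
  obtain ⟨b, rfl⟩ : ∃ b', b = b' + 1 := ⟨b - 1, by omega⟩
  induction ℓ, hℓ using Nat.le_induction with
  | base =>
    refine h.mono fun t j ht _ hcl => ?_
    rwa [min_eq_left (by omega)]
  | succ ℓ hℓ ih =>
    refine reach_succ_succ.2 ⟨?_, Or.inl ih⟩
    rw [show a = (a - 1) + 1 by omega, reach_succ_succ] at h
    rw [min_eq_right (by omega)]
    exact h.1

theorem dist_eq_pdist (p q : Plane) : dist p q = pdist (p 0) (p 1) (q 0) (q 1) := by
  rw [EuclideanSpace.dist_eq, Fin.sum_univ_two, pdist, sqd, Real.dist_eq, Real.dist_eq, sq_abs,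
    sq_abs, sq, sq]

/-! ### The layout of input and output -/

/-- The complexities of a family of curves. -/
def comps {n : ℕ} (G : Fin n → Curve) (g : ℕ) : ℕ := if h : g < n then (G ⟨g, h⟩).complexity else 0

theorem allVerts_succ {n : ℕ} (G : Fin (n + 1) → Curve) :
    allVerts G = List.ofFn (G 0).vertex ++ allVerts fun g => G g.succ := by
  simp [allVerts, List.ofFn_succ]

theorem off_comps_succ {n : ℕ} (G : Fin (n + 1) → Curve) (g : ℕ) :
    off (comps G) (g + 1) = (G 0).complexity + off (comps fun g => G g.succ) g := by
  rw [off, Finset.sum_range_succ', add_comm, off]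
  congr 1
  refine Finset.sum_congr rfl fun i _ => ?_
  simp [comps]

theorem length_allVerts {n : ℕ} (G : Fin n → Curve) : (allVerts G).length = off (comps G) n := by
  induction n with
  | zero => simp [allVerts, off]
  | succ n ih => rw [allVerts_succ, off_comps_succ, List.length_append, ih, List.length_ofFn]

theorem getElem?_allVerts {n : ℕ} (G : Fin n → Curve) (g : Fin n) (j : Fin (G g).complexity) :
    (allVerts G)[off (comps G) g + j]? = some ((G g).vertex j) := by
  induction n with
  | zero => exact g.elim0
  | succ n ih =>
    rw [allVerts_succ]
    induction g using Fin.cases with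
    | zero =>
      rw [List.getElem?_append_left (by simp [off])]
      simp [off]
    | succ g =>
      rw [Fin.val_succ, off_comps_succ, List.getElem?_append_right (by simp; omega),
        List.length_ofFn, ← ih (fun g => G g.succ) g j]
      congr 1
      omega

theorem inputState_vertex {n : ℕ} (k ℓ : ℕ) (G : Fin n → Curve) (g : Fin n)
    (j : Fin (G g).complexity) :
    (inputState k ℓ G).rmem 0 (off (comps G) g + j) = (G g).vertex j 0 ∧
    (inputState k ℓ G).rmem 1 (off (comps G) g + j) = (G g).vertex j 1 := by
  obtain ⟨h, e⟩ := List.getElem?_eq_some_iff.1 (getElem?_allVerts G g j)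
  simp [inputState, h, e]

theorem inputState_comps {n : ℕ} (k ℓ : ℕ) (G : Fin n → Curve) :
    (inputState k ℓ G).nmem 0 = comps G := by
  funext g
  simp [inputState, comps]

/-- The curves of complexity `ℓ` whose vertices have the coordinates `CX`, `CY`. -/
noncomputable def curvesOf {k ℓ : ℕ} (hℓ : 1 ≤ ℓ) (CX CY : ℕ → ℝ) (i : Fin k) : Curve :=
  ⟨ℓ, hℓ, fun t => !₂[CX (i * ℓ + t), CY (i * ℓ + t)]⟩

theorem off_const (ℓ i : ℕ) : off (fun _ => ℓ) i = i * ℓ := by simp [off]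

theorem off_comps_curvesOf {k ℓ : ℕ} (hℓ : 1 ≤ ℓ) (CX CY : ℕ → ℝ) {i : ℕ} (hi : i ≤ k) :
    off (comps (curvesOf (k := k) hℓ CX CY)) i = i * ℓ := by
  rw [← off_const]
  refine Finset.sum_congr rfl fun j hj => ?_
  have := Finset.mem_range.1 hj
  simp [comps, curvesOf, show j < k by omega]

theorem outputs_curvesOf {k ℓ : ℕ} (hℓ : 1 ≤ ℓ) {s : State} (h1 : ∀ i < k, s.nmem 1 i = ℓ) :
    Outputs s (curvesOf (k := k) hℓ (s.rmem 2) (s.rmem 3)) (s.rreg 0) := by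
  refine ⟨fun i => h1 i i.isLt, fun j hj => ?_, rfl⟩
  have hj' := hj
  rw [length_allVerts, off_comps_curvesOf hℓ _ _ le_rfl, ← off_const] at hj'
  obtain ⟨i, hi, t, ht, rfl⟩ := exists_off hj'
  obtain ⟨h, e⟩ := List.getElem?_eq_some_iff.1
    (getElem?_allVerts (curvesOf (k := k) hℓ (s.rmem 2) (s.rmem 3)) ⟨i, hi⟩ ⟨t, ht⟩)
  simp only [off_comps_curvesOf hℓ _ _ hi.le, ← off_const ℓ i] at h e
  rw [e]
  simp [curvesOf, off_const]

theorem centerCost_le_of_feas {n k ℓ : ℕ} (hn : 1 ≤ n) (hk : 1 ≤ k) (hℓ : 1 ≤ ℓ) {G : Fin n → Curve}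
    {CX CY : ℕ → ℝ} {r : ℝ} (h : Feas n k ℓ (comps G) ((inputState k ℓ G).rmem 0)
      ((inputState k ℓ G).rmem 1) r CX CY) :
    centerCost G (curvesOf (k := k) hℓ CX CY) ≤ r := by
  rw [centerCost_le_iff hn hk]
  intro g
  obtain ⟨i, hi, hR⟩ := h g g.isLt
  have hc : comps G g = (G g).complexity := by simp [comps]
  refine ⟨⟨i, hi⟩, discreteFrechet_le_iff.2 ?_⟩
  rw [hc] at hR
  refine hR.mono fun t j ht hj hle => ⟨ht, hj, ?_⟩
  obtain ⟨e0, e1⟩ := inputState_vertex k ℓ G g ⟨j, hj⟩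
  rw [e0, e1] at hle
  rw [dist_eq_pdist]
  simpa [curvesOf] using hle

theorem feas_centerCost {n k ℓ : ℕ} (hn : 1 ≤ n) (hk : 1 ≤ k) (hℓ : 1 ≤ ℓ) (G : Fin n → Curve)
    {C : Fin k → Curve} (hC : ∀ i, (C i).complexity ≤ ℓ) :
    ∃ CX CY, Feas n k ℓ (comps G) ((inputState k ℓ G).rmem 0)
      ((inputState k ℓ G).rmem 1) (centerCost G C) CX CY := by
  let V' : Fin k → ℕ → Plane := fun i t =>
    (C i).vertex ⟨min t ((C i).complexity - 1), by have := (C i).pos; omega⟩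
  -- Vertex `t` of the padded center `i` gets number `i * ℓ + t`.
  let V : ℕ → Plane := fun u => if h : u / ℓ < k then V' ⟨u / ℓ, h⟩ (u % ℓ) else 0
  have hV : ∀ (i : Fin k) t (ht : t < ℓ), V (i * ℓ + t) = V' i t := by
    intro i t ht
    have e1 : (i * ℓ + t) / ℓ = i := by
      rw [mul_comm, Nat.mul_add_div hℓ, Nat.div_eq_of_lt ht, add_zero]
    have e2 : (i * ℓ + t) % ℓ = t := by rw [mul_comm, Nat.mul_add_mod, Nat.mod_eq_of_lt ht]
    have hlt : (i * ℓ + t) / ℓ < k := by rw [e1]; exact i.isLt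
    have e3 : (⟨(i * ℓ + t) / ℓ, hlt⟩ : Fin k) = i := Fin.ext e1
    simp only [V]
    rw [dif_pos hlt, e3, e2]
  refine ⟨fun u => V u 0, fun u => V u 1, fun g hg => ?_⟩
  obtain ⟨i, hi⟩ := (centerCost_le_iff hn hk).1 (le_refl (centerCost G C)) ⟨g, hg⟩
  have hc : comps G g = (G ⟨g, hg⟩).complexity := by simp [comps, hg]
  rw [discreteFrechet_le_iff] at hi
  refine ⟨i, i.isLt, ?_⟩
  rw [hc]
  refine (hi.pad (C i).pos (G ⟨g, hg⟩).pos (hC i)).mono fun t j ht hj => ?_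
  rintro ⟨h1, h2, hle⟩
  obtain ⟨e0, e1⟩ := inputState_vertex k ℓ G ⟨g, hg⟩ ⟨j, hj⟩
  show pdist (V (i * ℓ + t) 0) (V (i * ℓ + t) 1) _ _ ≤ _
  rw [hV i t ht, e0, e1, ← dist_eq_pdist]
  exact hle

end CurveClustering

/-! ### The complete program -/

namespace RealRAM
open PlaneGeometry CurveClustering

/-- Compute the registers `3` to `8`. -/
def setup : Program :=
  .setN 3 (.const 0) ;; .forN 70 0 (.setN 3 (.reg 3 + .get 0 (.reg 70))) ;;
  .setN 6 (.const 0) ;; .forN 70 1 (.setN 6 (.reg 6 + .reg 2)) ;;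
  (.setN 4 (.reg 1 - .const 1) ;; .setN 5 (.reg 2 - .const 1) ;; .setN 7 (.reg 6 - .const 1) ;;
    .setN 8 (.reg 7 + .reg 7))

/-- The program for the center problem. -/
def centerProgram : Program :=
  setup ;; listRadii ;; mergeSort ;; searchRadius ;; .setR 0 (.reg 1) ;;
  .forN 70 1 (.putN 1 (.reg 70) (.reg 2))

/-- Indices cannot be multiplied, so `k * ℓ` is computed by repeated addition; this takes `O(k)`
steps. -/
theorem setup_spec {n k ℓ : ℕ} {s : State} (h0 : s.nreg 0 = n) (h1 : s.nreg 1 = k)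
    (h2 : s.nreg 2 = ℓ) :
    Wp setup s (20 * n + 20 * k + 100)
      (Env n k ℓ (off (s.nmem 0) n) (s.nmem 0) (s.rmem 0) (s.rmem 1)) := by
  refine Wp.seq (T₁ := 2) (T₂ := 20 * n + 20 * k + 98) (Q₁ := fun s' => s'.nreg 3 = 0)
    (Wp.basic rfl (by decide) (by simp [Program.run])) (by omega) ?_
  intro s₁ h₁ hF₁
  refine Wp.seq (T₁ := n * (10 + 10) + 8) (T₂ := 20 * k + 90)
    (Q₁ := fun s' => s'.nreg 3 = off (s.nmem 0) n) ?_ (by omega) ?_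
  · refine Wp.forN (fun j s' => s'.nreg 3 = off (s.nmem 0) j)
      ((hF₁.nreg 0 (by decide)).trans h0) (by decide) (by decide) (by intro j s' v; simp)
      (by simp [h₁, off]) ?_ le_rfl (fun s' h _ => h)
    intro j s' hj hI hF h70
    have a0 : s'.nmem 0 = s.nmem 0 := (hF.nmem 0 (by decide)).trans (hF₁.nmem 0 (by decide))
    exact Wp.basic rfl (by decide) (by simp [Program.run, hI, h70, a0, off_succ])
  intro s₂ h₂ hF₂
  refine Wp.seq (T₁ := 2) (T₂ := 20 * k + 88) (Q₁ := fun s' => s'.nreg 6 = 0)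
    (Wp.basic rfl (by decide) (by simp [Program.run])) (by omega) ?_
  intro s₃ h₃ hF₃
  have a1 : s₃.nreg 1 = k := (hF₃.nreg 1 (by decide)).trans ((hF₂.nreg 1 (by decide)).trans
    ((hF₁.nreg 1 (by decide)).trans h1))
  have a2 : s₃.nreg 2 = ℓ := (hF₃.nreg 2 (by decide)).trans ((hF₂.nreg 2 (by decide)).trans
    ((hF₁.nreg 2 (by decide)).trans h2))
  refine Wp.seq (T₁ := k * (10 + 10) + 8) (T₂ := 80) (Q₁ := fun s' => s'.nreg 6 = k * ℓ) ?_
    (by omega) ?_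
  · refine Wp.forN (fun j s' => s'.nreg 6 = j * ℓ) a1 (by decide) (by decide)
      (by intro j s' v; simp) (by simp [h₃]) ?_ le_rfl (fun s' h _ => h)
    intro j s' hj hI hF h70
    have b2 : s'.nreg 2 = ℓ := (hF.nreg 2 (by decide)).trans a2
    exact Wp.basic rfl (by decide) (by simp [Program.run, hI, b2, Nat.succ_mul])
  intro s₄ h₄ hF₄
  have b0 : s₄.nreg 0 = n := (hF₄.nreg 0 (by decide)).trans ((hF₃.nreg 0 (by decide)).trans
    ((hF₂.nreg 0 (by decide)).trans ((hF₁.nreg 0 (by decide)).trans h0)))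
  have b1 : s₄.nreg 1 = k := (hF₄.nreg 1 (by decide)).trans a1
  have b2 : s₄.nreg 2 = ℓ := (hF₄.nreg 2 (by decide)).trans a2
  have b3 : s₄.nreg 3 = off (s.nmem 0) n :=
    (hF₄.nreg 3 (by decide)).trans ((hF₃.nreg 3 (by decide)).trans h₂)
  have c0 : s₄.nmem 0 = s.nmem 0 := (hF₄.nmem 0 (by decide)).trans ((hF₃.nmem 0 (by decide)).trans
    ((hF₂.nmem 0 (by decide)).trans (hF₁.nmem 0 (by decide))))
  have d0 : s₄.rmem 0 = s.rmem 0 := (hF₄.rmem 0 (by decide)).trans ((hF₃.rmem 0 (by decide)).trans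
    ((hF₂.rmem 0 (by decide)).trans (hF₁.rmem 0 (by decide))))
  have d1 : s₄.rmem 1 = s.rmem 1 := (hF₄.rmem 1 (by decide)).trans ((hF₃.rmem 1 (by decide)).trans
    ((hF₂.rmem 1 (by decide)).trans (hF₁.rmem 1 (by decide))))
  refine Wp.basic rfl (by decide) ⟨?_, ?_, ?_, ?_, ?_, ?_, ?_, ?_, ?_, ?_, ?_, ?_⟩ <;>
    simp [Program.run, b0, b1, b2, b3, h₄, c0, d0, d1, two_mul]

/-- `H` is `Nat.clog 2 M` for the number `M` of listed radii. It bounds the passes of the sort as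
well as the rounds of the search, and `M ≤ (m * n) ^ 3` makes it logarithmic. -/
theorem centerProgram_spec {n k ℓ N m : ℕ} {s : State} (h0 : s.nreg 0 = n) (h1 : s.nreg 1 = k)
    (h2 : s.nreg 2 = ℓ) (hS : Sizes n k ℓ N m (s.nmem 0))
    (hex : ∃ c CX CY, Feas n k ℓ (s.nmem 0) (s.rmem 0) (s.rmem 1) c CX CY) :
    ∃ H, (H = 0 ∨ 2 ^ (H - 1) ≤ (m * n) ^ 3) ∧
    Wp centerProgram s (60000 * ((H + 1) * ((m * n) ^ (2 * (k * ℓ)) * (k * ℓ)))) (fun s' =>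
      Feas n k ℓ (s.nmem 0) (s.rmem 0) (s.rmem 1) (s'.rreg 0) (s'.rmem 2) (s'.rmem 3) ∧
      (∀ c CX CY, Feas n k ℓ (s.nmem 0) (s.rmem 0) (s.rmem 1) c CX CY → s'.rreg 0 ≤ c) ∧
      ∀ i < k, s'.nmem 1 i = ℓ) := by
  have hQ : 1 ≤ m * n := Nat.mul_pos hS.m_pos hS.n_pos
  have hkl : 1 ≤ k * ℓ := Nat.mul_pos hS.k_pos hS.ℓ_pos
  have hk : k ≤ k * ℓ := Nat.le_mul_of_pos_right _ hS.ℓ_pos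
  have hn : n ≤ m * n := Nat.le_mul_of_pos_left _ hS.m_pos
  have hP : m * n ≤ (m * n) ^ (2 * (k * ℓ)) := Nat.le_self_pow (by omega) _
  have hPD : (m * n) ^ (2 * (k * ℓ)) ≤ (m * n) ^ (2 * (k * ℓ)) * (k * ℓ) :=
    Nat.le_mul_of_pos_right _ hkl
  have hkD : k * ℓ ≤ (m * n) ^ (2 * (k * ℓ)) * (k * ℓ) :=
    Nat.le_mul_of_pos_left _ (by omega)
  set P := (m * n) ^ (2 * (k * ℓ)) with hPdef
  set D := P * (k * ℓ) with hDdef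
  obtain ⟨s₁, t₁, hr₁, ht₁, hE⟩ := setup_spec h0 h1 h2
  rw [← hS.N_eq] at hE
  obtain ⟨s₂, t₂, hr₂, ht₂, hM1, hM3, hMP, hC⟩ := listRadii_spec hE hS
  have hE₂ := hE.of_frame hr₂.frame (by decide) (by decide) (by decide) (by decide)
  rw [← hPdef] at ht₂ hMP
  set M := s₂.nreg 50 with hM
  set H := Nat.clog 2 M with hH
  refine ⟨H, ?_, ?_⟩
  · rcases Nat.eq_zero_or_pos H with h | h
    · exact Or.inl h
    · refine Or.inr (le_trans (le_of_lt ?_) hM3)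
      exact (Nat.lt_clog_iff_pow_lt (by norm_num)).1 (by omega)
  have hHD : (M + 1) * (H + 1) ≤ 2 * ((H + 1) * D) := by
    calc (M + 1) * (H + 1) ≤ (2 * D) * (H + 1) := Nat.mul_le_mul_right _ (by omega)
      _ = 2 * ((H + 1) * D) := by ring
  have hDH : D ≤ (H + 1) * D := Nat.le_mul_of_pos_left _ (by omega)
  obtain ⟨s₃, t₃, hr₃, ht₃, h57, hMH, hpw, hs, hv⟩ := mergeSort_spec (s := s₂) hM.symm
  rw [← hH] at ht₃ h57
  have hE₃ := hE₂.of_frame hr₃.frame (by decide) (by decide) (by decide) (by decide)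
  have a50 : s₃.nreg 50 = M := hr₃.frame.nreg 50 (by decide)
  have hD57 : (s₃.nreg 57 + 1) * D ≤ (H + 1) * D := Nat.mul_le_mul_right _ (by omega)
  have ht : t₁ + (t₂ + t₃) ≤ 12000 * ((H + 1) * D) := by omega
  obtain ⟨s₄, t₄, hr₄, ht₄, hf, hmin⟩ := searchRadius_spec hE₃ hS a50 rfl hMH hpw rfl hs
    (hC.congr hv) hex
  have hE₄ := hE₃.of_frame hr₄.frame (by decide) (by decide) (by decide) (by decide)
  rw [← hPdef, ← hDdef] at ht₄
  have hfin : Wp (.setR 0 (.reg 1) ;; .forN 70 1 (.putN 1 (.reg 70) (.reg 2))) s₄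
      (20 * D + 30) (fun s' => s'.rreg 0 = s₄.rreg 1 ∧ s'.rmem 2 = s₄.rmem 2 ∧
        s'.rmem 3 = s₄.rmem 3 ∧ ∀ i < k, s'.nmem 1 i = ℓ) := by
    refine Wp.seq (T₁ := 2) (T₂ := 20 * D + 20) (Q₁ := fun s' => s'.rreg 0 = s₄.rreg 1)
      (Wp.basic rfl (by decide) (by simp [Program.run])) (by omega) ?_
    intro s₅ h₅ hF₅
    have b2 : s₅.nreg 2 = ℓ := (hF₅.nreg 2 (by decide)).trans hE₄.ℓ_eq
    refine Wp.forN (n := k) (B := 10) (fun j s' => ∀ i < j, s'.nmem 1 i = ℓ)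
      ((hF₅.nreg 1 (by decide)).trans hE₄.k_eq) (by decide) (by decide) (by intro j s' v; simp)
      (by simp) ?_ (by omega) ?_
    · intro j s' hj hI hF h70
      have c2 : s'.nreg 2 = ℓ := (hF.nreg 2 (by decide)).trans b2
      refine Wp.basic rfl (by decide) fun i hi => ?_
      rcases Nat.lt_succ_iff_lt_or_eq.1 hi with h | rfl
      · simp [Program.run, h70, h.ne, hI i h]
      · simp [Program.run, h70, c2]
    · intro s' h hF
      exact ⟨(hF.rreg 0 (by decide)).trans h₅,
        (hF.rmem 2 (by decide)).trans (hF₅.rmem 2 (by decide)),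
        (hF.rmem 3 (by decide)).trans (hF₅.rmem 3 (by decide)), h⟩
  obtain ⟨s₆, t₆, hr₆, ht₆, e0, e2, e3, h1'⟩ := hfin
  refine ⟨s₆, _, hr₁.seq (hr₂.seq (hr₃.seq (hr₄.seq hr₆))), by omega, ?_⟩
  simp only [e0, e2, e3]
  exact ⟨hf, hmin, h1'⟩

end RealRAM

/-! ### Running time and conclusion -/

open CurveClustering RealRAM in
theorem sizes_of_curves {n k ℓ m : ℕ} {G : Fin n → Curve} (hn : 1 ≤ n) (hk : 1 ≤ k) (hℓ : 1 ≤ ℓ)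
    (hm : ∀ g, (G g).complexity ≤ m) : Sizes n k ℓ (off (comps G) n) m (comps G) where
  n_pos := hn
  k_pos := hk
  ℓ_pos := hℓ
  m_pos := (G ⟨0, hn⟩).pos.trans_le (hm _)
  comp_le g hg := by simpa [comps, hg] using hm ⟨g, hg⟩
  comp_pos g hg := by simpa [comps, hg] using Nat.succ_le_of_lt (G ⟨g, hg⟩).pos
  N_eq := rfl

/-- In units of `log Q / log 2`, `H - 1` is at most `3` and the constant `2` is at most `2` because
`Q ≥ 2`; and `5 / log 2 < 8`. -/
theorem succ_le_mul_log {H Q : ℕ} (hQ : 2 ≤ Q) (h : H = 0 ∨ 2 ^ (H - 1) ≤ Q ^ 3) :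
    (H + 1 : ℝ) ≤ 8 * Real.log Q := by
  have h2 := Real.log_two_gt_d9
  have hlog : Real.log 2 ≤ Real.log Q := Real.log_le_log (by norm_num) (by exact_mod_cast hQ)
  rcases h with rfl | h
  · norm_num
    linarith
  · rcases Nat.eq_zero_or_pos H with rfl | hH
    · norm_num
      linarith
    obtain ⟨H, rfl⟩ : ∃ H', H = H' + 1 := ⟨H - 1, by omega⟩
    have h3 : (2 : ℝ) ^ H ≤ (Q : ℝ) ^ 3 := by exact_mod_cast h
    have h4 := Real.log_le_log (by positivity) h3
    rw [Real.log_pow, Real.log_pow] at h4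
    push_cast at h4 ⊢
    have hHn : (0 : ℝ) ≤ H := Nat.cast_nonneg H
    nlinarith

theorem theorem6 :
    ∃ (P : RealRAM.Program) (K : ℝ),
      ∀ (n m k ℓ : ℕ) (G : Fin n → CurveClustering.Curve),
        1 ≤ n → 1 ≤ k → 1 ≤ ℓ → (∀ g, (G g).complexity ≤ m) →
        ∃ (s : RealRAM.State) (t : ℕ) (C : Fin k → CurveClustering.Curve),
          RealRAM.Runs P (CurveClustering.inputState k ℓ G) s t ∧
          CurveClustering.IsCenterSolution ℓ G C ∧
          CurveClustering.Outputs s C (CurveClustering.centerCost G C) ∧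
          (2 ≤ m * n →
            (t : ℝ) ≤ K * (((m : ℝ) * n) ^ (2 * k * ℓ) * (k * ℓ * m) *
              Real.log ((m : ℝ) * n))) := by
  -- `480000 = 60000 * 8`: the constant of `centerProgram_spec` times that of `succ_le_mul_log`.
  refine ⟨RealRAM.centerProgram, 480000, fun n m k ℓ G hn hk hℓ hm => ?_⟩
  have hS := sizes_of_curves hn hk hℓ hm
  set s₀ := CurveClustering.inputState k ℓ G with hs₀
  rw [← CurveClustering.inputState_comps k ℓ G, ← hs₀] at hS
  have hfeas := fun C : Fin k → CurveClustering.Curve =>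
    CurveClustering.feas_centerCost hn hk hℓ G (C := C)
  rw [← CurveClustering.inputState_comps k ℓ G, ← hs₀] at hfeas
  -- Some radius is feasible: the cost of the centers all of whose vertices are the origin.
  obtain ⟨H, hH, s, t, hr, ht, hf, hmin, h1⟩ := RealRAM.centerProgram_spec (s := s₀) (n := n)
    (k := k) (ℓ := ℓ) (by simp [hs₀, CurveClustering.inputState])
    (by simp [hs₀, CurveClustering.inputState]) (by simp [hs₀, CurveClustering.inputState]) hS
    ⟨_, hfeas (CurveClustering.curvesOf hℓ (fun _ => 0) (fun _ => 0)) fun _ => le_rfl⟩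
  rw [hs₀, CurveClustering.inputState_comps] at hf
  have hle := CurveClustering.centerCost_le_of_feas hn hk hℓ hf
  have hopt : ∀ C : Fin k → CurveClustering.Curve, (∀ i, (C i).complexity ≤ ℓ) →
      s.rreg 0 ≤ CurveClustering.centerCost G C := fun C hC => by
    obtain ⟨CX, CY, h⟩ := hfeas C hC
    exact hmin _ CX CY h
  refine ⟨s, t, CurveClustering.curvesOf hℓ (s.rmem 2) (s.rmem 3), hr,
    ⟨fun _ => le_rfl, fun C hC => hle.trans (hopt C hC)⟩, ?_, fun hmn => ?_⟩
  -- The returned radius is an upper bound for the cost of the returned centers and a lower bound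
  -- for the cost of all centers, so it is their cost.
  · rw [le_antisymm hle (hopt _ fun _ => le_rfl)]
    exact CurveClustering.outputs_curvesOf hℓ h1
  · have hlog := succ_le_mul_log hmn hH
    have hm1 : (1 : ℝ) ≤ m := by exact_mod_cast hS.m_pos
    have ht' : (t : ℝ) ≤ 60000 * ((H + 1) * (((m : ℝ) * n) ^ (2 * (k * ℓ)) * (k * ℓ))) := by
      exact_mod_cast ht
    push_cast at hlog
    have hD : (0 : ℝ) ≤ ((m : ℝ) * n) ^ (2 * (k * ℓ)) * (k * ℓ) := by positivity
    have hL : 0 ≤ Real.log ((m : ℝ) * n) := Real.log_nonneg (by exact_mod_cast (by omega))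
    rw [mul_assoc 2 k ℓ]
    calc (t : ℝ) ≤ 60000 * ((H + 1) * (((m : ℝ) * n) ^ (2 * (k * ℓ)) * (k * ℓ))) := ht'
      _ ≤ 60000 * ((8 * Real.log ((m : ℝ) * n)) * (((m : ℝ) * n) ^ (2 * (k * ℓ)) * (k * ℓ))) := by
        gcongr
      _ = 480000 * (((m : ℝ) * n) ^ (2 * (k * ℓ)) * (k * ℓ) * Real.log ((m : ℝ) * n)) * 1 := by
        ring
      -- The factor `m ≥ 1` is given away here.
      _ ≤ 480000 * (((m : ℝ) * n) ^ (2 * (k * ℓ)) * (k * ℓ) * Real.log ((m : ℝ) * n)) * m := by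
        gcongr
      _ = _ := by ring
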